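/- **Setting.** Fix countably infinite sets of vertices and of (atomic) sequents, and a finite set $\mathtt E$ of edge types. Write $\overline{\mathtt E}=\{\bar a: a\in\mathtt E\}$, $\bar{\bar a}=a$. *G-sequents.* A g-sequent $\Gamma\vdash\Delta$ consists of a finite set $\Delta$ of prefixed sequents $w:S$, one for each of its finitely many vertices $w$, and a finite set $\Gamma$ of edge atoms $w\mathcal E_a u$ ($a\in\mathtt E$) between these vertices. Put $w\mathcal E_{\bar a}u:=u\mathcal E_a w$. For a string $s$ over $\mathtt E\cup\overline{\mathtt E}$, $w\mathcal E_s u$ means that $\Gamma$ contains a path from $w$ to $u$ reading $s$ (so $w=u$ if $s=\varepsilon$). *$\mathtt E$-systems.* An $\mathtt E$-system $\mathbf G$ is a finite set of productions $x\to s$ ($x\in\mathtt E\cup\overline{\mathtt E}$, $s\in(\mathtt E\cup\overline{\mathtt E})^*$) closed under $p=(x\to y_1\cdots y_k)\mapsto\bar p=(\bar x\to\bar y_k\cdots\bar y_1)$. $\mathbf G(a)$ denotes the language of the strings derivable from $a\in\mathtt E$. *Constraints.* A structural constraint $C=(V,E,L)$ is a finite (oriented) tree whose edges carry labels $L(w,u)=\mathbf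 G(a)$, a label being given by the pair of the system $\mathbf G$ and $a\in\mathtt E$. A g-sequent satisfies $C$, for a given assignment of its vertices to the vertices of $C$, if for each edge $(w,u)$ of $C$ with label $\mathbf G(a)$ it has a path from (the vertex assigned to) $w$ to (that assigned to) $u$ reading a string of $\mathbf G(a)$. A sequent constraint $R$ is a relation between $k$ sequents and a set of prefixed sequents (for some $k$); "$S_1,\dots,S_k,\Delta$ satisfy $R$" means that some reordering of $S_1,\dots,S_k$ is related to $\Delta$. *Rules.* In all rules $w,u$ stand for arbitrary vertices. - Initial rule $i(C,R)$: conclude $\Gamma\vdash\Delta$ without premises if it satisfies $C$ for some assignment, and the sequents at the vertices assigned to those of $C$, together with the rest of $\Delta$, satisfy $R$. - Local rule $l(R)$: from $\Gamma\vdash\Delta,w:S_i$ ($1\le i\le m$, $m\geq 1$) conclude $\Gamma\vdash\Delta,w:S$, if $S_1,\dots,S_m,S,\Delta$ satisfy $R$. - Expansion rule $e(R)$, of type $x\in\mathtt E\cup\overline{\mathtt E}$: from $\Gamma,w\mathcal E_xu\vdash\Delta,w:S_1,u:S_2$ conclude $\Gamma\vdash\Delta,w:S$, if $u$ does not occur in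 the conclusion and $S_1,S_2,S,\Delta$ satisfy $R$. - Horn rules: the forward rule $h_f$ for $a\to s$ (the backward rule $h_b$ for $\bar a\to s$) infers $\Gamma,w\mathcal E_su\vdash\Delta$ from $\Gamma,w\mathcal E_su,w\mathcal E_au\vdash\Delta$ (from $\Gamma,w\mathcal E_su,u\mathcal E_aw\vdash\Delta$). - Reachability rule $r(\mathcal C,R)$, $\mathcal C=(C_1,\dots,C_m)$, $C_i=(\{w,u\},\{(w,u)\},L_i)$, $m\ge1$: from $\Gamma\vdash\Delta,w:S_i,u:S_i'$ ($1\le i\le m$) conclude $\Gamma\vdash\Delta,w:S,u:S'$, if the $i$-th premise satisfies $C_i$ and $S_1,S_1',\dots,S_m,S_m',S,S',\Delta$ satisfy $R$. *Calculi.* An abstract calculus $\mathfrak A$ over $\mathtt E$ is a finite set of such rules; $\mathrm H(\mathfrak A)$ is its set of Horn rules. A proof is a finite tree of rule applications (each node records its rule and its conclusion) whose leaves are applications of initial rules. The grammar $\mathbf G(\rho)$ of an initial or reachability rule is the union of all systems in its labels; $\mathbf G(h)=\{p,\bar p\}$ for the Horn rule $h$ of the production $p$; $\mathbf G(\rho)=\emptyset$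 for local and expansion rules; the grammar of a set of rules is the union of the grammars of its members. $\rho\oplus\mathbf G$ (resp. $\rho\ominus\mathbf G$) replaces each label $\mathbf G'(a)$ of an initial or reachability rule $\rho$ by $(\mathbf G'\cup\mathbf G)(a)$ (resp. $(\mathbf G'\setminus\mathbf G)(a)$); other rules are unchanged, and $\oplus$ is extended to calculi rule by rule. $\mathfrak A$ is *explicit* if $\rho\ominus\mathbf G(\mathfrak A)=\rho$ for each of its initial and reachability rules, and *implicit* if it has no Horn rules and $\rho\oplus\mathbf G(\mathfrak A)=\rho$ for each of its initial and reachability rules. *Upward space.* For a finite set $\mathrm H$ of Horn rules, let $\sqsubseteq$ be the following preorder on $\mathrm H$: for $\mathbf G(h)\neq\mathbf G(h')$ put $h\sqsubset h'$ if the left-hand side of a production of $\mathbf G(h')$ occurs in the right-hand side of a production of $\mathbf G(h)$; $\sqsubseteq$ is the reflexive-transitive closure, rules with the same grammar being identified. $V\subseteq\mathrm H$ is fracturable if there are no $h\in V$, $h'\in\mathrm H\setminus V$ with $h\sqsubseteq h'$; complements in $\mathrm H$ of fracturable sets are called anti-fracturable. Put $f(\mathfrak A,\mathrm H')=(\mathfrak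 A\oplus\mathbf G(\mathrm H'))\setminus\mathrm H'$. The upward space $(\mathbf S,\eqslantless)$ of $\mathfrak A$ is defined inductively: $\mathfrak A\in\mathbf S$; if $\mathfrak B\in\mathbf S$ and $\mathrm H'$ is an anti-fracturable subset of $\mathrm H(\mathfrak B)$, then $f(\mathfrak B,\mathrm H')\in\mathbf S$ and $\mathfrak B\eqslantless f(\mathfrak B,\mathrm H')$. *IMPLICATE$(\mathfrak A)$:* start with $\mathbf S=\{\mathfrak A\}$ and ${\eqslantless}=\emptyset$; as long as $(\mathbf S,\eqslantless)$ grows, for each $\eqslantless$-maximal $\mathfrak B\in\mathbf S$ and each anti-fracturable $\mathrm H'\subseteq\mathrm H(\mathfrak B)$ add $f(\mathfrak B,\mathrm H')$ to $\mathbf S$ and $\mathfrak B\eqslantless f(\mathfrak B,\mathrm H')$ to $\eqslantless$; return $(\mathbf S,\eqslantless)$. *Polynomial equivalence.* $\mathfrak B\dashv\vdash_p\mathfrak C$ means: the same g-sequents have proofs in $\mathfrak B$ and in $\mathfrak C$, and there are polynomial-time functions that turn each proof in $\mathfrak B$ into a proof of the same g-sequent in $\mathfrak C$, and vice versa. For computations,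 finite sets are given by lists in any order and sequent constraints by names; calculi are given by the list of their edge types and rules, spaces by the lists of their calculi and of the pairs in their relation. **Theorem.** Let $\mathfrak A$ be an explicit calculus with upward space $(\mathbf S,\eqslantless)$. Then 1. IMPLICATE$(\mathfrak A)$ terminates and returns $(\mathbf S,\eqslantless)$; 2. $(\mathbf S,\eqslantless)$ is computable from $\mathfrak A$ in EXPTIME, i.e. in time $2^{\mathrm{poly}}$ in the size of $\mathfrak A$; 3. if $\mathfrak B,\mathfrak C\in\mathbf S$, then $\mathfrak B\dashv\vdash_p\mathfrak C$; 4. $(\mathbf S,\eqslantless)$ has a unique top element $\top$ (a member of $\mathbf S$ with $\mathfrak B\eqslantless\top$ for all $\mathfrak B\in\mathbf S$), and $\top$ is computable from $\mathfrak A$ in PTIME; 5. $\top$ is implicit, and it is the only implicit calculus in $\mathbf S$. In 2 and 4 one algorithm works for all explicit calculi, over all finite sets of edge types. -/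

import Mathlib

namespace AbsCalc

/-! ## Edge types, strings, `E`-systems

The set of edge types is `Fin n`; vertices and sequents are atoms, taken from two countably
infinite sets. -/

abbrev Vertex := ℕ

abbrev Sequent := ℕ

/-- An element of `E ∪ Ē`: `(a, false)` is the edge type `a`, and `(a, true)` is its converse. -/
abbrev Letter (n : ℕ) := Fin n × Bool

abbrev Str (n : ℕ) := List (Letter n)

def Letter.conv {n : ℕ} (x : Letter n) : Letter n := (x.1, !x.2)

def Str.conv {n : ℕ} (s : Str n) : Str n := (s.map Letter.conv).reverse

/-- A production rule `x ⟶ s` whose left-hand side is a single letter. -/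
abbrev Production (n : ℕ) := Letter n × Str n

def Production.conv {n : ℕ} (p : Production n) : Production n :=
  (Letter.conv p.1, Str.conv p.2)

theorem Letter.conv_conv {n : ℕ} (x : Letter n) : Letter.conv (Letter.conv x) = x := by
  simp [Letter.conv]

theorem Str.conv_conv {n : ℕ} (s : Str n) : Str.conv (Str.conv s) = s := by
  simp [Str.conv, List.map_reverse, Function.comp_def, Letter.conv_conv]

theorem Production.conv_conv {n : ℕ} (p : Production n) :
    Production.conv (Production.conv p) = p := by
  simp [Production.conv, Letter.conv_conv, Str.conv_conv]

/-- A finite set of production rules that is closed under converses. -/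
@[ext]
structure ESystem (n : ℕ) where
  rules : Finset (Production n)
  closed : ∀ p, p ∈ rules ↔ Production.conv p ∈ rules

namespace ESystem

variable {n : ℕ}

def empty : ESystem n := ⟨∅, by simp⟩

def union (G G' : ESystem n) : ESystem n :=
  ⟨G.rules ∪ G'.rules, fun p => by
    simp only [Finset.mem_union, ← G.closed p, ← G'.closed p]⟩

def sdiff (G G' : ESystem n) : ESystem n :=
  ⟨G.rules \ G'.rules, fun p => by
    simp only [Finset.mem_sdiff, ← G.closed p, ← G'.closed p]⟩

/-- The union of a finite family. -/
def biUnion {α : Type} (s : Finset α) (g : α → ESystem n) : ESystem n :=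
  ⟨s.biUnion fun a => (g a).rules, fun p => by
    simp only [Finset.mem_biUnion]
    exact exists_congr fun a => and_congr_right fun _ => (g a).closed p⟩

/-- The system `{p, p̄}`. -/
def pair (p : Production n) : ESystem n :=
  ⟨{p, Production.conv p}, fun q => by
    simp only [Finset.mem_insert, Finset.mem_singleton]
    constructor
    · rintro (rfl | rfl)
      · exact Or.inr rfl
      · exact Or.inl (Production.conv_conv _)
    · rintro (h | h)
      · exact Or.inr (by rw [← h, Production.conv_conv])
      · exact Or.inl (by rw [← Production.conv_conv q, h, Production.conv_conv])⟩

/-- One rewriting step on strings. -/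
def Step (G : ESystem n) (t t' : Str n) : Prop :=
  ∃ p ∈ G.rules, ∃ l r : Str n, t = l ++ p.1 :: r ∧ t' = l ++ p.2 ++ r

/-- The language `G(a)` of an edge type `a`. -/
def lang (G : ESystem n) (a : Fin n) : Set (Str n) :=
  {t | Relation.ReflTransGen G.Step [(a, false)] t}

/-- The production pairs of `G`; a pair is represented by the system `{p, p̄}`, so that the pairs
`(p, p̄)` and `(p̄, p)` are identified. -/
def pairs (G : ESystem n) : Set (ESystem n) := {q | ∃ p ∈ G.rules, q = pair p}

/-- The pair `q'` depends on the pair `q` in `G`: the two are distinct, and a right-hand side in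
`q` contains a left-hand side in `q'`. -/
def Dep (G : ESystem n) (q q' : ESystem n) : Prop :=
  q ∈ G.pairs ∧ q' ∈ G.pairs ∧ q ≠ q' ∧ ∃ p ∈ q.rules, ∃ p' ∈ q'.rules, p'.1 ∈ p.2

end ESystem

/-! ## Generalized sequents -/

/-- The edge atom expressing that `x` leads from `w` to `u`; it is `w E_a u` for `x = a`, and
`u E_a w` for `x = ā`. -/
def edgeAtom {n : ℕ} (w : Vertex) (x : Letter n) (u : Vertex) : Vertex × Fin n × Vertex :=
  if x.2 then (u, x.1, w) else (w, x.1, u)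

/-- A (finite) g-sequent `Γ ⊢ Δ`: a set of edge atoms and a set of prefixed sequents that labels
each vertex with exactly one sequent; the vertices are the ones labelled by `Δ`. -/
@[ext]
structure GSeq (n : ℕ) where
  ant : Finset (Vertex × Fin n × Vertex)
  suc : Finset (Vertex × Sequent)
  functional : ∀ w S S', (w, S) ∈ suc → (w, S') ∈ suc → S = S'
  src_mem : ∀ w a u, (w, a, u) ∈ ant → w ∈ suc.image Prod.fst
  tgt_mem : ∀ w a u, (w, a, u) ∈ ant → u ∈ suc.image Prod.fst

namespace GSeq

variable {n : ℕ}

def verts (G : GSeq n) : Finset Vertex := G.suc.image Prod.fst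

/-- There is a path from `w` to `u` in `G` that reads the string. -/
def Path (G : GSeq n) : Str n → Vertex → Vertex → Prop
  | [], w, u => w ∈ G.verts ∧ w = u
  | x :: s, w, u => ∃ v, edgeAtom w x v ∈ G.ant ∧ G.Path s v u

/-- There is a path from `w` to `u` in `G` that reads a string of the language. -/
def LangPath (G : GSeq n) (K : Set (Str n)) (w u : Vertex) : Prop :=
  ∃ s ∈ K, G.Path s w u

end GSeq

/-! ## Structural constraints and sequent constraints -/

/-- A label `G(a)` of an edge of a constraint, kept as the system `G` and the edge type `a`. -/
abbrev Label (n : ℕ) := ESystem n × Fin n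

namespace Label

variable {n : ℕ}

def lang (L : Label n) : Set (Str n) := L.1.lang L.2

def absorb (L : Label n) (G : ESystem n) : Label n := (L.1.union G, L.2)

def fracture (L : Label n) (G : ESystem n) : Label n := (L.1.sdiff G, L.2)

end Label

/-- A finite tree with an orientation of each edge. -/
def IsOrientedTree (V : Finset Vertex) (E : Finset (Vertex × Vertex)) : Prop :=
  (∀ e ∈ E, e.1 ∈ V ∧ e.2 ∈ V) ∧ (∀ x y, (x, y) ∈ E → (y, x) ∉ E) ∧
    (SimpleGraph.fromRel fun x y : {v // v ∈ V} => (x.1, y.1) ∈ E).IsTree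

/-- A structural constraint `(V, E, L)`. -/
structure Constraint (n : ℕ) where
  verts : Finset Vertex
  edges : Finset (Vertex × Vertex)
  label : {e // e ∈ edges} → Label n
  tree : IsOrientedTree verts edges

namespace Constraint

variable {n : ℕ}

def absorb (C : Constraint n) (G : ESystem n) : Constraint n :=
  { C with label := fun e => (C.label e).absorb G }

def fracture (C : Constraint n) (G : ESystem n) : Constraint n :=
  { C with label := fun e => (C.label e).fracture G }

/-- The union of all systems that participate in `C`. -/
def grammar (C : Constraint n) : ESystem n :=
  ESystem.biUnion C.edges.attach fun e => (C.label e).1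

/-- `G` satisfies `C` when the vertices of `C`, which are place holders, are matched with vertices
of `G` by `θ`. -/
def Satisfied (C : Constraint n) (G : GSeq n) (θ : Vertex → Vertex) : Prop :=
  (∀ v ∈ C.verts, θ v ∈ G.verts) ∧
    ∀ e : {e // e ∈ C.edges}, G.LangPath (C.label e).lang (θ e.1.1) (θ e.1.2)

end Constraint

/-- A sequent constraint: a relation `R ⊆ S × ⋯ × S × 2^PS`. -/
structure SeqConstraint where
  arity : ℕ
  rel : Set ((Fin arity → Sequent) × Set (Vertex × Sequent))

/-- The sequents of the list, in some order, and `Δ` are in the relation. -/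
def SeqConstraint.Sat (R : SeqConstraint) (l : List Sequent) (Δ : Set (Vertex × Sequent)) :
    Prop :=
  ∃ v : Fin R.arity → Sequent, (List.ofFn v).Perm l ∧ (v, Δ) ∈ R.rel

/-! ## Inference rules -/

/-- Inference rules. An expansion rule `exp x R` introduces, read bottom-up, an edge of the form
`x` from a vertex to a fresh one. The rules `hornF a s` and `hornB a s` are the forward and the
backward Horn rule; they belong to the productions `a ⟶ s` and `ā ⟶ s`. In `reach fam R` the list
is the constraint family: its `i`-th member is the constraint `({w, u}, {(w, u)}, L_i)`, given by
the label `L_i (w, u)`. -/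
inductive Rule (n : ℕ) where
  | init (C : Constraint n) (R : SeqConstraint)
  | loc (R : SeqConstraint)
  | exp (x : Letter n) (R : SeqConstraint)
  | hornF (a : Fin n) (s : Str n)
  | hornB (a : Fin n) (s : Str n)
  | reach (fam : List (Label n)) (R : SeqConstraint)

noncomputable instance {n : ℕ} : DecidableEq (Rule n) := Classical.decEq _

namespace Rule

variable {n : ℕ}

def IsHorn : Rule n → Prop
  | hornF _ _ => True
  | hornB _ _ => True
  | _ => False

/-- The grammar of a rule. -/
def grammar : Rule n → ESystem n
  | init C _ => C.grammar
  | loc _ => ESystem.empty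
  | exp _ _ => ESystem.empty
  | hornF a s => ESystem.pair ((a, false), s)
  | hornB a s => ESystem.pair ((a, true), s)
  | reach fam _ => fam.foldr (fun L G => L.1.union G) ESystem.empty

/-- The operation `⊕`; only initial and reachability rules are changed. -/
def absorb (G : ESystem n) : Rule n → Rule n
  | init C R => init (C.absorb G) R
  | reach fam R => reach (fam.map fun L => L.absorb G) R
  | ρ => ρ

/-- The operation `⊖`; only initial and reachability rules are changed. -/
def fracture (G : ESystem n) : Rule n → Rule n
  | init C R => init (C.fracture G) R
  | reach fam R => reach (fam.map fun L => L.fracture G) R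
  | ρ => ρ

/-- `Infer ρ Ps G`: the rule `ρ` has an application with the premises `Ps` and the conclusion `G`.
Initial rules are the only ones that can be applied without premises. -/
def Infer : Rule n → List (GSeq n) → GSeq n → Prop
  | init C R, Ps, G => Ps = [] ∧ ∃ (θ : Vertex → Vertex) (S : Vertex → Sequent),
      C.Satisfied G θ ∧ (∀ v ∈ C.verts, (θ v, S v) ∈ G.suc) ∧
      R.Sat (C.verts.toList.map S) {q | q ∈ G.suc ∧ ∀ v ∈ C.verts, q.1 ≠ θ v}
  | loc R, Ps, G => Ps ≠ [] ∧
      ∃ (w : Vertex) (S : Sequent) (Δ : Finset (Vertex × Sequent)) (Ss : List Sequent),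
        (∀ q ∈ Δ, q.1 ≠ w) ∧ G.suc = insert (w, S) Δ ∧
        List.Forall₂ (fun P S' => P.ant = G.ant ∧ P.suc = insert (w, S') Δ) Ps Ss ∧
        R.Sat (Ss ++ [S]) ↑Δ
  | exp x R, Ps, G =>
      ∃ (P : GSeq n) (w u : Vertex) (S S₁ S₂ : Sequent) (Δ : Finset (Vertex × Sequent)),
        Ps = [P] ∧ (∀ q ∈ Δ, q.1 ≠ w) ∧ G.suc = insert (w, S) Δ ∧ u ∉ G.verts ∧
        P.ant = insert (edgeAtom w x u) G.ant ∧
        P.suc = insert (w, S₁) (insert (u, S₂) Δ) ∧ R.Sat [S₁, S₂, S] ↑Δ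
  | hornF a s, Ps, G => ∃ (P : GSeq n) (w u : Vertex), Ps = [P] ∧ G.Path s w u ∧
      P.ant = insert (w, a, u) G.ant ∧ P.suc = G.suc
  | hornB a s, Ps, G => ∃ (P : GSeq n) (w u : Vertex), Ps = [P] ∧ G.Path s w u ∧
      P.ant = insert (u, a, w) G.ant ∧ P.suc = G.suc
  | reach fam R, Ps, G => Ps ≠ [] ∧
      ∃ (w u : Vertex) (S S' : Sequent) (Δ : Finset (Vertex × Sequent))
        (Ss : List (Sequent × Sequent)),
        (∀ q ∈ Δ, q.1 ≠ w ∧ q.1 ≠ u) ∧ G.suc = insert (w, S) (insert (u, S') Δ) ∧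
        List.Forall₂ (fun P T => P.ant = G.ant ∧
          P.suc = insert (w, T.1) (insert (u, T.2) Δ)) Ps Ss ∧
        List.Forall₂ (fun P L => GSeq.LangPath P (Label.lang L) w u) Ps fam ∧
        R.Sat (Ss.flatMap (fun T => [T.1, T.2]) ++ [S, S']) ↑Δ

end Rule

/-! ## Abstract calculi -/

/-- An abstract calculus over the edge types `Fin n`: a finite set of rules. -/
abbrev Calculus (n : ℕ) := Finset (Rule n)

/-- The grammar of a set of rules. -/
def grammarOf {n : ℕ} (A : Finset (Rule n)) : ESystem n := ESystem.biUnion A Rule.grammar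

open Classical in
/-- The set of Horn rules of a calculus. -/
noncomputable def hornRules {n : ℕ} (A : Calculus n) : Finset (Rule n) := A.filter Rule.IsHorn

/-- `A ⊕ G` -/
noncomputable def absorbCalc {n : ℕ} (A : Calculus n) (G : ESystem n) : Calculus n :=
  A.image (Rule.absorb G)

/-- `f(A, H) = (A ⊕ G(H)) \ H` -/
noncomputable def absorbHorn {n : ℕ} (A : Calculus n) (H : Finset (Rule n)) : Calculus n :=
  absorbCalc A (grammarOf H) \ H

/-- The equation is trivial for the rules that are neither initial nor reachability rules. -/
def Explicit {n : ℕ} (A : Calculus n) : Prop :=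
  ∀ ρ ∈ A, ρ.fracture (grammarOf A) = ρ

/-- The equation is trivial for the rules that are neither initial nor reachability rules. -/
def Implicit {n : ℕ} (A : Calculus n) : Prop :=
  (∀ ρ ∈ A, ¬ ρ.IsHorn) ∧ ∀ ρ ∈ A, ρ.absorb (grammarOf A) = ρ

/-! ## Dependency graph and upward space -/

/-- The order of the dependency graph of a set `H` of Horn rules. -/
def HornLE {n : ℕ} (H : Finset (Rule n)) (h h' : Rule n) : Prop :=
  Relation.ReflTransGen (grammarOf H).Dep h.grammar h'.grammar

def Fracturable {n : ℕ} (H V : Finset (Rule n)) : Prop :=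
  V ⊆ H ∧ ∀ h ∈ V, ∀ h' ∈ H \ V, ¬ HornLE H h h'

def AntiFracturable {n : ℕ} (H V : Finset (Rule n)) : Prop :=
  ∃ V', Fracturable H V' ∧ V = H \ V'

/-- A set of calculi with a binary relation. -/
@[ext]
structure Space (n : ℕ) where
  carrier : Set (Calculus n)
  le : Set (Calculus n × Calculus n)

inductive UpMem {n : ℕ} (A : Calculus n) : Calculus n → Prop
  | base : UpMem A A
  | step {B : Calculus n} {H : Finset (Rule n)} :
      UpMem A B → AntiFracturable (hornRules B) H → UpMem A (absorbHorn B H)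

/-- The upward space of a calculus. -/
def upSpace {n : ℕ} (A : Calculus n) : Space n where
  carrier := {B | UpMem A B}
  le := {q | UpMem A q.1 ∧
    ∃ H, AntiFracturable (hornRules q.1) H ∧ q.2 = absorbHorn q.1 H}

/-- `T` is the top element of the space. -/
def Space.IsTop {n : ℕ} (X : Space n) (T : Calculus n) : Prop :=
  T ∈ X.carrier ∧ ∀ B ∈ X.carrier, (B, T) ∈ X.le

def Space.IsMaximal {n : ℕ} (X : Space n) (B : Calculus n) : Prop :=
  B ∈ X.carrier ∧ ∀ C ∈ X.carrier, (B, C) ∈ X.le → C = B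

/-! ## The algorithm IMPLICATE -/

/-- One execution of the body of the while-loop. -/
def implicateRound {n : ℕ} (X : Space n) : Space n where
  carrier := X.carrier ∪ {C | ∃ B H, X.IsMaximal B ∧ AntiFracturable (hornRules B) H ∧
    C = absorbHorn B H}
  le := X.le ∪ {q | ∃ B H, X.IsMaximal B ∧ AntiFracturable (hornRules B) H ∧
    q = (B, absorbHorn B H)}

/-- The space after `k` executions of the body of the while-loop. -/
def implicateStage {n : ℕ} (A : Calculus n) (k : ℕ) : Space n :=
  implicateRound^[k] ⟨{A}, ∅⟩

/-- On input `A` the loop is left, namely after the first execution of its body in which the space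
does not grow, and `X` is returned. -/
def ImplicateReturns {n : ℕ} (A : Calculus n) (X : Space n) : Prop :=
  ∃ k, (∀ j < k, implicateStage A (j + 1) ≠ implicateStage A j) ∧
    implicateStage A (k + 1) = implicateStage A k ∧ X = implicateStage A k

/-! ## Proofs -/

/-- A tree of rule applications; a node holds a rule, the conclusion, and the trees above it. -/
inductive ProofTree (n : ℕ) where
  | node (ρ : Rule n) (G : GSeq n) (subs : List (ProofTree n))

def ProofTree.concl {n : ℕ} : ProofTree n → GSeq n
  | node _ G _ => G

/-- The tree is a proof in the calculus `A`; its leaves are applications of initial rules, as no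
other rule can be applied without premises. -/
inductive IsProof {n : ℕ} (A : Calculus n) : ProofTree n → Prop
  | node {ρ : Rule n} {G : GSeq n} {subs : List (ProofTree n)} :
      ρ ∈ A → ρ.Infer (subs.map ProofTree.concl) G → (∀ t ∈ subs, IsProof A t) →
      IsProof A (ProofTree.node ρ G subs)

def IsProofOf {n : ℕ} (A : Calculus n) (G : GSeq n) (t : ProofTree n) : Prop :=
  IsProof A t ∧ t.concl = G

/-! ## Time-bounded computation

The machine model is the language of while-programs over binary trees, with a cost that also
charges for the sizes of all trees that are copied, built or compared; a run of cost `t` can thus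
be simulated by a Turing machine in time polynomial in `t` and the size of the input, and a Turing
machine is simulated by a while-program with polynomial overhead. -/

inductive Data where
  | nil
  | cons (l r : Data)

namespace Data

def size : Data → ℕ
  | nil => 1
  | cons l r => l.size + r.size + 1

def hd : Data → Data
  | nil => nil
  | cons l _ => l

def tl : Data → Data
  | nil => nil
  | cons _ r => r

end Data

abbrev Store := ℕ → Data

inductive Expr where
  | var (x : ℕ)
  | nil
  | cons (e₁ e₂ : Expr)
  | hd (e : Expr)
  | tl (e : Expr)
  | eq (e₁ e₂ : Expr)

namespace Expr

open Classical in
/-- The value; `nil` stands for false, and every other tree for true. -/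
noncomputable def eval (σ : Store) : Expr → Data
  | var x => σ x
  | nil => Data.nil
  | cons e₁ e₂ => Data.cons (e₁.eval σ) (e₂.eval σ)
  | hd e => (e.eval σ).hd
  | tl e => (e.eval σ).tl
  | eq e₁ e₂ => if e₁.eval σ = e₂.eval σ then Data.cons Data.nil Data.nil else Data.nil

/-- The cost of the evaluation. -/
def cost (σ : Store) : Expr → ℕ
  | var x => (σ x).size
  | nil => 1
  | cons e₁ e₂ => e₁.cost σ + e₂.cost σ + 1
  | hd e => e.cost σ + 1
  | tl e => e.cost σ + 1
  | eq e₁ e₂ => e₁.cost σ + e₂.cost σ + 1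

end Expr

inductive Cmd where
  | assign (x : ℕ) (e : Expr)
  | seq (c₁ c₂ : Cmd)
  | ite (e : Expr) (c₁ c₂ : Cmd)
  | loop (e : Expr) (c : Cmd)

/-- `Exec c σ t σ'`: started in `σ`, the program `c` halts with cost `t` in `σ'`. The command
`loop e c` is `while e do c`. -/
inductive Exec : Cmd → Store → ℕ → Store → Prop
  | assign (x : ℕ) (e : Expr) (σ : Store) :
      Exec (Cmd.assign x e) σ (e.cost σ + 1) (Function.update σ x (e.eval σ))
  | seq {c₁ c₂ : Cmd} {σ σ₁ σ₂ : Store} {t₁ t₂ : ℕ} :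
      Exec c₁ σ t₁ σ₁ → Exec c₂ σ₁ t₂ σ₂ → Exec (Cmd.seq c₁ c₂) σ (t₁ + t₂) σ₂
  | iteTrue {e : Expr} {c₁ c₂ : Cmd} {σ σ' : Store} {t : ℕ} :
      e.eval σ ≠ Data.nil → Exec c₁ σ t σ' → Exec (Cmd.ite e c₁ c₂) σ (e.cost σ + 1 + t) σ'
  | iteFalse {e : Expr} {c₁ c₂ : Cmd} {σ σ' : Store} {t : ℕ} :
      e.eval σ = Data.nil → Exec c₂ σ t σ' → Exec (Cmd.ite e c₁ c₂) σ (e.cost σ + 1 + t) σ'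
  | loopDone {e : Expr} {c : Cmd} {σ : Store} :
      e.eval σ = Data.nil → Exec (Cmd.loop e c) σ (e.cost σ + 1) σ
  | loopStep {e : Expr} {c : Cmd} {σ σ₁ σ₂ : Store} {t₁ t₂ : ℕ} :
      e.eval σ ≠ Data.nil → Exec c σ t₁ σ₁ → Exec (Cmd.loop e c) σ₁ t₂ σ₂ →
      Exec (Cmd.loop e c) σ (e.cost σ + 1 + t₁ + t₂) σ₂

/-- Input and output are the values of variable `0`; all other variables start with `nil`. -/
def Runs (c : Cmd) (d : Data) (t : ℕ) (d' : Data) : Prop :=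
  ∃ σ, Exec c (Function.update (fun _ => Data.nil) 0 d) t σ ∧ σ 0 = d'

/-- A computational problem: `Q d O` says that `d` is an input and that `O` is the set of correct
outputs for it. The program `c` solves `Q` in time `T`. -/
def Solves (c : Cmd) (T : ℕ → ℕ) (Q : Data → Set Data → Prop) : Prop :=
  ∀ d O, Q d O → ∃ t d', Runs c d t d' ∧ t ≤ T d.size ∧ d' ∈ O

def PTime (Q : Data → Set Data → Prop) : Prop :=
  ∃ (c : Cmd) (p : Polynomial ℕ), Solves c (fun m => p.eval m) Q

def ExpTime (Q : Data → Set Data → Prop) : Prop :=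
  ∃ (c : Cmd) (p : Polynomial ℕ), Solves c (fun m => 2 ^ p.eval m) Q

/-! ## Encodings

A finite set is encoded by a list, without repetitions, of codes of its elements, in any order. -/

def listCode (ds : List Data) : Data := ds.foldr Data.cons Data.nil

def boolCode (b : Bool) : Data := if b then Data.cons Data.nil Data.nil else Data.nil

/-- Binary notation. -/
def natCode (m : ℕ) : Data := listCode (m.bits.map boolCode)

def letterCode {n : ℕ} (x : Letter n) : Data := Data.cons (natCode x.1) (boolCode x.2)

def strCode {n : ℕ} (s : Str n) : Data := listCode (s.map letterCode)

/-- `d` encodes the set `s`, where `code` says which data encode which elements. -/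
def SetCode {α : Type} (code : α → Data → Prop) (s : Set α) (d : Data) : Prop :=
  ∃ (l : List α) (ds : List Data), l.Nodup ∧ (∀ x, x ∈ l ↔ x ∈ s) ∧
    List.Forall₂ code l ds ∧ d = listCode ds

def ESystem.Code {n : ℕ} (G : ESystem n) (d : Data) : Prop :=
  SetCode (fun p d => d = Data.cons (letterCode p.1) (strCode p.2)) (G.rules : Set (Production n)) d

def Label.Code {n : ℕ} (L : Label n) (d : Data) : Prop :=
  ∃ g, L.1.Code g ∧ d = Data.cons g (natCode L.2)

def Constraint.Code {n : ℕ} (C : Constraint n) (d : Data) : Prop :=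
  ∃ v e, SetCode (fun x d => d = natCode x) (C.verts : Set Vertex) v ∧
    SetCode (fun (x : {x // x ∈ C.edges}) d => ∃ g, (C.label x).Code g ∧
      d = Data.cons (Data.cons (natCode x.1.1) (natCode x.1.2)) g) Set.univ e ∧
    d = Data.cons v e

/-- A sequent constraint is an infinite object; in a code it is represented by a name `ν R`. -/
def Rule.Code {n : ℕ} (ν : SeqConstraint → ℕ) : Rule n → Data → Prop
  | init C R, d => ∃ c, C.Code c ∧ d = listCode [natCode 0, c, natCode (ν R)]
  | loc R, d => d = listCode [natCode 1, natCode (ν R)]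
  | exp x R, d => d = listCode [natCode 2, letterCode x, natCode (ν R)]
  | hornF a s, d => d = listCode [natCode 3, natCode a, strCode s]
  | hornB a s, d => d = listCode [natCode 4, natCode a, strCode s]
  | reach fam R, d => ∃ ds, List.Forall₂ Label.Code fam ds ∧
      d = listCode [natCode 5, listCode ds, natCode (ν R)]

/-- The sequent constraints that occur in the rules of `A`. -/
def seqConstraints {n : ℕ} (A : Calculus n) : Set SeqConstraint :=
  {R | (∃ C, Rule.init C R ∈ A) ∨ Rule.loc R ∈ A ∨ (∃ x, Rule.exp x R ∈ A) ∨
    ∃ fam, Rule.reach fam R ∈ A}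

/-- The code of a calculus lists the edge types and the rules. -/
def calcCode {n : ℕ} (ν : SeqConstraint → ℕ) (A : Calculus n) (d : Data) : Prop :=
  ∃ r, SetCode (Rule.Code ν) (A : Set (Rule n)) r ∧
    d = Data.cons (listCode ((List.range n).map natCode)) r

/-- The code of a space lists its elements and the pairs in its relation. -/
def Space.Code {n : ℕ} (ν : SeqConstraint → ℕ) (X : Space n) (d : Data) : Prop :=
  ∃ c r, SetCode (calcCode ν) X.carrier c ∧
    SetCode (fun q d => ∃ b b', calcCode ν q.1 b ∧ calcCode ν q.2 b' ∧ d = Data.cons b b')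
      X.le r ∧
    d = Data.cons c r

def GSeq.Code {n : ℕ} (G : GSeq n) (d : Data) : Prop :=
  ∃ g s, SetCode (fun e d => d = listCode [natCode e.1, natCode e.2.1, natCode e.2.2])
      (G.ant : Set (Vertex × Fin n × Vertex)) g ∧
    SetCode (fun q d => d = Data.cons (natCode q.1) (natCode q.2))
      (G.suc : Set (Vertex × Sequent)) s ∧
    d = Data.cons g s

/-- Codes of proof trees, where a rule is represented by its position in the list `l`. -/
inductive ProofCode {n : ℕ} (l : List (Rule n)) : ProofTree n → Data → Prop
  | node {ρ : Rule n} {G : GSeq n} {subs : List (ProofTree n)} {i : ℕ} {g : Data}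
      {ds : List Data} :
      l[i]? = some ρ → G.Code g → subs.length = ds.length →
      (∀ q ∈ subs.zip ds, ProofCode l q.1 q.2) →
      ProofCode l (ProofTree.node ρ G subs)
        (Data.cons (natCode i) (Data.cons g (listCode ds)))

/-! ## Polynomial equivalence and the computational problems of the theorem -/

/-- `l` lists the rules of `A` without repetitions. -/
def Lists {n : ℕ} (l : List (Rule n)) (A : Calculus n) : Prop :=
  l.Nodup ∧ ∀ ρ, ρ ∈ l ↔ ρ ∈ A

/-- Transform a given proof in `A` into a proof of the same g-sequent in `B`. -/
def translationProblem {n : ℕ} (A B : Calculus n) (l l' : List (Rule n)) (d : Data)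
    (O : Set Data) : Prop :=
  ∃ G t, IsProofOf A G t ∧ ProofCode l t d ∧
    O = {d' | ∃ t', IsProofOf B G t' ∧ ProofCode l' t' d'}

/-- The same g-sequents have proofs in `A` and in `B`, and proofs can be translated in polynomial
time in both directions. -/
def PolyEquiv {n : ℕ} (A B : Calculus n) : Prop :=
  (∀ G, (∃ t, IsProofOf A G t) ↔ ∃ t, IsProofOf B G t) ∧
    ∀ l l', Lists l A → Lists l' B →
      PTime (translationProblem A B l l') ∧ PTime (translationProblem B A l' l)

/-- The input is an explicit calculus; the output is its upward space. -/
def upSpaceProblem (d : Data) (O : Set Data) : Prop :=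
  ∃ (n : ℕ) (A : Calculus n) (ν : SeqConstraint → ℕ), Explicit A ∧
    Set.InjOn ν (seqConstraints A) ∧ calcCode ν A d ∧ O = {d' | (upSpace A).Code ν d'}

/-- The input is an explicit calculus; the output is the top element of its upward space. -/
def topProblem (d : Data) (O : Set Data) : Prop :=
  ∃ (n : ℕ) (A : Calculus n) (ν : SeqConstraint → ℕ), Explicit A ∧
    Set.InjOn ν (seqConstraints A) ∧ calcCode ν A d ∧
    O = {d' | ∃ T, (upSpace A).IsTop T ∧ calcCode ν T d'}

end AbsCalc

open AbsCalc

/-! Successive absorptions merge: `f(f(A, H), H') = f(A, H ∪ H')`. A set is anti-fracturable as soon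
as no rule outside it lies immediately below, or shares its grammar with, a rule inside it. Hence
every member of the upward space is `f(A, H)` for exactly one anti-fracturable set `H` of Horn rules
of `A` (`absorbHorn_absorbHorn`, `antiFracturable_iff`, `upMem_iff`, `absorbHorn_injOn`), and the
relation of the space is inclusion of these sets (`mem_upSpace_le_iff`). The top therefore absorbs
all Horn rules. Two rounds of IMPLICATE suffice: one finds all members and the pairs that start at
`A`, the other finds the remaining pairs.

The systems in the labels of a calculus are part of its grammar, so in an explicit calculus they are
empty (`Explicit.systems_eq_empty`). A label of `A` thus asks for a single edge atom, and every
label of `f(A, H)` carries just the grammar of `H`. The top has no Horn rules and its labels carry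
all productions there are, so it is implicit; every other member still has a Horn rule.

Proofs are translated by way of `A`. From `f(A, H)` to `A`, the edge atoms of each g-sequent are
saturated under the rules of `H`, from the root upwards. In a saturated g-sequent a path that reads
a string of `K(a)`, where `K` is the grammar of `H`, is accompanied by the atom of type `a`, so the
labels with empty systems are satisfied; Horn rules placed below remove the extra atoms
(`fractureTree_correct`). From `A` to `f(A, H)`, the applications of rules of `H` are dropped, and
the atoms that they introduce are deleted everywhere above. A deleted atom of type `a` is still
represented by a path that reads a string of `K(a)`, which is what the new labels ask for
(`GSeq.Covers`). A Horn rule outside `H` needs its own path literally; since `H` is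
anti-fracturable, no letter of that path is a left-hand side in `K`, so the path survives the
deletion (`absorbTree_correct`).

For the time bounds, polynomial-time functions on trees of data are shown to be closed under
composition, under folds that add a bounded amount in each step (`Poly.foldl`), and under recursion
on trees whose accumulators and values grow additively (`poly_treeRec`). Both translations are such
recursions. The upward space is obtained by listing all sublists of the Horn rules, which takes
exponential time, and by applying a polynomial-time function to that list; the top needs a single
absorption. -/

namespace AbsCalc

/-! ## Computability by while-programs with cost bounds -/

namespace Data

theorem size_pos (d : Data) : 0 < d.size := by cases d <;> simp [size]

theorem size_hd_le (d : Data) : d.hd.size ≤ d.size := by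
  cases d <;> simp only [size, hd] <;> omega

theorem size_tl_le (d : Data) : d.tl.size ≤ d.size := by
  cases d <;> simp only [size, tl] <;> omega

end Data

theorem Expr.size_eval_le (σ : Store) (e : Expr) : (e.eval σ).size ≤ e.cost σ := by
  induction e with
  | var x => simp [Expr.eval, Expr.cost]
  | nil => simp [Expr.eval, Expr.cost, Data.size]
  | cons e₁ e₂ h₁ h₂ => simp only [Expr.eval, Expr.cost, Data.size]; omega
  | hd e h => exact (Data.size_hd_le _).trans (h.trans (Nat.le_succ _))
  | tl e h => exact (Data.size_tl_le _).trans (h.trans (Nat.le_succ _))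
  | eq e₁ e₂ h₁ h₂ =>
    have := Data.size_pos (e₁.eval σ)
    have := Data.size_pos (e₂.eval σ)
    simp only [Expr.eval, Expr.cost]
    split_ifs <;> simp [Data.size] <;> omega

/-- The cost of an assignment covers the size of the assigned value, so every time bound is also a
bound on the size of the output. -/
theorem Exec.size_le {c : Cmd} {σ σ' : Store} {t : ℕ} (h : Exec c σ t σ') (x : ℕ) :
    (σ' x).size ≤ (σ x).size + t := by
  induction h with
  | assign y e σ =>
    have := e.size_eval_le σ
    by_cases hx : x = y
    · subst hx; simp; omega
    · simp [hx]
  | seq _ _ h₁ h₂ => omega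
  | iteTrue _ _ h => omega
  | iteFalse _ _ h => omega
  | loopDone _ => omega
  | loopStep _ _ _ h₁ h₂ => omega

/-- Some program maps the value of variable `0` by `f`, in time `T`, and changes only finitely many
variables, whose initial values do not matter. -/
def Runnable (f : Data → Data) (T : Data → ℕ) : Prop :=
  ∃ (c : Cmd) (K : ℕ), ∀ σ, ∃ t σ', Exec c σ t σ' ∧ σ' 0 = f (σ 0) ∧
    (∀ x, K < x → σ' x = σ x) ∧ t ≤ T (σ 0)

namespace Runnable

variable {f g b s : Data → Data} {T U : Data → ℕ}

theorem mono (h : Runnable f T) (hTU : ∀ d, T d ≤ U d) : Runnable f U := by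
  obtain ⟨c, K, h⟩ := h
  refine ⟨c, K, fun σ => ?_⟩
  obtain ⟨t, σ', h₁, h₂, h₃, h₄⟩ := h σ
  exact ⟨t, σ', h₁, h₂, h₃, h₄.trans (hTU _)⟩

theorem congr (h : Runnable f T) (hfg : ∀ d, f d = g d) : Runnable g T :=
  funext hfg ▸ h

theorem size_le (h : Runnable f T) (d : Data) : (f d).size ≤ d.size + T d := by
  obtain ⟨c, K, h⟩ := h
  obtain ⟨t, σ', h₁, h₂, _, h₄⟩ := h fun _ => d
  have := h₁.size_le 0
  rw [h₂] at this
  omega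

theorem of_expr (e : Expr) (he : ∀ σ : Store, e.eval σ = f (σ 0))
    (hT : ∀ σ : Store, e.cost σ + 1 ≤ T (σ 0)) : Runnable f T :=
  ⟨Cmd.assign 0 e, 0, fun σ => ⟨_, _, Exec.assign 0 e σ, by simp [he],
    fun x hx => by simp [Nat.pos_iff_ne_zero.mp hx], hT σ⟩⟩

theorem comp (hg : Runnable g U) (hf : Runnable f T) :
    Runnable (fun d => g (f d)) (fun d => T d + U (f d)) := by
  obtain ⟨c, K, hf⟩ := hf
  obtain ⟨c', K', hg⟩ := hg
  refine ⟨Cmd.seq c c', max K K', fun σ => ?_⟩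
  obtain ⟨t, σ₁, h₁, h₂, h₃, h₄⟩ := hf σ
  obtain ⟨t', σ₂, k₁, k₂, k₃, k₄⟩ := hg σ₁
  rw [h₂] at k₂ k₄
  exact ⟨_, σ₂, Exec.seq h₁ k₁, k₂, fun x hx => by rw [k₃ x (by omega), h₃ x (by omega)],
    by dsimp only; omega⟩

theorem cons (hf : Runnable f T) (hg : Runnable g U) :
    Runnable (fun d => Data.cons (f d) (g d)) (fun d => 6 * (T d + U d + d.size + 2)) := by
  have sf := hf.size_le
  have sg := hg.size_le
  obtain ⟨c, K, hf⟩ := hf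
  obtain ⟨c', K', hg⟩ := hg
  have a₁ : max K K' + 1 ≠ 0 := by omega
  have a₂ : max K K' + 2 ≠ 0 := by omega
  have a₃ : max K K' + 2 ≠ max K K' + 1 := by omega
  -- Neither program touches the variables above `max K K'`; two of them keep the input and the
  -- first value.
  refine ⟨Cmd.seq (Cmd.assign (max K K' + 1) (Expr.var 0)) (Cmd.seq c
    (Cmd.seq (Cmd.assign (max K K' + 2) (Expr.var 0))
    (Cmd.seq (Cmd.assign 0 (Expr.var (max K K' + 1))) (Cmd.seq c'
    (Cmd.assign 0 (Expr.cons (Expr.var (max K K' + 2)) (Expr.var 0))))))), max K K' + 2,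
    fun σ => ?_⟩
  obtain ⟨t, σ₁, h₁, h₂, h₃, h₄⟩ := hf (Function.update σ (max K K' + 1) (σ 0))
  have e₀ := h₃ (max K K' + 1) (by omega)
  simp [a₁.symm] at h₂ h₄ e₀
  obtain ⟨t', σ₂, k₁, k₂, k₃, k₄⟩ := hg (Function.update (Function.update σ₁ (max K K' + 2) (σ₁ 0)) 0
    (σ₁ (max K K' + 1)))
  have e₁ := k₃ (max K K' + 2) (by omega)
  simp [a₂, h₂, e₀] at k₂ k₄ e₁
  refine ⟨_, _, Exec.seq (Exec.assign _ _ _) (Exec.seq h₁ (Exec.seq (Exec.assign _ _ _)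
    (Exec.seq (Exec.assign _ _ _) (Exec.seq (by simpa [Expr.eval, a₃.symm] using k₁)
    (Exec.assign _ _ _))))), ?_, fun x hx => ?_, ?_⟩
  · simp [Expr.eval, k₂, e₁]
  · have b₁ : x ≠ 0 := by omega
    have b₂ : x ≠ max K K' + 2 := by omega
    have b₃ : x ≠ max K K' + 1 := by omega
    simp only [ne_eq, b₁, not_false_eq_true, Function.update_of_ne]
    rw [k₃ x (by omega)]
    simp only [ne_eq, b₁, b₂, not_false_eq_true, Function.update_of_ne]
    rw [h₃ x (by omega)]
    simp [b₃]
  · have := sf (σ 0)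
    have := sg (σ 0)
    simp [Expr.cost, k₂, e₁, h₂, e₀]
    omega

theorem ite (hb : Runnable b T) (hf : Runnable f U) (hg : Runnable g U) :
    Runnable (fun d => open Classical in if b d = Data.nil then g d else f d)
      (fun d => 4 * (T d + U d + d.size + 2)) := by
  have sb := hb.size_le
  obtain ⟨c₀, K₀, hb⟩ := hb
  obtain ⟨c, K, hf⟩ := hf
  obtain ⟨c', K', hg⟩ := hg
  obtain ⟨N, hN₀, hN, hN'⟩ : ∃ N, K₀ ≤ N ∧ K ≤ N ∧ K' ≤ N :=
    ⟨max K₀ (max K K'), by omega, by omega, by omega⟩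
  refine ⟨Cmd.seq (Cmd.assign (N + 1) (Expr.var 0)) (Cmd.seq c₀
    (Cmd.seq (Cmd.assign (N + 2) (Expr.var 0))
    (Cmd.seq (Cmd.assign 0 (Expr.var (N + 1))) (Cmd.ite (Expr.var (N + 2)) c c')))), N + 2,
    fun σ => ?_⟩
  obtain ⟨t, σ₁, h₁, h₂, h₃, h₄⟩ := hb (Function.update σ (N + 1) (σ 0))
  have e₀ := h₃ (N + 1) (by omega)
  simp at h₂ h₄ e₀
  set σ₂ := Function.update (Function.update σ₁ (N + 2) (σ₁ 0)) 0 (σ₁ (N + 1)) with hσ₂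
  have e₂ : σ₂ 0 = σ 0 := by simp [hσ₂, e₀]
  have e₃ : σ₂ (N + 2) = b (σ 0) := by simp [hσ₂, h₂]
  have e₄ : ∀ x, N + 2 < x → σ₂ x = σ x := fun x hx => by
    have b₁ : x ≠ 0 := by omega
    have b₂ : x ≠ N + 2 := by omega
    have b₃ : x ≠ N + 1 := by omega
    simp only [hσ₂, ne_eq, b₁, b₂, not_false_eq_true, Function.update_of_ne]
    rw [h₃ x (by omega)]
    simp [b₃]
  have run : ∀ t' σ', Exec (Cmd.ite (Expr.var (N + 2)) c c') σ₂ t' σ' →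
      Exec (Cmd.seq (Cmd.assign (N + 1) (Expr.var 0)) (Cmd.seq c₀
        (Cmd.seq (Cmd.assign (N + 2) (Expr.var 0))
        (Cmd.seq (Cmd.assign 0 (Expr.var (N + 1))) (Cmd.ite (Expr.var (N + 2)) c c'))))) σ
        ((σ 0).size + 1 + (t + ((σ₁ 0).size + 1 + ((σ₁ (N + 1)).size + 1 + t')))) σ' := by
    intro t' σ' h
    refine Exec.seq (Exec.assign _ _ _) (Exec.seq h₁ (Exec.seq (Exec.assign _ _ _) ?_))
    have := Exec.assign 0 (Expr.var (N + 1)) (Function.update σ₁ (N + 2) (σ₁ 0))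
    have e : Function.update σ₁ (N + 2) (σ₁ 0) (N + 1) = σ₁ (N + 1) := by simp
    simp only [Expr.cost, Expr.eval, e] at this ⊢
    exact Exec.seq this h
  have hsz := sb (σ 0)
  by_cases hn : b (σ 0) = Data.nil
  · obtain ⟨t', σ₃, k₁, k₂, k₃, k₄⟩ := hg σ₂
    refine ⟨_, σ₃, run _ _ (Exec.iteFalse (by simpa [Expr.eval, e₃] using hn) k₁), ?_,
      fun x hx => by rw [k₃ x (by omega), e₄ x hx], ?_⟩
    · simp [hn, k₂, e₂]
    · rw [e₂] at k₄
      simp only [Expr.cost, h₂, e₀, e₃]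
      omega
  · obtain ⟨t', σ₃, k₁, k₂, k₃, k₄⟩ := hf σ₂
    refine ⟨_, σ₃, run _ _ (Exec.iteTrue (by simpa [Expr.eval, e₃] using hn) k₁), ?_,
      fun x hx => by rw [k₃ x (by omega), e₄ x hx], ?_⟩
    · simp [hn, k₂, e₂]
    · rw [e₂] at k₄
      simp only [Expr.cost, h₂, e₀, e₃]
      omega

/-- Started in the state `i d`, do `s` while `b` holds; this happens `k d` times. -/
theorem loop {i : Data → Data} {V : Data → ℕ} (hb : Runnable b T) (hs : Runnable s U)
    (hi : Runnable i V) {k M : Data → ℕ} (hdone : ∀ d, b (s^[k d] (i d)) = Data.nil)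
    (hgo : ∀ d, ∀ j < k d, b (s^[j] (i d)) ≠ Data.nil)
    (hM : ∀ d, ∀ j ≤ k d, T (s^[j] (i d)) + U (s^[j] (i d)) + (s^[j] (i d)).size ≤ M d) :
    Runnable (fun d => s^[k d] (i d)) (fun d => V d + (k d + 1) * (10 * (M d + 2))) := by
  have sb := hb.size_le
  obtain ⟨c₀, K₀, hb⟩ := hb
  obtain ⟨c, K, hs⟩ := hs
  obtain ⟨c₁, K₁, hi⟩ := hi
  obtain ⟨N, hN₀, hN, hN₁⟩ : ∃ N, K₀ ≤ N ∧ K ≤ N ∧ K₁ ≤ N :=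
    ⟨max K₀ (max K K₁), by omega, by omega, by omega⟩
  -- The test destroys variable `0`, so the state is saved in `N + 1` and restored; the truth value
  -- stays in `N + 2`, where the loop condition reads it.
  have test : ∀ σ : Store, ∃ t σ', Exec (Cmd.seq (Cmd.assign (N + 1) (Expr.var 0)) (Cmd.seq c₀
      (Cmd.seq (Cmd.assign (N + 2) (Expr.var 0)) (Cmd.assign 0 (Expr.var (N + 1)))))) σ t σ' ∧
      σ' 0 = σ 0 ∧ σ' (N + 2) = b (σ 0) ∧ (∀ x, N + 2 < x → σ' x = σ x) ∧
      t ≤ 3 * (T (σ 0) + (σ 0).size + 1) := by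
    intro σ
    obtain ⟨t, σ₁, h₁, h₂, h₃, h₄⟩ := hb (Function.update σ (N + 1) (σ 0))
    have e₀ := h₃ (N + 1) (by omega)
    simp at h₂ h₄ e₀
    refine ⟨_, _, Exec.seq (Exec.assign _ _ _) (Exec.seq h₁ (Exec.seq (Exec.assign _ _ _)
      (Exec.assign _ _ _))), ?_, ?_, fun x hx => ?_, ?_⟩
    · simp [Expr.eval, e₀]
    · simp [Expr.eval, h₂]
    · have b₁ : x ≠ 0 := by omega
      have b₂ : x ≠ N + 2 := by omega
      have b₃ : x ≠ N + 1 := by omega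
      simp only [ne_eq, b₁, b₂, not_false_eq_true, Function.update_of_ne]
      rw [h₃ x (by omega)]
      simp [b₃]
    · have := sb (σ 0)
      simp [Expr.cost, h₂, e₀]
      omega
  set ct := Cmd.seq (Cmd.assign (N + 1) (Expr.var 0)) (Cmd.seq c₀
      (Cmd.seq (Cmd.assign (N + 2) (Expr.var 0)) (Cmd.assign 0 (Expr.var (N + 1))))) with hct
  have main : ∀ k m (σ : Store), σ (N + 2) = b (σ 0) → b (s^[k] (σ 0)) = Data.nil →
      (∀ j < k, b (s^[j] (σ 0)) ≠ Data.nil) →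
      (∀ j ≤ k, T (s^[j] (σ 0)) + U (s^[j] (σ 0)) + (s^[j] (σ 0)).size ≤ m) →
      ∃ t σ', Exec (Cmd.loop (Expr.var (N + 2)) (Cmd.seq c ct)) σ t σ' ∧
        σ' 0 = s^[k] (σ 0) ∧ (∀ x, N + 2 < x → σ' x = σ x) ∧
        t ≤ k * (8 * (m + 1)) + m + 1 := by
    intro k
    induction k with
    | zero =>
      intro m σ h₀ h₁ _ h₃
      refine ⟨_, σ, Exec.loopDone (by simpa [Expr.eval, h₀] using h₁), rfl, fun _ _ => rfl, ?_⟩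
      have h := h₃ 0 le_rfl
      have := sb (σ 0)
      simp only [Function.iterate_zero, id_eq] at h
      simp only [Expr.cost, h₀]
      omega
    | succ k ih =>
      intro m σ h₀ h₁ h₂ h₃
      obtain ⟨t, σ₁, k₁, k₂, k₃, k₄⟩ := hs σ
      obtain ⟨t', σ₂, l₁, l₂, l₃, l₄, l₅⟩ := test σ₁
      rw [k₂] at l₂ l₃ l₅
      obtain ⟨t'', σ₃, n₁, n₂, n₃, n₄⟩ := ih m σ₂ (by rw [l₃, l₂])
        (by rw [l₂, ← Function.iterate_succ_apply]; exact h₁)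
        (fun j hj => by rw [l₂, ← Function.iterate_succ_apply]; exact h₂ _ (by omega))
        (fun j hj => by rw [l₂, ← Function.iterate_succ_apply]; exact h₃ _ (by omega))
      refine ⟨_, σ₃, Exec.loopStep (by simpa [Expr.eval, h₀] using h₂ 0 (by omega))
        (Exec.seq k₁ l₁) n₁, by rw [n₂, l₂, ← Function.iterate_succ_apply],
        fun x hx => by rw [n₃ x hx, l₄ x hx, k₃ x (by omega)], ?_⟩
      have a₀ := h₃ 0 (by omega)
      have a₁ := h₃ 1 (by omega)
      have := sb (σ 0)
      simp only [Function.iterate_zero, id_eq, Function.iterate_one] at a₀ a₁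
      simp only [Expr.cost, h₀]
      have : (k + 1) * (8 * (m + 1)) = k * (8 * (m + 1)) + 8 * (m + 1) := by ring
      omega
  refine ⟨Cmd.seq c₁ (Cmd.seq ct (Cmd.loop (Expr.var (N + 2)) (Cmd.seq c ct))), N + 2,
    fun σ => ?_⟩
  obtain ⟨t₀, σ₀, h₁, h₂, h₃, h₄⟩ := hi σ
  obtain ⟨t, σ₁, l₁, l₂, l₃, l₄, l₅⟩ := test σ₀
  rw [h₂] at l₂ l₃ l₅
  obtain ⟨t', σ₂, n₁, n₂, n₃, n₄⟩ := main (k (σ 0)) (M (σ 0)) σ₁ (by rw [l₃, l₂])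
    (by rw [l₂]; exact hdone _) (by rw [l₂]; exact hgo _) (by rw [l₂]; exact hM _)
  refine ⟨_, σ₂, Exec.seq h₁ (Exec.seq l₁ n₁), by rw [n₂, l₂],
    fun x hx => by rw [n₃ x hx, l₄ x hx, h₃ x (by omega)], ?_⟩
  have a₀ := hM (σ 0) 0 (by omega)
  simp only [Function.iterate_zero, id_eq] at a₀
  have : (k (σ 0) + 1) * (10 * (M (σ 0) + 2)) =
    k (σ 0) * (8 * (M (σ 0) + 1)) + k (σ 0) * (2 * M (σ 0) + 12) + 10 * (M (σ 0) + 2) := by ring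
  dsimp only
  omega

end Runnable

end AbsCalc

namespace AbsCalc

/-! ## Polynomial and exponential time -/

theorem Polynomial.eval_nat_mono (p : Polynomial ℕ) {m k : ℕ} (h : m ≤ k) :
    p.eval m ≤ p.eval k := by
  simp only [Polynomial.eval_eq_sum_range]
  exact Finset.sum_le_sum fun i _ => Nat.mul_le_mul_left _ (Nat.pow_le_pow_left h _)

/-- `T` is bounded by a polynomial in the size of the argument. -/
def PBdd (T : Data → ℕ) : Prop := ∃ p : Polynomial ℕ, ∀ d, T d ≤ p.eval d.size

namespace PBdd

variable {T U : Data → ℕ}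

theorem mono (h : PBdd U) (hTU : ∀ d, T d ≤ U d) : PBdd T := by
  obtain ⟨p, hp⟩ := h
  exact ⟨p, fun d => (hTU d).trans (hp d)⟩

theorem const (m : ℕ) : PBdd fun _ => m := ⟨Polynomial.C m, fun d => by simp⟩

theorem size : PBdd Data.size := ⟨Polynomial.X, fun d => by simp⟩

theorem add (hT : PBdd T) (hU : PBdd U) : PBdd fun d => T d + U d := by
  obtain ⟨p, hp⟩ := hT
  obtain ⟨q, hq⟩ := hU
  exact ⟨p + q, fun d => by simpa using Nat.add_le_add (hp d) (hq d)⟩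

theorem mul (hT : PBdd T) (hU : PBdd U) : PBdd fun d => T d * U d := by
  obtain ⟨p, hp⟩ := hT
  obtain ⟨q, hq⟩ := hU
  exact ⟨p * q, fun d => by simpa using Nat.mul_le_mul (hp d) (hq d)⟩

theorem eval (hT : PBdd T) (p : Polynomial ℕ) : PBdd fun d => p.eval (T d) := by
  obtain ⟨q, hq⟩ := hT
  exact ⟨p.comp q, fun d => by
    rw [Polynomial.eval_comp]; exact Polynomial.eval_nat_mono _ (hq d)⟩

theorem comp {f : Data → Data} (hT : PBdd T) (hf : PBdd fun d => (f d).size) :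
    PBdd fun d => T (f d) := by
  obtain ⟨p, hp⟩ := hT
  exact (hf.eval p).mono fun d => hp _

end PBdd

/-- `T` is bounded by the exponential function of a polynomial in the size of the argument. -/
def EBdd (T : Data → ℕ) : Prop := ∃ U, PBdd U ∧ ∀ d, T d ≤ 2 ^ U d

namespace EBdd

variable {T U : Data → ℕ}

theorem mono (h : EBdd U) (hTU : ∀ d, T d ≤ U d) : EBdd T := by
  obtain ⟨p, hp, h⟩ := h
  exact ⟨p, hp, fun d => (hTU d).trans (h d)⟩

theorem _root_.AbsCalc.PBdd.eBdd (h : PBdd T) : EBdd T := ⟨T, h, fun _ => Nat.lt_two_pow_self.le⟩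

theorem mul (hT : EBdd T) (hU : EBdd U) : EBdd fun d => T d * U d := by
  obtain ⟨p, hp, hp'⟩ := hT
  obtain ⟨q, hq, hq'⟩ := hU
  exact ⟨_, hp.add hq, fun d => by rw [pow_add]; exact Nat.mul_le_mul (hp' d) (hq' d)⟩

theorem add (hT : EBdd T) (hU : EBdd U) : EBdd fun d => T d + U d := by
  obtain ⟨p, hp, hp'⟩ := hT
  obtain ⟨q, hq, hq'⟩ := hU
  refine ⟨_, (hp.add hq).add (PBdd.const 1), fun d => ?_⟩
  have h₁ := (hp' d).trans (Nat.pow_le_pow_right two_pos (Nat.le_add_right (p d) (q d)))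
  have h₂ := (hq' d).trans (Nat.pow_le_pow_right two_pos (Nat.le_add_left (q d) (p d)))
  simp only [pow_succ]
  omega

theorem pow (hT : EBdd T) (k : ℕ) : EBdd fun d => T d ^ k := by
  induction k with
  | zero => simpa using (PBdd.const 1).eBdd
  | succ k ih => simpa only [pow_succ] using ih.mul hT

theorem eval (hT : EBdd T) (p : Polynomial ℕ) : EBdd fun d => p.eval (T d) := by
  simp only [Polynomial.eval_eq_sum_range]
  induction Finset.range (p.natDegree + 1) using Finset.induction_on with
  | empty => simpa using (PBdd.const 0).eBdd
  | insert a s ha ih =>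
    simp only [Finset.sum_insert ha]
    exact ((PBdd.const _).eBdd.mul (hT.pow _)).add ih

end EBdd

/-- Functions computable in polynomial time. -/
@[fun_prop]
def Poly (f : Data → Data) : Prop := ∃ T, PBdd T ∧ Runnable f T

/-- Functions computable in exponential time. -/
def Expo (f : Data → Data) : Prop := ∃ T, EBdd T ∧ Runnable f T

theorem Poly.size_le {f : Data → Data} (hf : Poly f) : PBdd fun d => (f d).size := by
  obtain ⟨T, hT, hf⟩ := hf
  exact (PBdd.size.add hT).mono hf.size_le

/-- A polynomial in an exponential bound is again exponential, whereas a composition of two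
exponential-time functions need not be exponential. All exponential work is therefore done in one
initial phase. -/
theorem Poly.comp_expo {f g : Data → Data} (hg : Poly g) (hf : Expo f) :
    Expo fun d => g (f d) := by
  obtain ⟨U, ⟨p, hp⟩, hg⟩ := hg
  obtain ⟨T, hT, hf⟩ := hf
  exact ⟨_, hT.add (((PBdd.size.eBdd.add hT).mono hf.size_le).eval p),
    (hg.comp hf).mono fun d => Nat.add_le_add_left (hp _) _⟩

namespace Poly

variable {f g : Data → Data}

@[fun_prop]
theorem id : Poly fun d => d :=
  ⟨_, (PBdd.size.add (PBdd.const 1)), Runnable.of_expr (Expr.var 0) (fun _ => rfl) fun _ => le_rfl⟩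

theorem nil : Poly fun _ => Data.nil :=
  ⟨_, PBdd.const 2, Runnable.of_expr Expr.nil (fun _ => rfl) fun _ => le_rfl⟩

@[fun_prop]
theorem comp (hg : Poly g) (hf : Poly f) : Poly fun d => g (f d) := by
  have hs := hf.size_le
  obtain ⟨U, hU, hg⟩ := hg
  obtain ⟨T, hT, hf⟩ := hf
  exact ⟨_, hT.add (hU.comp hs), hg.comp hf⟩

@[fun_prop]
theorem hd (hf : Poly f) : Poly fun d => (f d).hd :=
  comp (g := Data.hd) ⟨_, (PBdd.size.add (PBdd.const 2)),
    Runnable.of_expr (Expr.hd (Expr.var 0)) (fun _ => rfl) fun _ => le_rfl⟩ hf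

@[fun_prop]
theorem tl (hf : Poly f) : Poly fun d => (f d).tl :=
  comp (g := Data.tl) ⟨_, (PBdd.size.add (PBdd.const 2)),
    Runnable.of_expr (Expr.tl (Expr.var 0)) (fun _ => rfl) fun _ => le_rfl⟩ hf

@[fun_prop]
theorem cons (hf : Poly f) (hg : Poly g) : Poly fun d => Data.cons (f d) (g d) := by
  obtain ⟨U, hU, hg⟩ := hg
  obtain ⟨T, hT, hf⟩ := hf
  exact ⟨_, (PBdd.const 6).mul (((hT.add hU).add PBdd.size).add (PBdd.const 2)), hf.cons hg⟩

@[fun_prop]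
theorem const (c : Data) : Poly fun _ => c := by
  induction c with
  | nil => exact nil
  | cons l r hl hr => exact hl.cons hr

theorem ite_nil {b : Data → Data} (hb : Poly b) (hf : Poly f) (hg : Poly g) :
    Poly fun d => open Classical in if b d = Data.nil then g d else f d := by
  obtain ⟨T, hT, hb⟩ := hb
  obtain ⟨U, hU, hf⟩ := hf
  obtain ⟨V, hV, hg⟩ := hg
  exact ⟨_, (PBdd.const 4).mul (((hT.add (hU.add hV)).add PBdd.size).add (PBdd.const 2)),
    hb.ite (hf.mono fun d => Nat.le_add_right _ _) (hg.mono fun d => Nat.le_add_left _ _)⟩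

end Poly

open Classical in
/-- Predicates decidable in polynomial time. -/
def PolyP (P : Data → Prop) : Prop :=
  Poly fun d => if P d then Data.cons Data.nil Data.nil else Data.nil

namespace PolyP

variable {P Q : Data → Prop} {f g : Data → Data}

theorem ite {dec : ∀ d, Decidable (P d)} (hP : PolyP P) (hf : Poly f) (hg : Poly g) :
    Poly fun d => if P d then f d else g d := by
  convert hP.ite_nil hf hg using 2 with d
  by_cases h : P d <;> simp [h]

theorem of_iff (hP : PolyP P) (h : ∀ d, Q d ↔ P d) : PolyP Q :=
  (funext fun d => propext (h d) : Q = P) ▸ hP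

theorem comp (hP : PolyP P) (hf : Poly f) : PolyP fun d => P (f d) :=
  Poly.comp (g := fun d => open Classical in
    if P d then Data.cons Data.nil Data.nil else Data.nil) hP hf

theorem not (hP : PolyP P) : PolyP fun d => ¬ P d := by
  classical
  unfold PolyP
  convert hP.ite (dec := fun _ => Classical.propDecidable _) (Poly.const Data.nil) (Poly.const (Data.cons Data.nil Data.nil)) using 2 with d
  by_cases h : P d <;> simp [h]

theorem and (hP : PolyP P) (hQ : PolyP Q) : PolyP fun d => P d ∧ Q d := by
  classical
  unfold PolyP
  convert hP.ite (dec := fun _ => Classical.propDecidable _) hQ (Poly.const Data.nil) using 2 with d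
  by_cases h : P d <;> by_cases h' : Q d <;> simp [h, h']

theorem or (hP : PolyP P) (hQ : PolyP Q) : PolyP fun d => P d ∨ Q d :=
  (hP.not.and hQ.not).not.of_iff fun d => by tauto

theorem eq (hf : Poly f) (hg : Poly g) : PolyP fun d => f d = g d :=
  (show PolyP fun d => d.hd = d.tl from ⟨_, ((PBdd.const 2).mul PBdd.size).add (PBdd.const 4),
    Runnable.of_expr (Expr.eq (Expr.hd (Expr.var 0)) (Expr.tl (Expr.var 0)))
    (fun σ => by by_cases h : (σ 0).hd = (σ 0).tl <;> simp [Expr.eval, h]) fun σ => by simp only [Expr.cost]; omega⟩).comp (hf.cons hg)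

end PolyP

/-! ## Lists of data -/

def Data.toList : Data → List Data
  | nil => []
  | cons h t => h :: t.toList

@[simp]
theorem toList_nil : Data.nil.toList = [] := rfl

@[simp]
theorem toList_cons (h t : Data) : (Data.cons h t).toList = h :: t.toList := rfl

@[simp]
theorem toList_listCode (l : List Data) : (listCode l).toList = l := by
  induction l with
  | nil => rfl
  | cons x l ih => simpa [listCode] using ih

@[simp]
theorem listCode_toList (d : Data) : listCode d.toList = d := by
  induction d with
  | nil => rfl
  | cons h t _ ih => simpa [listCode] using ih

@[simp]
theorem listCode_nil : listCode [] = Data.nil := rfl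

@[simp]
theorem listCode_cons (x : Data) (l : List Data) :
    listCode (x :: l) = Data.cons x (listCode l) := rfl

theorem listCode_injective : Function.Injective listCode :=
  Function.LeftInverse.injective toList_listCode

namespace Data

theorem size_lt_of_mem {d x : Data} (h : x ∈ d.toList) : x.size < d.size := by
  induction d with
  | nil => simp at h
  | cons a t _ ih =>
    simp only [toList_cons, List.mem_cons] at h
    simp only [size]
    rcases h with rfl | h
    · omega
    · have := ih h
      omega

theorem length_lt_size (d : Data) : d.toList.length < d.size := by
  induction d with
  | nil => simp [size]
  | cons a t _ ih => simp only [toList_cons, List.length_cons, size]; omega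

theorem size_listCode_append (l l' : List Data) :
    (listCode (l ++ l')).size + 1 = (listCode l).size + (listCode l').size := by
  induction l with
  | nil => simp [size]; omega
  | cons x l ih => simp only [List.cons_append, listCode_cons, size]; omega

theorem size_listCode_drop (l : List Data) (j : ℕ) :
    (listCode (l.drop j)).size ≤ (listCode l).size := by
  have := size_listCode_append (l.take j) (l.drop j)
  have := size_pos (listCode (l.take j))
  rw [List.take_append_drop] at *
  omega

end Data

/-- The loop of a fold: the state consists of the input, the rest of the list, and the value. -/
def foldStep (s : Data → Data → Data → Data) (st : Data) : Data :=
  Data.cons st.hd (Data.cons st.tl.hd.tl (s st.hd st.tl.tl st.tl.hd.hd))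

theorem foldStep_iterate (s : Data → Data → Data → Data) (e : Data) (l : List Data) (a : Data)
    (j : ℕ) (hj : j ≤ l.length) :
    (foldStep s)^[j] (Data.cons e (Data.cons (listCode l) a)) =
      Data.cons e (Data.cons (listCode (l.drop j)) ((l.take j).foldl (s e) a)) := by
  induction j generalizing l a with
  | zero => simp
  | succ j ih =>
    cases l with
    | nil => simp at hj
    | cons x l =>
      rw [Function.iterate_succ_apply]
      simp only [List.length_cons, Nat.add_le_add_iff_right] at hj
      simpa [foldStep, Data.hd, Data.tl] using ih l (s e a x) hj

/-- A function of several arguments counts as polynomial-time if it is so on the coded tuple, here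
`(d, (a, x))` with `d` the parameter, `a` the value so far and `x` the list element. -/
theorem Poly.foldStep {s : Data → Data → Data → Data}
    (hs : Poly fun e => s e.hd e.tl.hd e.tl.tl) : Poly (foldStep s) :=
  (by fun_prop : Poly fun d : Data => d.hd).cons ((by fun_prop : Poly fun d : Data => d.tl.hd.tl).cons
    (hs.comp (f := fun d => Data.cons d.hd (Data.cons d.tl.tl d.tl.hd.hd)) (by fun_prop)))

section Fold

variable {l i : Data → Data} {s : Data → Data → Data → Data}

/-- The bound `B` on the intermediate values is left arbitrary, so that polynomial and exponential
time are both instances. The output carries the input `d` along for later phases. -/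
theorem Runnable.foldl {B : Data → ℕ} (hl : Poly l) (hi : Poly i)
    (hs : Poly fun e => s e.hd e.tl.hd e.tl.tl)
    (hB : ∀ d, ∀ j, ((((l d).toList).take j).foldl (s d) (i d)).size ≤ B d) :
    ∃ (p : Polynomial ℕ) (U : Data → ℕ), PBdd U ∧
      Runnable (fun d => Data.cons d (Data.cons Data.nil ((l d).toList.foldl (s d) (i d))))
      fun d => U d + (l d).size * (10 * (p.eval (U d + B d) + 2)) := by
  have hinit : Poly fun d => Data.cons d (Data.cons (l d) (i d)) := by fun_prop
  have hsz := (PBdd.size.add hl.size_le).add (PBdd.const 2)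
  obtain ⟨V, hV, hinit⟩ := hinit
  obtain ⟨U, ⟨p, hp⟩, hstep⟩ := Poly.foldStep hs
  obtain ⟨T, ⟨q, hq⟩, htest⟩ := (by fun_prop : Poly fun d : Data => d.tl.hd)
  refine ⟨q + p + Polynomial.X, _, hV.add hsz, (((htest.loop hstep hinit
    (k := fun d => (l d).toList.length)
    (M := fun d => (q + p + Polynomial.X : Polynomial ℕ).eval (d.size + (l d).size + 2 + B d))
    (fun d => ?_) (fun d j hj => ?_) (fun d j hj => ?_)).congr fun d => ?_).mono fun d => ?_)⟩
  all_goals try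
    have key := foldStep_iterate s d (l d).toList (i d) _ le_rfl
    rw [listCode_toList] at key
  · simp [key, Data.tl, Data.hd]
  · have key := foldStep_iterate s d (l d).toList (i d) j hj.le
    rw [listCode_toList] at key
    rw [key]
    simp only [Data.tl, Data.hd]
    intro h
    have h' := listCode_injective (h.trans listCode_nil.symm)
    simp only [List.drop_eq_nil_iff] at h'
    omega
  · have key := foldStep_iterate s d (l d).toList (i d) j hj
    rw [listCode_toList] at key
    rw [key]
    set e := Data.cons d (Data.cons (listCode ((l d).toList.drop j))
      (((l d).toList.take j).foldl (s d) (i d))) with he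
    have hsize : e.size ≤ d.size + (l d).size + 2 + B d := by
      have h₁ := Data.size_listCode_drop (l d).toList j
      have h₂ := hB d j
      rw [listCode_toList] at h₁
      simp only [he, Data.size]
      omega
    have h₁ := (hq e).trans (Polynomial.eval_nat_mono q hsize)
    have h₂ := (hp e).trans (Polynomial.eval_nat_mono p hsize)
    simp only [Polynomial.eval_add, Polynomial.eval_X]
    omega
  · simp [key]
  · have h₁ := Data.length_lt_size (l d)
    have h₂ := Polynomial.eval_nat_mono (q + p + Polynomial.X)
      (show d.size + (l d).size + 2 + B d ≤ V d + (d.size + (l d).size + 2) + B d by omega)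
    have h₃ := Nat.mul_le_mul (show (l d).toList.length + 1 ≤ (l d).size by omega)
      (Nat.mul_le_mul_left 10 (Nat.add_le_add_right h₂ 2))
    omega

end Fold

end AbsCalc

/-! ### Folds in exponential and in polynomial time -/

namespace AbsCalc

section Fold

variable {l i : Data → Data} {s : Data → Data → Data → Data}

theorem Expo.foldl {B : Data → ℕ} (hl : Poly l) (hi : Poly i)
    (hs : Poly fun e => s e.hd e.tl.hd e.tl.tl) (hE : EBdd B)
    (hB : ∀ d, ∀ j, ((((l d).toList).take j).foldl (s d) (i d)).size ≤ B d) :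
    Expo (fun d => Data.cons d (Data.cons Data.nil ((l d).toList.foldl (s d) (i d)))) := by
  obtain ⟨p, U, hU, h⟩ := Runnable.foldl hl hi hs hB
  exact ⟨_, hU.eBdd.add (hl.size_le.eBdd.mul ((PBdd.const 10).eBdd.mul
    (((hU.eBdd.add hE).eval p).add (PBdd.const 2).eBdd))), h⟩

theorem Poly.foldl_of_bound {B : Data → ℕ} (hl : Poly l) (hi : Poly i)
    (hs : Poly fun e => s e.hd e.tl.hd e.tl.tl) (hP : PBdd B)
    (hB : ∀ d, ∀ j, ((((l d).toList).take j).foldl (s d) (i d)).size ≤ B d) :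
    Poly fun d => (l d).toList.foldl (s d) (i d) := by
  obtain ⟨p, U, hU, h⟩ := Runnable.foldl hl hi hs hB
  exact Poly.tl (Poly.tl ⟨_, hU.add (hl.size_le.mul ((PBdd.const 10).mul
    (((hU.add hP).eval p).add (PBdd.const 2)))), h⟩)

/-- A polynomial-time step might square the value each time. If it only adds a polynomial in the
parameter and the element, all intermediate values remain polynomial. The invariant `I` serves steps
for which this holds on reachable values only. -/
theorem Poly.foldl (hl : Poly l) (hi : Poly i) (hs : Poly fun e => s e.hd e.tl.hd e.tl.tl)
    (I : Data → Data → Prop) (hI : ∀ d, I d (i d)) {T : Data → ℕ} (hT : PBdd T)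
    (h : ∀ d a x, I d a → x ∈ (l d).toList →
      I d (s d a x) ∧ (s d a x).size ≤ a.size + T (Data.cons d x)) :
    Poly fun d => (l d).toList.foldl (s d) (i d) := by
  obtain ⟨p, hp⟩ := hT
  refine Poly.foldl_of_bound hl hi hs
    (hi.size_le.add (hl.size_le.mul (((PBdd.size.add hl.size_le).add (PBdd.const 1)).eval p)))
    fun d j => ?_
  have key : ∀ L : List Data, (∀ x ∈ L, x ∈ (l d).toList) → ∀ a, I d a → I d (L.foldl (s d) a) ∧
      (L.foldl (s d) a).size ≤ a.size + L.length * p.eval (d.size + (l d).size + 1) := by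
    intro L
    induction L with
    | nil => intro _ a ha; simpa using ha
    | cons x L ih =>
      intro hL a ha
      obtain ⟨h₁, h₂⟩ := h d a x ha (hL x (by simp))
      obtain ⟨h₃, h₄⟩ := ih (fun y hy => hL y (by simp [hy])) _ h₁
      refine ⟨h₃, h₄.trans ?_⟩
      have h₅ := (hp (Data.cons d x)).trans (Polynomial.eval_nat_mono p
        (show (Data.cons d x).size ≤ d.size + (l d).size + 1 by
          have := Data.size_lt_of_mem (hL x (by simp))
          simp only [Data.size]; omega))
      rw [List.length_cons, Nat.succ_mul]
      omega
  have h₁ := (key _ (fun x hx => List.mem_of_mem_take hx) _ (hI d) :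
    I d (((l d).toList.take j).foldl (s d) (i d)) ∧ _).2
  refine h₁.trans (Nat.add_le_add_left (Nat.mul_le_mul_right _ ?_) _)
  have := Data.length_lt_size (l d)
  simp only [List.length_take]
  omega

theorem foldl_cons_eq (L : List Data) (a : Data) :
    L.foldl (fun a x => Data.cons x a) a = listCode (L.reverse ++ a.toList) := by
  induction L generalizing a with
  | nil => simp
  | cons x L ih => simp [ih]

@[fun_prop]
theorem Poly.reverse (hl : Poly l) : Poly fun d => listCode (l d).toList.reverse := by
  have := Poly.foldl (s := fun _ a x => Data.cons x a) hl (Poly.const Data.nil) (by fun_prop)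
    (fun _ _ => True) (fun _ => trivial) PBdd.size
    fun d a x _ _ => ⟨trivial, by simp only [Data.size]; omega⟩
  simpa only [foldl_cons_eq, toList_nil, List.append_nil] using this

theorem Poly.foldr (hl : Poly l) (hi : Poly i) (hs : Poly fun e => s e.hd e.tl.hd e.tl.tl)
    {T : Data → ℕ} (hT : PBdd T) (h : ∀ d a x, (s d a x).size ≤ a.size + T (Data.cons d x)) :
    Poly fun d => (l d).toList.foldr (fun x a => s d a x) (i d) := by
  have := Poly.foldl (s := s) hl.reverse hi hs (fun _ _ => True) (fun _ => trivial) hT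
    fun d a x _ _ => ⟨trivial, h d a x⟩
  simpa only [toList_listCode, List.foldl_reverse] using this

end Fold

/-! ### Polynomial-time operations on lists -/

section Lists

variable {l f g : Data → Data} {F : Data → Data → Data} {P : Data → Data → Prop}

@[fun_prop]
theorem Poly.append (hf : Poly f) (hg : Poly g) :
    Poly fun d => listCode ((f d).toList ++ (g d).toList) := by
  have := Poly.foldr (s := fun _ a x => Data.cons x a) hf hg (by fun_prop) PBdd.size
    fun d a x => by simp only [Data.size]; omega
  convert this using 2 with d
  induction (f d).toList with
  | nil => simp
  | cons x L ih => simp [ih]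

theorem Poly.flatMap (hl : Poly l) (hF : Poly fun e => F e.hd e.tl) :
    Poly fun d => listCode ((l d).toList.flatMap fun x => (F d x).toList) := by
  have := Poly.foldr (s := fun d a x => listCode ((F d x).toList ++ a.toList)) hl
    (Poly.const Data.nil)
    (Poly.append (hF.comp (f := fun e => Data.cons e.hd e.tl.tl) (by fun_prop)) (by fun_prop))
    hF.size_le fun d a x => by
      have := Data.size_listCode_append (F d x).toList a.toList
      simp only [listCode_toList] at this
      simp only [Data.hd, Data.tl]
      omega
  convert this using 2 with d
  induction (l d).toList with
  | nil => simp
  | cons x L ih => simp [← ih]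

theorem Poly.map (hl : Poly l) (hF : Poly fun e => F e.hd e.tl) :
    Poly fun d => listCode ((l d).toList.map (F d)) := by
  have := Poly.flatMap (F := fun d x => Data.cons (F d x) Data.nil) hl
    (hF.cons (Poly.const _))
  convert this using 3 with d
  induction (l d).toList with
  | nil => simp
  | cons x L ih => simp [ih]

theorem Poly.filter {dec : ∀ d, DecidablePred (P d)} (hl : Poly l) (hP : PolyP fun e => P e.hd e.tl) :
    Poly fun d => listCode ((l d).toList.filter fun x => decide (P d x)) := by
  have := Poly.flatMap (F := fun d x => if P d x then Data.cons x Data.nil else Data.nil) hl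
    (hP.ite ((Poly.tl Poly.id).cons (Poly.const _)) (Poly.const _))
  convert this using 3 with d
  induction (l d).toList with
  | nil => simp
  | cons x L ih => by_cases h : P d x <;> simp [ih, h]

theorem PolyP.exists (hl : Poly l) (hP : PolyP fun e => P e.hd e.tl) :
    PolyP fun d => ∃ x ∈ (l d).toList, P d x := by
  classical
  refine (PolyP.eq (Poly.filter (dec := fun _ _ => Classical.propDecidable _) hl hP) (Poly.const Data.nil)).not.of_iff fun d => ?_
  rw [← listCode_nil, listCode_injective.eq_iff]
  simp [List.filter_eq_nil_iff]

theorem PolyP.forall (hl : Poly l) (hP : PolyP fun e => P e.hd e.tl) :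
    PolyP fun d => ∀ x ∈ (l d).toList, P d x :=
  (PolyP.exists (P := fun d x => ¬ P d x) hl hP.not).not.of_iff fun d => by simp

theorem PolyP.mem (hf : Poly f) (hl : Poly l) : PolyP fun d => f d ∈ (l d).toList :=
  (PolyP.exists (P := fun d x => f d = x) hl
    (PolyP.eq (hf.comp (Poly.hd Poly.id)) (Poly.tl Poly.id))).of_iff
    fun d => by simp

open Classical in
theorem Poly.union (hf : Poly f) (hg : Poly g) :
    Poly fun d => listCode ((f d).toList ∪ (g d).toList) := by
  have := Poly.foldr (s := fun _ a x => if x ∈ a.toList then a else Data.cons x a) hf hg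
    (by beta_reduce; exact PolyP.ite (PolyP.mem (by fun_prop) (by fun_prop)) (by fun_prop) (by fun_prop))
    PBdd.size fun d a x => by
      split_ifs <;> simp only [Data.size] <;> omega
  convert this using 2 with d
  induction (f d).toList with
  | nil => simp
  | cons x L ih =>
    rw [List.foldr_cons, ← ih, List.cons_union, toList_listCode]
    split_ifs with h
    · rw [List.insert_of_mem h]
    · rw [List.insert_of_not_mem h, listCode_cons]

end Lists

theorem Poly.loop {b s i : Data → Data} {k S : Data → ℕ} (hb : Poly b) (hs : Poly s) (hi : Poly i)
    (hk : PBdd k) (hS : PBdd S) (hdone : ∀ d, b (s^[k d] (i d)) = Data.nil)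
    (hgo : ∀ d, ∀ j < k d, b (s^[j] (i d)) ≠ Data.nil)
    (hsize : ∀ d, ∀ j ≤ k d, (s^[j] (i d)).size ≤ S d) :
    Poly fun d => s^[k d] (i d) := by
  obtain ⟨V, hV, hi⟩ := hi
  obtain ⟨U, ⟨p, hp⟩, hs⟩ := hs
  obtain ⟨T, ⟨q, hq⟩, hb⟩ := hb
  refine ⟨_, ?_, hb.loop hs hi (M := fun d => q.eval (S d) + p.eval (S d) + S d) hdone hgo
    fun d j hj => ?_⟩
  · exact hV.add ((hk.add (PBdd.const 1)).mul ((PBdd.const 10).mul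
      ((((hS.eval q).add (hS.eval p)).add hS).add (PBdd.const 2))))
  · have h := hsize d j hj
    have h₁ := (hq (s^[j] (i d))).trans (Polynomial.eval_nat_mono q h)
    have h₂ := (hp (s^[j] (i d))).trans (Polynomial.eval_nat_mono p h)
    omega

/-! ## Recursion on trees -/

section TreeRec

variable (down : Data → Data → Data) (up : Data → Data → Data → Data)

/-- Recursion on a tree whose nodes have the form `(i, (g, children))`; `down` passes an accumulator
to the children, and `up` collects the values at the children. -/
def treeRec (a d : Data) : Data :=
  up a d (listCode (d.tl.tl.toList.attach.map fun k => treeRec (down a d) k.1))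
termination_by d.size
decreasing_by
  exact (Data.size_lt_of_mem k.2).trans_le ((Data.size_tl_le _).trans (Data.size_tl_le _))

theorem treeRec_eq (a d : Data) :
    treeRec down up a d = up a d (listCode (d.tl.tl.toList.map (treeRec down up (down a d)))) := by
  rw [treeRec]
  simp

/-- A frame holds an accumulator, a node, the children that wait, and the values (last first) at
those that have been dealt with. -/
def frame (a d rem res : Data) : Data := Data.cons a (Data.cons d (Data.cons rem res))

/-- The value `r` is delivered to the frame below. With an empty stack, `nil` is put on top, which
is the signal to halt. -/
noncomputable def popInto (r rest : Data) : Data :=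
  open Classical in if rest = Data.nil then Data.cons Data.nil r else
    Data.cons (frame rest.hd.hd rest.hd.tl.hd rest.hd.tl.tl.hd (Data.cons r rest.hd.tl.tl.tl)) rest.tl

/-- If no child waits, the value at the node is computed and delivered; otherwise a frame for the
next child is pushed. The list is reversed because values are collected last first. -/
noncomputable def treeStep (st : Data) : Data :=
  open Classical in if st.hd.tl.tl.hd = Data.nil then
    popInto (up st.hd.hd st.hd.tl.hd (listCode st.hd.tl.tl.tl.toList.reverse)) st.tl
  else Data.cons (frame (down st.hd.hd st.hd.tl.hd) st.hd.tl.tl.hd.hd st.hd.tl.tl.hd.hd.tl.tl Data.nil)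
    (Data.cons (frame st.hd.hd st.hd.tl.hd st.hd.tl.tl.hd.tl st.hd.tl.tl.tl) st.tl)

variable {down up}

theorem size_popInto_le (r rest : Data) : (popInto r rest).size ≤ rest.size + r.size + 10 := by
  unfold popInto frame
  split_ifs with h
  · simp only [Data.size]; omega
  · rcases rest with _ | ⟨_ | ⟨a, _ | ⟨b, _ | ⟨c, e⟩⟩⟩, t⟩ <;> simp [Data.size, Data.hd, Data.tl] <;>
      omega

theorem poly_treeStep (hd : Poly fun e => down e.hd e.tl)
    (hu : Poly fun e => up e.hd e.tl.hd e.tl.tl) : Poly (treeStep down up) := by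
  have hpop : Poly fun e => popInto e.hd e.tl :=
    by unfold popInto frame; exact PolyP.ite (PolyP.eq (by fun_prop) (by fun_prop)) (by fun_prop) (by fun_prop)
  unfold treeStep
  refine PolyP.ite (PolyP.eq (by fun_prop) (by fun_prop)) ?_ ?_
  · have h₁ := hu.comp (f := fun st => Data.cons st.hd.hd (Data.cons st.hd.tl.hd
      (listCode st.hd.tl.tl.tl.toList.reverse))) (by fun_prop)
    exact hpop.comp (h₁.cons (Poly.tl Poly.id))
  · have h₁ := hd.comp (f := fun st => Data.cons st.hd.hd st.hd.tl.hd) (by fun_prop)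
    exact (Poly.cons h₁ (by fun_prop)).cons (by unfold frame; fun_prop)

/-- In `m` steps `st` is turned into `st'`; the size grows by at most `Q` in a step. -/
def Steps (s : Data → Data) (Q m : ℕ) (st st' : Data) : Prop :=
  s^[m] st = st' ∧ (∀ j < m, (s^[j] st).hd ≠ Data.nil) ∧
    ∀ j ≤ m, (s^[j] st).size ≤ st.size + j * Q

theorem Steps.trans {s : Data → Data} {Q m m' : ℕ} {st st' st'' : Data} (h : Steps s Q m st st')
    (h' : Steps s Q m' st' st'') : Steps s Q (m + m') st st'' := by
  obtain ⟨rfl, h₂, h₃⟩ := h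
  obtain ⟨rfl, h₅, h₆⟩ := h'
  have e : ∀ j, m ≤ j → s^[j] st = s^[j - m] (s^[m] st) := fun j hj => by
    rw [← Function.iterate_add_apply]; congr 2; omega
  refine ⟨by rw [e _ (by omega)]; congr 2; omega, fun j hj => ?_, fun j hj => ?_⟩
  · by_cases hjm : j < m
    · exact h₂ j hjm
    · rw [e j (by omega)]; exact h₅ _ (by omega)
  · by_cases hjm : j < m
    · exact h₃ j hjm.le
    · rw [e j (by omega)]
      refine (h₆ _ (by omega)).trans ((Nat.add_le_add_right (h₃ m le_rfl) _).trans ?_)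
      rw [add_assoc, ← add_mul, Nat.add_sub_cancel' (by omega)]

theorem Steps.single {s : Data → Data} {Q : ℕ} {st : Data} (h : st.hd ≠ Data.nil)
    (hQ : (s st).size ≤ st.size + Q) : Steps s Q 1 st (s st) := by
  refine ⟨rfl, fun j hj => ?_, fun j hj => ?_⟩
  · obtain rfl : j = 0 := by omega
    exact h
  · obtain rfl | rfl : j = 0 ∨ j = 1 := by omega
    · simp
    · simpa using hQ

/-- `M` is a budget for the accumulators: a child is smaller than its parent, so `a.size + d.size *
p.eval S ≤ M` is kept although each descent may add `p.eval S` to the accumulator. Each waiting node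
costs one push and each frame one pop, which gives the bound `2 * rem.size`. -/
theorem steps_treeStep {p q : Polynomial ℕ}
    (hdown : ∀ a d, (down a d).size ≤ a.size + p.eval d.size)
    (hup : ∀ a d r, (up a d r).size ≤ r.size + q.eval (a.size + d.size)) {M S : ℕ} :
    ∀ (N : ℕ) (rem : Data), rem.size ≤ N → ∀ a d res rest,
      a.size + d.size * p.eval S ≤ M → d.size ≤ S → (∀ k ∈ rem.toList, k.size < d.size) →
      ∃ m ≤ 2 * rem.size, Steps (treeStep down up) (M + 2 * S + q.eval (M + S) + 20) m
        (Data.cons (frame a d rem res) rest)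
        (popInto (up a d (listCode (res.toList.reverse ++
          rem.toList.map (treeRec down up (down a d))))) rest) := by
  intro N
  induction N with
  | zero => intro rem h; have := rem.size_pos; omega
  | succ N ih =>
    intro rem hN a d res rest ha hd hk
    have haM : a.size ≤ M := le_trans (Nat.le_add_right _ _) ha
    cases rem with
    | nil =>
      refine ⟨1, by simp [Data.size], ?_⟩
      have e : treeStep down up (Data.cons (frame a d Data.nil res) rest) =
          popInto (up a d (listCode (res.toList.reverse))) rest := by
        simp [treeStep, frame, Data.hd, Data.tl]
      simp only [toList_nil, List.map_nil, List.append_nil]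
      rw [← e]
      refine Steps.single (by simp [frame, Data.hd]) ?_
      rw [e]
      refine (size_popInto_le _ _).trans ?_
      have h₁ := hup a d (listCode res.toList.reverse)
      have h₂ := Polynomial.eval_nat_mono q (show a.size + d.size ≤ M + S by omega)
      -- The size of a list of data does not depend on the order of its elements.
      have h₃ : (listCode res.toList.reverse).size = res.size := by
        have : ∀ L L' : List Data, L.Perm L' → (listCode L).size = (listCode L').size := by
          intro L L' h
          induction h with
          | nil => rfl
          | cons x _ ih => simp [Data.size, ih]
          | swap x y l => simp only [listCode_cons, Data.size]; omega
          | trans _ _ h₁ h₂ => rw [h₁, h₂]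
        rw [this _ _ res.toList.reverse_perm, listCode_toList]
      simp only [frame, Data.size]
      omega
    | cons k rem =>
      simp only [Data.size] at hN
      have hkd : k.size < d.size := hk k (by simp)
      have hkk : k.tl.tl.size ≤ k.size := (Data.size_tl_le _).trans (Data.size_tl_le _)
      have hda := hdown a d
      have hpS := Polynomial.eval_nat_mono p hd
      have hmul : (k.size + 1) * p.eval S ≤ d.size * p.eval S := Nat.mul_le_mul_right _ hkd
      rw [add_mul, one_mul] at hmul
      have e : treeStep down up (Data.cons (frame a d (Data.cons k rem) res) rest) =
          Data.cons (frame (down a d) k k.tl.tl Data.nil) (Data.cons (frame a d rem res) rest) := by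
        simp [treeStep, frame, Data.hd, Data.tl]
      have s₁ := Steps.single (s := treeStep down up) (Q := M + 2 * S + q.eval (M + S) + 20)
        (st := Data.cons (frame a d (Data.cons k rem) res) rest) (by simp [frame, Data.hd])
        (by rw [e]; simp only [frame, Data.size]; omega)
      rw [e] at s₁
      obtain ⟨m₂, hm₂, s₂⟩ := ih k.tl.tl (by omega) (down a d) k Data.nil
        (Data.cons (frame a d rem res) rest) (by omega) (by omega)
        fun x hx => (Data.size_lt_of_mem hx).trans_le hkk
      obtain ⟨m₃, hm₃, s₃⟩ := ih rem (by omega) a d (Data.cons (treeRec down up (down a d) k) res)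
        rest ha hd fun x hx => hk x (by simp [hx])
      refine ⟨1 + m₂ + m₃, by simp only [Data.size]; omega, (s₁.trans s₂).trans ?_⟩
      rw [toList_nil, List.reverse_nil, List.nil_append, ← treeRec_eq down up]
      simpa [popInto, frame, Data.hd, Data.tl] using s₃

/-- Both the number of steps and the growth per step are polynomial. It matters that `hdown` and
`hup` are additive: a constant factor at each level could make the sizes exponential in the depth.
-/
theorem poly_treeRec (hd : Poly fun e => down e.hd e.tl)
    (hu : Poly fun e => up e.hd e.tl.hd e.tl.tl) {p q : Polynomial ℕ}
    (hdown : ∀ a d, (down a d).size ≤ a.size + p.eval d.size)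
    (hup : ∀ a d r, (up a d r).size ≤ r.size + q.eval (a.size + d.size)) {f g : Data → Data}
    (hf : Poly f) (hg : Poly g) : Poly fun d => treeRec down up (f d) (g d) := by
  have key := fun d => steps_treeStep hdown hup (M := (f d).size + (g d).size * p.eval (g d).size)
    (S := (g d).size) _ (g d).tl.tl le_rfl (f d) (g d) Data.nil Data.nil le_rfl le_rfl
    fun k hk => (Data.size_lt_of_mem hk).trans_le
      ((Data.size_tl_le _).trans (Data.size_tl_le _))
  choose m hm hsteps using key
  have hM := (hf.size_le.add (hg.size_le.mul (hg.size_le.eval p)))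
  have hQ := ((hM.add ((PBdd.const 2).mul hg.size_le)).add
    ((hM.add hg.size_le).eval q)).add (PBdd.const 20)
  have hi : Poly fun d => Data.cons (frame (f d) (g d) (g d).tl.tl Data.nil) Data.nil := by
    unfold frame; fun_prop
  have hmb : PBdd m := ((PBdd.const 2).mul (((Poly.tl (Poly.tl Poly.id)).comp hg).size_le)).mono hm
  have := Poly.loop (Poly.hd Poly.id) (poly_treeStep hd hu) hi hmb
    (hi.size_le.add (hmb.mul hQ))
    (fun d => by
      rw [(hsteps d).1]
      simp [popInto, Data.hd])
    (fun d j hj => (hsteps d).2.1 j hj)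
    (fun d j hj => ((hsteps d).2.2 j hj).trans
      (Nat.add_le_add_left (Nat.mul_le_mul_right _ hj) _))
  convert this.tl using 2 with d
  rw [(hsteps d).1, toList_nil, List.reverse_nil, List.nil_append, ← treeRec_eq down up]
  simp [popInto, Data.tl]

end TreeRec

end AbsCalc

namespace AbsCalc

/-! ## The upward space -/

variable {n : ℕ}

namespace ESystem

@[simp]
theorem union_empty (G : ESystem n) : G.union empty = G := by
  ext1; simp [union, empty]

@[simp]
theorem empty_union (G : ESystem n) : empty.union G = G := by
  ext1; simp [union, empty]

theorem union_assoc (G G' G'' : ESystem n) :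
    (G.union G').union G'' = G.union (G'.union G'') := by
  ext1; simp [union, Finset.union_assoc]

theorem mem_pair {p q : Production n} : q ∈ (pair p).rules ↔ q = p ∨ q = Production.conv p := by
  simp [pair]

theorem pair_eq_of_mem {p q : Production n} (h : q ∈ (pair p).rules) : pair q = pair p := by
  rcases mem_pair.mp h with rfl | rfl
  · rfl
  · ext1
    simp [pair, Production.conv_conv, Finset.pair_comm]

end ESystem

namespace Rule

theorem IsHorn.absorb_eq {ρ : Rule n} (h : ρ.IsHorn) (G : ESystem n) : ρ.absorb G = ρ := by
  cases ρ <;> first | rfl | exact h.elim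

@[simp]
theorem isHorn_absorb {ρ : Rule n} {G : ESystem n} : (ρ.absorb G).IsHorn ↔ ρ.IsHorn := by
  cases ρ <;> rfl

theorem absorb_absorb (G G' : ESystem n) (ρ : Rule n) :
    (ρ.absorb G).absorb G' = ρ.absorb (G.union G') := by
  cases ρ <;> simp [Rule.absorb, Constraint.absorb, Label.absorb, ESystem.union_assoc]

@[simp]
theorem absorb_empty (ρ : Rule n) : ρ.absorb ESystem.empty = ρ := by
  cases ρ <;> simp [Rule.absorb, Constraint.absorb, Label.absorb]

theorem IsHorn.exists_pair {ρ : Rule n} (h : ρ.IsHorn) : ∃ p, ρ.grammar = ESystem.pair p := by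
  cases ρ <;> first | exact h.elim | exact ⟨_, rfl⟩

end Rule

theorem mem_hornRules {A : Calculus n} {ρ : Rule n} : ρ ∈ hornRules A ↔ ρ ∈ A ∧ ρ.IsHorn := by
  simp [hornRules]

theorem mem_grammarOf {A : Finset (Rule n)} {p : Production n} :
    p ∈ (grammarOf A).rules ↔ ∃ ρ ∈ A, p ∈ ρ.grammar.rules := by
  simp [grammarOf, ESystem.biUnion]

theorem grammarOf_empty : grammarOf (∅ : Finset (Rule n)) = ESystem.empty := by
  ext1; rfl

theorem grammarOf_union (A B : Finset (Rule n)) :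
    grammarOf (A ∪ B) = (grammarOf A).union (grammarOf B) := by
  ext1
  ext p
  simp only [mem_grammarOf, ESystem.union, Finset.mem_union]
  constructor
  · rintro ⟨ρ, h | h, hp⟩
    · exact Or.inl ⟨ρ, h, hp⟩
    · exact Or.inr ⟨ρ, h, hp⟩
  · rintro (⟨ρ, h, hp⟩ | ⟨ρ, h, hp⟩)
    · exact ⟨ρ, Or.inl h, hp⟩
    · exact ⟨ρ, Or.inr h, hp⟩

/-- Absorption fixes Horn rules and turns no other rule into one, so `H` may just as well be removed
before the absorption. -/
theorem mem_absorbHorn {A : Calculus n} {H : Finset (Rule n)} (hH : ∀ h ∈ H, h.IsHorn)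
    {ρ : Rule n} :
    ρ ∈ absorbHorn A H ↔ ∃ ρ' ∈ A, ρ' ∉ H ∧ ρ'.absorb (grammarOf H) = ρ := by
  simp only [absorbHorn, absorbCalc, Finset.mem_sdiff, Finset.mem_image]
  constructor
  · rintro ⟨⟨ρ', h, rfl⟩, h'⟩
    exact ⟨ρ', h, fun hρ => h' (by rwa [(hH _ hρ).absorb_eq]), rfl⟩
  · rintro ⟨ρ', h, h', rfl⟩
    refine ⟨⟨ρ', h, rfl⟩, fun hρ => h' ?_⟩
    rwa [(Rule.isHorn_absorb.mp (hH _ hρ)).absorb_eq] at hρ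

theorem hornRules_absorbHorn {A : Calculus n} {H : Finset (Rule n)} (hH : H ⊆ hornRules A) :
    hornRules (absorbHorn A H) = hornRules A \ H := by
  ext ρ
  rw [mem_hornRules, mem_absorbHorn fun h hh => (mem_hornRules.mp (hH hh)).2, Finset.mem_sdiff,
    mem_hornRules]
  constructor
  · rintro ⟨⟨ρ', h, h', rfl⟩, hρ⟩
    have hρ' := Rule.isHorn_absorb.mp hρ
    rw [hρ'.absorb_eq]
    exact ⟨⟨h, hρ'⟩, h'⟩
  · rintro ⟨⟨h, hρ⟩, h'⟩
    exact ⟨⟨ρ, h, h', hρ.absorb_eq _⟩, hρ⟩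

theorem absorbHorn_empty (A : Calculus n) : absorbHorn A ∅ = A := by
  ext ρ
  simp [mem_absorbHorn, grammarOf_empty]

theorem absorbHorn_absorbHorn {A : Calculus n} {H H' : Finset (Rule n)} (hH : H ⊆ hornRules A)
    (hH' : H' ⊆ hornRules (absorbHorn A H)) :
    absorbHorn (absorbHorn A H) H' = absorbHorn A (H ∪ H') := by
  have h₁ : ∀ h ∈ H, h.IsHorn := fun h hh => (mem_hornRules.mp (hH hh)).2
  have h₂ : ∀ h ∈ H', h.IsHorn := fun h hh => (mem_hornRules.mp (hH' hh)).2
  have h₃ : ∀ h ∈ H ∪ H', h.IsHorn := fun h hh => (Finset.mem_union.mp hh).elim (h₁ h) (h₂ h)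
  ext ρ
  rw [mem_absorbHorn h₂, mem_absorbHorn h₃]
  constructor
  · rintro ⟨ρ', h, h', rfl⟩
    obtain ⟨ρ, k, k', rfl⟩ := (mem_absorbHorn h₁).mp h
    refine ⟨ρ, k, fun hρ => ?_, by rw [grammarOf_union, Rule.absorb_absorb]⟩
    rcases Finset.mem_union.mp hρ with hρ | hρ
    · exact k' hρ
    · exact h' (by rwa [(h₂ _ hρ).absorb_eq])
  · rintro ⟨ρ, k, k', rfl⟩
    simp only [Finset.mem_union, not_or] at k'
    refine ⟨_, (mem_absorbHorn h₁).mpr ⟨ρ, k, k'.1, rfl⟩, fun hρ => k'.2 ?_,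
      by rw [grammarOf_union, Rule.absorb_absorb]⟩
    rwa [(Rule.isHorn_absorb.mp (h₂ _ hρ)).absorb_eq] at hρ

/-- `H` can be recovered as the set of Horn rules of `A` that are missing from the result. -/
theorem absorbHorn_injOn {A : Calculus n} {H H' : Finset (Rule n)} (hH : H ⊆ hornRules A)
    (hH' : H' ⊆ hornRules A) (h : absorbHorn A H = absorbHorn A H') : H = H' := by
  have := congrArg hornRules h
  rw [hornRules_absorbHorn hH, hornRules_absorbHorn hH'] at this
  rw [← Finset.sdiff_sdiff_eq_self hH, this, Finset.sdiff_sdiff_eq_self hH']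

/-- The Horn rules have the same grammar, or `h` is immediately below `h'`. -/
def Conflict (h h' : Rule n) : Prop :=
  h.grammar = h'.grammar ∨ ∃ p ∈ h.grammar.rules, ∃ p' ∈ h'.grammar.rules, p'.1 ∈ p.2

theorem mem_pairs_grammarOf {H : Finset (Rule n)} (hH : ∀ h ∈ H, h.IsHorn) {q : ESystem n} :
    q ∈ (grammarOf H).pairs ↔ ∃ h ∈ H, h.grammar = q := by
  constructor
  · rintro ⟨p, hp, rfl⟩
    obtain ⟨h, hh, hp⟩ := mem_grammarOf.mp hp
    obtain ⟨q, hq⟩ := (hH h hh).exists_pair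
    rw [hq] at hp
    exact ⟨h, hh, by rw [hq, ESystem.pair_eq_of_mem hp]⟩
  · rintro ⟨h, hh, rfl⟩
    obtain ⟨q, hq⟩ := (hH h hh).exists_pair
    exact ⟨q, mem_grammarOf.mpr ⟨h, hh, by rw [hq]; exact ESystem.mem_pair.mpr (Or.inl rfl)⟩, hq⟩

/-- A chain of dependencies from a rule outside `V` to one inside must enter `V` in a single step.
Equality of grammars counts as a step because the preorder sees rules only through their grammars.
No transitive closure is needed in the algorithm. -/
theorem antiFracturable_iff {H V : Finset (Rule n)} (hH : ∀ h ∈ H, h.IsHorn) :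
    AntiFracturable H V ↔ V ⊆ H ∧ ∀ h ∈ H, h ∉ V → ∀ h' ∈ V, ¬ Conflict h h' := by
  have key : ∀ W, AntiFracturable H W ↔ W ⊆ H ∧ ∀ h ∈ H, h ∉ W → ∀ h' ∈ W, ¬ HornLE H h h' := by
    intro W
    constructor
    · rintro ⟨V', ⟨hV', h⟩, rfl⟩
      refine ⟨Finset.sdiff_subset, fun h₁ hh₁ hn h' hh' => ?_⟩
      simp only [Finset.mem_sdiff, not_and, not_not] at hn hh'
      exact h h₁ (hn hh₁) h' (Finset.mem_sdiff.mpr hh')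
    · rintro ⟨hW, h⟩
      refine ⟨H \ W, ⟨Finset.sdiff_subset, fun h₁ hh₁ h' hh' => ?_⟩,
        (Finset.sdiff_sdiff_eq_self hW).symm⟩
      rw [Finset.sdiff_sdiff_eq_self hW] at hh'
      rw [Finset.mem_sdiff] at hh₁
      exact h h₁ hh₁.1 hh₁.2 h' hh'
  rw [key]
  refine and_congr_right fun hV => ⟨fun h h₁ hh₁ hn h' hh' hc => h h₁ hh₁ hn h' hh' ?_,
    fun h h₁ hh₁ hn h' hh' hle => ?_⟩
  · by_cases he : h₁.grammar = h'.grammar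
    · rw [HornLE, he]
    · exact Relation.ReflTransGen.single ⟨(mem_pairs_grammarOf hH).mpr ⟨h₁, hh₁, rfl⟩,
        (mem_pairs_grammarOf hH).mpr ⟨h', hV hh', rfl⟩, he, hc.resolve_left he⟩
  · have : ∀ q, Relation.ReflTransGen (grammarOf H).Dep h₁.grammar q → ∀ g ∈ H, g.grammar = q →
        g ∉ V := by
      intro q hq
      induction hq with
      | refl => exact fun g _ hgq hgV => h h₁ hh₁ hn g hgV (Or.inl hgq.symm)
      | tail _ hd ih =>
        intro g _ hgq hgV
        obtain ⟨hq, _, _, hd⟩ := hd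
        obtain ⟨g', hg', rfl⟩ := (mem_pairs_grammarOf hH).mp hq
        subst hgq
        exact h g' hg' (ih g' hg' rfl) g hgV (Or.inr hd)
    exact this _ hle h' (hV hh') rfl hh'

theorem isHorn_of_mem_hornRules {A : Calculus n} : ∀ h ∈ hornRules A, h.IsHorn :=
  fun _ hh => (mem_hornRules.mp hh).2

theorem antiFracturable_self (A : Calculus n) : AntiFracturable (hornRules A) (hornRules A) :=
  (antiFracturable_iff isHorn_of_mem_hornRules).mpr ⟨subset_rfl, fun _ h h' => absurd h h'⟩

theorem antiFracturable_empty (A : Calculus n) : AntiFracturable (hornRules A) ∅ :=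
  (antiFracturable_iff isHorn_of_mem_hornRules).mpr ⟨Finset.empty_subset _, by simp⟩

theorem AntiFracturable.subset {A : Calculus n} {H : Finset (Rule n)}
    (h : AntiFracturable (hornRules A) H) : H ⊆ hornRules A := by
  obtain ⟨V, _, rfl⟩ := h
  exact Finset.sdiff_subset

theorem AntiFracturable.union {A : Calculus n} {H H' : Finset (Rule n)}
    (h : AntiFracturable (hornRules A) H)
    (h' : AntiFracturable (hornRules (absorbHorn A H)) H') :
    AntiFracturable (hornRules A) (H ∪ H') := by
  have hs := h.subset
  rw [hornRules_absorbHorn hs] at h'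
  rw [antiFracturable_iff fun g hg => isHorn_of_mem_hornRules g (Finset.mem_sdiff.mp hg).1] at h'
  rw [antiFracturable_iff isHorn_of_mem_hornRules] at h ⊢
  refine ⟨Finset.union_subset hs (h'.1.trans Finset.sdiff_subset), fun g hg hn g' hg' => ?_⟩
  simp only [Finset.mem_union, not_or] at hn
  rcases Finset.mem_union.mp hg' with hg' | hg'
  · exact h.2 g hg hn.1 g' hg'
  · exact h'.2 g (Finset.mem_sdiff.mpr ⟨hg, hn.1⟩) hn.2 g' hg'

/-- Together with `AntiFracturable.union`, this matches the steps that start at `absorbHorn A H`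
with the anti-fracturable sets of `A` that contain `H`. -/
theorem AntiFracturable.sdiff {A : Calculus n} {H H' : Finset (Rule n)}
    (h : AntiFracturable (hornRules A) H) (h' : AntiFracturable (hornRules A) H') :
    AntiFracturable (hornRules (absorbHorn A H)) (H' \ H) := by
  have hs := h.subset
  rw [hornRules_absorbHorn hs]
  rw [antiFracturable_iff fun g hg => isHorn_of_mem_hornRules g (Finset.mem_sdiff.mp hg).1]
  rw [antiFracturable_iff isHorn_of_mem_hornRules] at h h'
  refine ⟨Finset.sdiff_subset_sdiff h'.1 subset_rfl, fun g hg hn g' hg' => ?_⟩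
  simp only [Finset.mem_sdiff, not_and, not_not] at hg hn hg'
  exact h'.2 g hg.1 (fun k => hg.2 (hn k)) g' hg'.1

theorem upMem_iff {A B : Calculus n} :
    UpMem A B ↔ ∃ H, AntiFracturable (hornRules A) H ∧ B = absorbHorn A H := by
  constructor
  · intro h
    induction h with
    | base => exact ⟨∅, antiFracturable_empty A, (absorbHorn_empty A).symm⟩
    | step _ hH ih =>
      obtain ⟨H', hH', rfl⟩ := ih
      exact ⟨_, hH'.union hH, absorbHorn_absorbHorn hH'.subset hH.subset⟩
  · rintro ⟨H, hH, rfl⟩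
    exact UpMem.step UpMem.base hH

theorem mem_upSpace_le_iff {A : Calculus n} {q : Calculus n × Calculus n} :
    q ∈ (upSpace A).le ↔ ∃ H H', AntiFracturable (hornRules A) H ∧
      AntiFracturable (hornRules A) H' ∧ H ⊆ H' ∧ q = (absorbHorn A H, absorbHorn A H') := by
  obtain ⟨B, C⟩ := q
  simp only [upSpace, Set.mem_ofPred_eq, upMem_iff, Prod.mk.injEq]
  constructor
  · rintro ⟨⟨H, hH, rfl⟩, H', hH', rfl⟩
    exact ⟨H, H ∪ H', hH, hH.union hH', Finset.subset_union_left, rfl,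
      absorbHorn_absorbHorn hH.subset hH'.subset⟩
  · rintro ⟨H, H', hH, hH', hs, rfl, rfl⟩
    refine ⟨⟨H, hH, rfl⟩, H' \ H, hH.sdiff hH', ?_⟩
    rw [absorbHorn_absorbHorn hH.subset (hH.sdiff hH').subset, Finset.union_sdiff_of_subset hs]

theorem isTop_absorbHorn (A : Calculus n) :
    (upSpace A).IsTop (absorbHorn A (hornRules A)) := by
  refine ⟨UpMem.step UpMem.base (antiFracturable_self A), fun B hB => ?_⟩
  obtain ⟨H, hH, rfl⟩ := upMem_iff.mp hB
  exact mem_upSpace_le_iff.mpr ⟨H, _, hH, antiFracturable_self A, hH.subset, rfl⟩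

/-- The full absorption lies below `T`, and no set of Horn rules is properly larger than the full
one. -/
theorem eq_of_isTop {A T : Calculus n} (h : (upSpace A).IsTop T) :
    T = absorbHorn A (hornRules A) := by
  obtain ⟨H, H', hH, hH', hs, he⟩ := mem_upSpace_le_iff.mp (h.2 _ (isTop_absorbHorn A).1)
  simp only [Prod.mk.injEq] at he
  have := absorbHorn_injOn (antiFracturable_self A).subset hH.subset he.1
  subst this
  rw [he.2, hH'.subset.antisymm hs]

/-! ### The algorithm IMPLICATE -/

theorem implicateRound_upSpace (A : Calculus n) : implicateRound (upSpace A) = upSpace A := by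
  have h : ∀ B H, (upSpace A).IsMaximal B → AntiFracturable (hornRules B) H →
      UpMem A (absorbHorn B H) ∧ (B, absorbHorn B H) ∈ (upSpace A).le := fun B H hB hH =>
    ⟨UpMem.step hB.1 hH, hB.1, H, hH, rfl⟩
  ext q
  · simp only [implicateRound, Set.mem_union, Set.mem_ofPred_eq]
    constructor
    · rintro (hq | ⟨B, H, hB, hH, rfl⟩)
      · exact hq
      · exact (h B H hB hH).1
    · exact Or.inl
  · simp only [implicateRound, Set.mem_union, Set.mem_ofPred_eq]
    constructor
    · rintro (hq | ⟨B, H, hB, hH, rfl⟩)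
      · exact hq
      · exact (h B H hB hH).2
    · exact Or.inl

theorem implicateRound_init (A : Calculus n) : implicateRound ⟨{A}, ∅⟩ =
    ⟨{B | UpMem A B}, {q | q.1 = A ∧ q ∈ (upSpace A).le}⟩ := by
  have hmax : ∀ B, (⟨{A}, ∅⟩ : Space n).IsMaximal B ↔ B = A := fun B => by
    simp [Space.IsMaximal]
  ext q
  · simp only [implicateRound, hmax, Set.mem_union, Set.mem_ofPred_eq, Set.mem_singleton_iff,
      upMem_iff]
    constructor
    · rintro (rfl | ⟨B, H, rfl, hH, rfl⟩)
      · exact ⟨∅, antiFracturable_empty _, (absorbHorn_empty _).symm⟩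
      · exact ⟨H, hH, rfl⟩
    · rintro ⟨H, hH, rfl⟩
      exact Or.inr ⟨A, H, rfl, hH, rfl⟩
  · simp only [implicateRound, hmax, Set.empty_union, Set.mem_ofPred_eq]
    constructor
    · rintro ⟨B, H, rfl, hH, rfl⟩
      exact ⟨rfl, UpMem.base, H, hH, rfl⟩
    · rintro ⟨h, _, H, hH, hq⟩
      exact ⟨A, H, rfl, h ▸ hH, by rw [← h, ← hq]⟩

/-- After the first round all pairs start at `A`, so every other member is maximal. The second round
adds all pairs that start at these members, and those that start at `A` are already present. -/
theorem implicateStage_two (A : Calculus n) : implicateStage A 2 = upSpace A := by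
  show implicateRound (implicateRound ⟨{A}, ∅⟩) = _
  rw [implicateRound_init]
  set X : Space n := ⟨{B | UpMem A B}, {q | q.1 = A ∧ q ∈ (upSpace A).le}⟩ with hX
  have hmax : ∀ B, UpMem A B → B ≠ A → X.IsMaximal B := fun B hB hBA =>
    ⟨hB, fun C _ hC => absurd hC.1 hBA⟩
  ext q
  · simp only [implicateRound, Set.mem_union, Set.mem_ofPred_eq]
    constructor
    · rintro (hq | ⟨B, H, hB, hH, rfl⟩)
      · exact hq
      · exact UpMem.step hB.1 hH
    · exact Or.inl
  · simp only [implicateRound, Set.mem_union, Set.mem_ofPred_eq]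
    constructor
    · rintro (hq | ⟨B, H, hB, hH, rfl⟩)
      · exact hq.2
      · exact ⟨hB.1, H, hH, rfl⟩
    · intro hq
      by_cases hA : q.1 = A
      · exact Or.inl ⟨hA, hq⟩
      · obtain ⟨hq, H, hH, he⟩ := hq
        exact Or.inr ⟨q.1, H, hmax _ hq hA, hH, by rw [← he]⟩

theorem implicateReturns_upSpace (A : Calculus n) : ImplicateReturns A (upSpace A) := by
  classical
  have hsucc : ∀ k, implicateStage A (k + 1) = implicateRound (implicateStage A k) := fun k =>
    Function.iterate_succ_apply' _ _ _
  have hfix : ∃ k, implicateStage A (k + 1) = implicateStage A k :=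
    ⟨2, by rw [hsucc, implicateStage_two, implicateRound_upSpace]⟩
  refine ⟨Nat.find hfix, fun j hj => Nat.find_min hfix hj, Nat.find_spec hfix, ?_⟩
  have hle : Nat.find hfix ≤ 2 :=
    Nat.find_min' hfix (by rw [hsucc, implicateStage_two, implicateRound_upSpace])
  -- From its first repetition on the sequence of stages is constant, so the space returned is the
  -- one at stage two.
  have : ∀ m, implicateStage A (Nat.find hfix + m) = implicateStage A (Nat.find hfix) := by
    intro m
    induction m with
    | zero => rfl
    | succ m ih => rw [← add_assoc, hsucc, ih, ← hsucc, Nat.find_spec hfix]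
  rw [← implicateStage_two, ← this (2 - Nat.find hfix), Nat.add_sub_cancel' hle]

/-! ### Explicit and implicit calculi -/

/-- The systems in the labels of a rule. -/
def Rule.systems : Rule n → Set (ESystem n)
  | init C _ => {G | ∃ e, G = (C.label e).1}
  | reach fam _ => {G | ∃ L ∈ fam, G = L.1}
  | _ => ∅

theorem ESystem.sdiff_eq_self_iff {G G' : ESystem n} :
    G.sdiff G' = G ↔ ∀ p ∈ G.rules, p ∉ G'.rules := by
  rw [ESystem.ext_iff, sdiff]
  simp [Finset.sdiff_eq_self_iff_disjoint, Finset.disjoint_left]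

theorem ESystem.union_eq_self_iff {G G' : ESystem n} :
    G.union G' = G ↔ G'.rules ⊆ G.rules := by
  rw [ESystem.ext_iff, union]
  simp

theorem Rule.mem_grammar_of_systems {ρ : Rule n} {G : ESystem n} (hG : G ∈ ρ.systems)
    {p : Production n} (hp : p ∈ G.rules) : p ∈ ρ.grammar.rules := by
  cases ρ with
  | init C R =>
    obtain ⟨e, rfl⟩ := hG
    simp only [Rule.grammar, Constraint.grammar, ESystem.biUnion, Finset.mem_biUnion]
    exact ⟨e, Finset.mem_attach _ _, hp⟩
  | reach fam R =>
    obtain ⟨L, hL, rfl⟩ := hG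
    simp only [Rule.grammar]
    induction fam with
    | nil => simp at hL
    | cons L' fam ih =>
      simp only [List.foldr_cons, ESystem.union, Finset.mem_union]
      rcases List.mem_cons.mp hL with rfl | hL
      · exact Or.inl hp
      · exact Or.inr (ih hL)
  | _ => exact hG.elim

theorem Rule.exists_systems_of_mem_grammar {ρ : Rule n} (hρ : ¬ ρ.IsHorn) {p : Production n}
    (hp : p ∈ ρ.grammar.rules) : ∃ G ∈ ρ.systems, p ∈ G.rules := by
  cases ρ with
  | init C R =>
    simp only [Rule.grammar, Constraint.grammar, ESystem.biUnion, Finset.mem_biUnion] at hp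
    obtain ⟨e, _, hp⟩ := hp
    exact ⟨_, ⟨e, rfl⟩, hp⟩
  | reach fam R =>
    simp only [Rule.grammar] at hp
    induction fam with
    | nil => simp [ESystem.empty] at hp
    | cons L' fam ih =>
      simp only [List.foldr_cons, ESystem.union, Finset.mem_union] at hp
      rcases hp with hp | hp
      · exact ⟨_, ⟨L', by simp, rfl⟩, hp⟩
      · obtain ⟨_, ⟨L, hL, rfl⟩, h⟩ := ih hρ hp
        exact ⟨_, ⟨L, by simp [hL], rfl⟩, h⟩
  | hornF => exact (hρ trivial).elim
  | hornB => exact (hρ trivial).elim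
  | loc => simp [Rule.grammar, ESystem.empty] at hp
  | exp => simp [Rule.grammar, ESystem.empty] at hp

theorem map_eq_self_iff {α : Type*} {f : α → α} {l : List α} :
    l.map f = l ↔ ∀ x ∈ l, f x = x := by
  induction l with
  | nil => simp
  | cons x l ih => simp [ih]

theorem Rule.fracture_eq_self_iff {ρ : Rule n} {G : ESystem n} :
    ρ.fracture G = ρ ↔ ∀ G' ∈ ρ.systems, G'.sdiff G = G' := by
  cases ρ with
  | init C R =>
    obtain ⟨V, E, l, ht⟩ := C
    simp [Rule.fracture, Rule.systems, Constraint.fracture, Label.fracture, funext_iff, Prod.ext_iff]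
    exact ⟨fun h G' a b c e => e ▸ h a b c, fun h a b c => h _ a b c rfl⟩
  | reach fam R =>
    simp only [Rule.fracture, Rule.systems, Rule.reach.injEq, and_true, Set.mem_ofPred_eq,
      forall_exists_index, and_imp]
    rw [map_eq_self_iff]
    simp [Label.fracture, Prod.ext_iff]
    grind
  | _ => simp [Rule.fracture, Rule.systems]

theorem Rule.absorb_eq_self_iff {ρ : Rule n} {G : ESystem n} :
    ρ.absorb G = ρ ↔ ∀ G' ∈ ρ.systems, G'.union G = G' := by
  cases ρ with
  | init C R =>
    obtain ⟨V, E, l, ht⟩ := C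
    simp [Rule.absorb, Rule.systems, Constraint.absorb, Label.absorb, funext_iff, Prod.ext_iff]
    exact ⟨fun h G' a b c e => e ▸ h a b c, fun h a b c => h _ a b c rfl⟩
  | reach fam R =>
    simp only [Rule.absorb, Rule.systems, Rule.reach.injEq, and_true, Set.mem_ofPred_eq,
      forall_exists_index, and_imp]
    rw [map_eq_self_iff]
    simp [Label.absorb, Prod.ext_iff]
    grind
  | _ => simp [Rule.absorb, Rule.systems]

theorem Rule.systems_absorb {ρ : Rule n} {G : ESystem n} :
    (ρ.absorb G).systems = (fun G' => G'.union G) '' ρ.systems := by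
  cases ρ with
  | init C R =>
    ext G'
    simp only [Rule.absorb, Rule.systems, Constraint.absorb, Label.absorb, Set.mem_ofPred_eq,
      Set.mem_image]
    grind
  | reach fam R =>
    ext G'
    simp only [Rule.absorb, Rule.systems, Label.absorb, List.mem_map, Set.mem_ofPred_eq,
      Set.mem_image]
    grind
  | _ => simp [Rule.absorb, Rule.systems]

/-- Explicitness makes each system in a label disjoint from the grammar of the calculus, of which it
is itself a part. -/
theorem Explicit.systems_eq_empty {A : Calculus n} (hA : Explicit A) {ρ : Rule n} (hρ : ρ ∈ A)
    {G : ESystem n} (hG : G ∈ ρ.systems) : G = ESystem.empty := by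
  have h := ESystem.sdiff_eq_self_iff.mp (Rule.fracture_eq_self_iff.mp (hA ρ hρ) G hG)
  ext1
  exact Finset.eq_empty_of_forall_notMem fun p hp =>
    h p hp (mem_grammarOf.mpr ⟨ρ, hρ, Rule.mem_grammar_of_systems hG hp⟩)

/-- All labels carry `grammarOf (hornRules A)`. As no Horn rule is left, the grammar of the new
calculus stems from the labels alone, and absorbing it changes nothing. -/
theorem implicit_absorbHorn {A : Calculus n} (hA : Explicit A) :
    Implicit (absorbHorn A (hornRules A)) := by
  have hm := fun ρ => mem_absorbHorn (A := A) (H := hornRules A) isHorn_of_mem_hornRules (ρ := ρ)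
  have hs : ∀ ρ ∈ absorbHorn A (hornRules A), ∀ G ∈ ρ.systems, G = grammarOf (hornRules A) := by
    intro ρ hρ G hG
    obtain ⟨ρ', h, _, rfl⟩ := (hm ρ).mp hρ
    rw [Rule.systems_absorb] at hG
    obtain ⟨G', hG', rfl⟩ := hG
    simp [hA.systems_eq_empty h hG']
  have hn : ∀ ρ ∈ absorbHorn A (hornRules A), ¬ ρ.IsHorn := by
    intro ρ hρ h
    have := mem_hornRules.mpr ⟨hρ, h⟩
    rw [hornRules_absorbHorn subset_rfl] at this
    simp at this
  refine ⟨hn, fun ρ hρ => Rule.absorb_eq_self_iff.mpr fun G hG => ?_⟩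
  rw [ESystem.union_eq_self_iff, hs ρ hρ G hG]
  intro p hp
  obtain ⟨ρ', h, hp⟩ := mem_grammarOf.mp hp
  obtain ⟨G', hG', hp⟩ := Rule.exists_systems_of_mem_grammar (hn _ h) hp
  rwa [hs _ h _ hG'] at hp

theorem implicit_iff_eq_top {A T : Calculus n} (hA : Explicit A) (hT : (upSpace A).IsTop T)
    {B : Calculus n} (hB : B ∈ (upSpace A).carrier) : Implicit B ↔ B = T := by
  rw [eq_of_isTop hT]
  refine ⟨fun h => ?_, fun h => h ▸ implicit_absorbHorn hA⟩
  obtain ⟨H, hH, rfl⟩ := upMem_iff.mp hB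
  have : hornRules A \ H = ∅ := by
    rw [← hornRules_absorbHorn hH.subset]
    exact Finset.eq_empty_of_forall_notMem fun ρ hρ =>
      h.1 ρ (mem_hornRules.mp hρ).1 (mem_hornRules.mp hρ).2
  rw [hH.subset.antisymm (Finset.sdiff_eq_empty_iff_subset.mp this)]

end AbsCalc

namespace AbsCalc

/-! ## Paths and derivations -/

variable {n : ℕ}

namespace GSeq

/-- The g-sequent with another set of edge atoms. -/
def withAnt (G : GSeq n) (F : Finset (Vertex × Fin n × Vertex))
    (h : ∀ e ∈ F, e.1 ∈ G.verts ∧ e.2.2 ∈ G.verts) : GSeq n where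
  ant := F
  suc := G.suc
  functional := G.functional
  src_mem := fun _ _ _ he => (h _ he).1
  tgt_mem := fun _ _ _ he => (h _ he).2

theorem mem_verts_of_mem_ant {G : GSeq n} {e : Vertex × Fin n × Vertex} (he : e ∈ G.ant) :
    e.1 ∈ G.verts ∧ e.2.2 ∈ G.verts :=
  ⟨G.src_mem _ _ _ he, G.tgt_mem _ _ _ he⟩

theorem edgeAtom_conv (w : Vertex) (x : Letter n) (u : Vertex) :
    edgeAtom u (Letter.conv x) w = edgeAtom w x u := by
  obtain ⟨a, _ | _⟩ := x <;> rfl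

theorem mem_verts_of_edgeAtom {G : GSeq n} {w u : Vertex} {x : Letter n}
    (h : edgeAtom w x u ∈ G.ant) : w ∈ G.verts ∧ u ∈ G.verts := by
  obtain ⟨a, _ | _⟩ := x
  · exact mem_verts_of_mem_ant (e := (w, a, u)) h
  · exact (mem_verts_of_mem_ant (e := (u, a, w)) h).symm

theorem Path.mem_verts {G : GSeq n} {s : Str n} {w u : Vertex} (h : G.Path s w u) :
    w ∈ G.verts ∧ u ∈ G.verts := by
  induction s generalizing w with
  | nil => obtain ⟨h, rfl⟩ := h; exact ⟨h, h⟩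
  | cons x s ih =>
    obtain ⟨v, hv, h⟩ := h
    exact ⟨(mem_verts_of_edgeAtom hv).1, (ih h).2⟩

theorem path_singleton {G : GSeq n} {x : Letter n} {w u : Vertex} :
    G.Path [x] w u ↔ edgeAtom w x u ∈ G.ant := by
  simp only [Path]
  constructor
  · rintro ⟨v, hv, _, rfl⟩; exact hv
  · exact fun h => ⟨u, h, (mem_verts_of_edgeAtom h).2, rfl⟩

theorem path_append {G : GSeq n} {s t : Str n} {w u : Vertex} :
    G.Path (s ++ t) w u ↔ ∃ v, G.Path s w v ∧ G.Path t v u := by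
  induction s generalizing w with
  | nil =>
    simp only [List.nil_append, Path]
    exact ⟨fun h => ⟨w, ⟨h.mem_verts.1, rfl⟩, h⟩, fun ⟨v, ⟨_, e⟩, h⟩ => e ▸ h⟩
  | cons x s ih =>
    simp only [List.cons_append, Path, ih]
    constructor
    · rintro ⟨v, hv, v', h, h'⟩; exact ⟨v', ⟨v, hv, h⟩, h'⟩
    · rintro ⟨v', ⟨v, hv, h⟩, h'⟩; exact ⟨v, hv, v', h, h'⟩

theorem Path.conv {G : GSeq n} {s : Str n} {w u : Vertex} (h : G.Path s w u) :
    G.Path (Str.conv s) u w := by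
  induction s generalizing w with
  | nil => obtain ⟨h, rfl⟩ := h; exact ⟨h, rfl⟩
  | cons x s ih =>
    obtain ⟨v, hv, h⟩ := h
    rw [show Str.conv (x :: s) = Str.conv s ++ [Letter.conv x] by simp [Str.conv], path_append]
    exact ⟨v, ih h, path_singleton.mpr (by rwa [edgeAtom_conv])⟩

theorem Path.mono {G G' : GSeq n} (ha : G.ant ⊆ G'.ant) (hv : G.verts ⊆ G'.verts) {s : Str n}
    {w u : Vertex} (h : G.Path s w u) : G'.Path s w u := by
  induction s generalizing w with
  | nil => exact ⟨hv h.1, h.2⟩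
  | cons x s ih =>
    obtain ⟨v, hv, h⟩ := h
    exact ⟨v, ha hv, ih h⟩

theorem LangPath.mono {G G' : GSeq n} (ha : G.ant ⊆ G'.ant) (hv : G.verts ⊆ G'.verts)
    {K : Set (Str n)} {w u : Vertex} (h : G.LangPath K w u) : G'.LangPath K w u :=
  let ⟨s, hs, h⟩ := h
  ⟨s, hs, h.mono ha hv⟩

end GSeq

namespace ESystem

abbrev Derives (G : ESystem n) : Str n → Str n → Prop := Relation.ReflTransGen G.Step

theorem Derives.context {G : ESystem n} {t t' : Str n} (h : G.Derives t t') (l r : Str n) :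
    G.Derives (l ++ t ++ r) (l ++ t' ++ r) := by
  refine Relation.ReflTransGen.lift (fun t => l ++ t ++ r) ?_ _ _ h
  rintro _ _ ⟨p, hp, l', r', rfl, rfl⟩
  exact ⟨p, hp, l ++ l', r' ++ r, by simp, by simp⟩

theorem Derives.append {G : ESystem n} {s s' t t' : Str n} (h : G.Derives s s')
    (h' : G.Derives t t') : G.Derives (s ++ t) (s' ++ t') := by
  have h₁ := h.context [] t
  have h₂ := h'.context s' []
  simp only [List.nil_append, List.append_nil] at h₁ h₂
  exact h₁.trans h₂

/-- Each step is mirrored by the converse production, which belongs to the system by closure. -/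
theorem Derives.conv {G : ESystem n} {t t' : Str n} (h : G.Derives t t') :
    G.Derives (Str.conv t) (Str.conv t') := by
  refine Relation.ReflTransGen.lift Str.conv ?_ _ _ h
  rintro _ _ ⟨p, hp, l, r, rfl, rfl⟩
  exact ⟨Production.conv p, (G.closed p).mp hp, Str.conv r, Str.conv l,
    by simp [Str.conv, Production.conv], by simp [Str.conv, Production.conv]⟩

theorem derives_singleton_of_mem {G : ESystem n} {p : Production n} (hp : p ∈ G.rules) :
    G.Derives [p.1] p.2 :=
  Relation.ReflTransGen.single ⟨p, hp, [], [], rfl, by simp⟩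

theorem eq_singleton_of_derives {G : ESystem n} {x : Letter n} (hx : ∀ p ∈ G.rules, p.1 ≠ x)
    {t : Str n} (h : G.Derives [x] t) : t = [x] := by
  induction h with
  | refl => rfl
  | tail _ hs ih =>
    obtain ⟨p, hp, l, r, h, _⟩ := hs
    subst ih
    have hm : p.1 ∈ [x] := by rw [h]; simp
    exact absurd (List.mem_singleton.mp hm) (hx p hp)

end ESystem

open ESystem

theorem langPath_of_mem_ant {X : GSeq n} {G : ESystem n} {w u : Vertex} {a : Fin n}
    (h : (w, a, u) ∈ X.ant) : X.LangPath (G.lang a) w u :=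
  ⟨[(a, false)], Relation.ReflTransGen.refl, GSeq.path_singleton.mpr h⟩

theorem langPath_iff_mem_ant {X : GSeq n} {G : ESystem n} {a : Fin n}
    (ha : ∀ p ∈ G.rules, p.1 ≠ (a, false)) {w u : Vertex} :
    X.LangPath (G.lang a) w u ↔ (w, a, u) ∈ X.ant := by
  refine ⟨fun ⟨s, hs, h⟩ => ?_, langPath_of_mem_ant⟩
  rw [eq_singleton_of_derives ha hs] at h
  exact GSeq.path_singleton.mp h

theorem langPath_empty_iff {X : GSeq n} {a : Fin n} {w u : Vertex} :
    X.LangPath (ESystem.empty.lang a) w u ↔ (w, a, u) ∈ X.ant :=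
  langPath_iff_mem_ant (by simp [ESystem.empty])

/-- The edge atoms of `X` are closed under the Horn rules that belong to `K`. -/
def GSeq.Saturated (K : ESystem n) (X : GSeq n) : Prop :=
  ∀ p ∈ K.rules, ∀ w u, X.Path p.2 w u → edgeAtom w p.1 u ∈ X.ant

/-- The derivation is undone from its last step: a subpath that reads a right-hand side is replaced
by the atom that saturation provides. -/
theorem GSeq.Saturated.path {K : ESystem n} {X : GSeq n} (hX : X.Saturated K) {t t' : Str n}
    (h : K.Derives t t') {w u : Vertex} (hp : X.Path t' w u) : X.Path t w u := by
  induction h with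
  | refl => exact hp
  | tail _ hs ih =>
    obtain ⟨p, hpK, l, r, rfl, rfl⟩ := hs
    apply ih
    rw [List.append_assoc, GSeq.path_append] at hp
    obtain ⟨v, h₁, h₂⟩ := hp
    obtain ⟨v', h₂, h₃⟩ := GSeq.path_append.mp h₂
    exact GSeq.path_append.mpr ⟨v, h₁, v', hX p hpK _ _ h₂, h₃⟩

theorem GSeq.Saturated.mem_ant {K : ESystem n} {X : GSeq n} (hX : X.Saturated K) {w u : Vertex}
    {a : Fin n} (h : X.LangPath (K.lang a) w u) : (w, a, u) ∈ X.ant := by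
  obtain ⟨s, hs, h⟩ := h
  exact GSeq.path_singleton.mp (hX.path hs h)

theorem GSeq.Saturated.congr {K : ESystem n} {X Y : GSeq n} (hX : X.Saturated K)
    (ha : Y.ant = X.ant) (hv : Y.verts = X.verts) : Y.Saturated K := fun p hp w u h =>
  ha ▸ hX p hp w u (h.mono ha.le hv.le)

/-- Every edge atom of `G` is replaced in `X` by a path that reads a string of `K(a)`. -/
def GSeq.Covers (K : ESystem n) (X G : GSeq n) : Prop :=
  ∀ w a u, (w, a, u) ∈ G.ant → X.LangPath (K.lang a) w u

/-- The edges are expanded one by one. An edge traversed backwards is replaced by the reversed path,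
whose string is derived with the converse productions. -/
theorem GSeq.Covers.path {K : ESystem n} {X G : GSeq n} (hX : X.Covers K G)
    (hv : G.verts ⊆ X.verts) {t : Str n} {w u : Vertex} (h : G.Path t w u) :
    ∃ t', K.Derives t t' ∧ X.Path t' w u := by
  induction t generalizing w with
  | nil => exact ⟨[], Relation.ReflTransGen.refl, hv h.1, h.2⟩
  | cons x s ih =>
    obtain ⟨v, hx, h⟩ := h
    obtain ⟨s', hs', h⟩ := ih h
    obtain ⟨r, hr, hr'⟩ : ∃ r, K.Derives [x] r ∧ X.Path r w v := by
      obtain ⟨a, _ | _⟩ := x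
      · exact hX _ _ _ hx
      · obtain ⟨r, hr, h⟩ := hX _ _ _ hx
        exact ⟨_, Derives.conv hr, h.conv⟩
    exact ⟨r ++ s', hr.append hs', GSeq.path_append.mpr ⟨v, hr', h⟩⟩

/-- If a letter is not a left-hand side then, by closure under converses, neither is its converse.
The language that covers such an edge contains only the edge type itself, so the atom is present in
`X`. -/
theorem GSeq.Covers.path_of_notMem {K : ESystem n} {X G : GSeq n} (hX : X.Covers K G)
    (hv : G.verts ⊆ X.verts) {t : Str n} (ht : ∀ p ∈ K.rules, p.1 ∉ t) {w u : Vertex}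
    (h : G.Path t w u) : X.Path t w u := by
  induction t generalizing w with
  | nil => exact ⟨hv h.1, h.2⟩
  | cons x s ih =>
    obtain ⟨v, hx, h⟩ := h
    refine ⟨v, ?_, ih (fun p hp hm => ht p hp (List.mem_cons_of_mem _ hm)) h⟩
    obtain ⟨a, b⟩ := x
    have ha : ∀ p ∈ K.rules, p.1 ≠ (a, false) := by
      intro p hp e
      cases b with
      | false => exact ht p hp (by simp [e])
      | true => exact ht _ ((K.closed p).mp hp) (by simp [Production.conv, Letter.conv, e])
    cases b with
    | false => exact (langPath_iff_mem_ant ha).mp (hX _ _ _ hx)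
    | true => exact (langPath_iff_mem_ant ha).mp (hX _ _ _ hx)

/-! ## Transfer of rule applications -/

theorem forall₂_imp_of_mem {α β : Type*} {r s : α → β → Prop} {l : List α} {l' : List β}
    (h : List.Forall₂ r l l') (hrs : ∀ a ∈ l, ∀ b ∈ l', r a b → s a b) : List.Forall₂ s l l' := by
  induction h with
  | nil => exact List.Forall₂.nil
  | cons hab _ ih =>
    exact List.Forall₂.cons (hrs _ (by simp) _ (by simp) hab)
      (ih fun a ha b hb => hrs a (by simp [ha]) b (by simp [hb]))

theorem forall₂_comp {α β γ : Type*} {r : α → β → Prop} {s : α → γ → Prop} {t : β → γ → Prop}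
    (hrst : ∀ a b c, r a b → s a c → t b c) {l : List α} {l' : List β} {l'' : List γ}
    (h : List.Forall₂ r l l') (h' : List.Forall₂ s l l'') : List.Forall₂ t l' l'' := by
  induction h generalizing l'' with
  | nil => cases h'; exact List.Forall₂.nil
  | cons hab _ ih =>
    cases h' with
    | cons hac h' => exact List.Forall₂.cons (hrst _ _ _ hab hac) (ih h')

/-- Read bottom-up, rules only add atoms and vertices, so whatever is known of atoms and paths in a
conclusion remains available above it. -/
theorem Rule.Infer.premise {ρ : Rule n} {Ps : List (GSeq n)} {G : GSeq n} (h : ρ.Infer Ps G) :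
    ∀ P ∈ Ps, G.ant ⊆ P.ant ∧ G.verts ⊆ P.verts := by
  intro P hP
  have hmem : ∀ {β : Type} {r : GSeq n → β → Prop} {Ss : List β},
      List.Forall₂ r Ps Ss → ∃ b, r P b := by
    intro β r Ss hf
    clear h
    induction hf with
    | nil => simp at hP
    | cons hab _ ih =>
      rcases List.mem_cons.mp hP with rfl | hP
      · exact ⟨_, hab⟩
      · exact ih hP
  cases ρ with
  | init C R => obtain ⟨rfl, _⟩ := h; simp at hP
  | loc R =>
    obtain ⟨_, w, S, Δ, Ss, hΔ, hG, hf, _⟩ := h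
    obtain ⟨S', ha, hs⟩ := hmem hf
    exact ⟨ha.ge, by simp [GSeq.verts, hG, hs]⟩
  | exp x R =>
    obtain ⟨P', w, u, S, S₁, S₂, Δ, rfl, hΔ, hG, hu, ha, hs, _⟩ := h
    obtain rfl := List.mem_singleton.mp hP
    refine ⟨by simp [ha], ?_⟩
    simp only [GSeq.verts, hG, hs, Finset.image_insert]
    exact Finset.insert_subset_insert _ (Finset.subset_insert _ _)
  | hornF a s =>
    obtain ⟨P', w, u, rfl, _, ha, hs⟩ := h
    obtain rfl := List.mem_singleton.mp hP
    exact ⟨by simp [ha], by simp [GSeq.verts, hs]⟩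
  | hornB a s =>
    obtain ⟨P', w, u, rfl, _, ha, hs⟩ := h
    obtain rfl := List.mem_singleton.mp hP
    exact ⟨by simp [ha], by simp [GSeq.verts, hs]⟩
  | reach fam R =>
    obtain ⟨_, w, u, S, S', Δ, Ss, hΔ, hG, hf, _⟩ := h
    obtain ⟨T, ha, hs⟩ := hmem hf
    exact ⟨ha.ge, by simp [GSeq.verts, hG, hs]⟩

theorem empty_absorb_lang {K : ESystem n} {L : Label n} (h : L.1 = ESystem.empty) :
    (L.absorb K).lang = K.lang L.2 := by
  simp [Label.lang, Label.absorb, h]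

theorem empty_label_lang {L : Label n} (h : L.1 = ESystem.empty) :
    L.lang = ESystem.empty.lang L.2 := by
  simp [Label.lang, h]

/-- In the saturated `Y` a path that satisfies a label of `ρ.absorb K` comes with the single atom
for which the label of `ρ` asks. The atoms added to conclusion and premises do not disturb the other
conditions of the rule. -/
theorem Rule.Infer.fracture {ρ : Rule n} {K : ESystem n} (hρ : ∀ G ∈ ρ.systems, G = ESystem.empty)
    {Ps Ps' : List (GSeq n)} {G Y : GSeq n} (h : (ρ.absorb K).Infer Ps G) (hYs : Y.suc = G.suc)
    (hYa : G.ant ⊆ Y.ant) (hY : Y.Saturated K)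
    (hPs : List.Forall₂ (fun P P' => P'.suc = P.suc ∧ P'.ant = Y.ant ∪ P.ant) Ps Ps') :
    ρ.Infer Ps' Y := by
  have hYv : Y.verts = G.verts := by simp [GSeq.verts, hYs]
  cases ρ with
  | init C R =>
    obtain ⟨rfl, θ, S, ⟨hC₁, hC₂⟩, hS, hR⟩ := h
    cases hPs
    refine ⟨rfl, θ, S, ⟨fun v hv => hYv ▸ hC₁ v hv, fun e => ?_⟩, fun v hv => hYs ▸ hS v hv,
      by rw [hYs]; exact hR⟩
    have he := hC₂ e
    have hl : (C.label e).1 = ESystem.empty := hρ _ ⟨e, rfl⟩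
    rw [empty_label_lang hl, langPath_empty_iff]
    refine hY.mem_ant (GSeq.LangPath.mono hYa hYv.ge ?_)
    rw [← empty_absorb_lang hl]
    exact he
  | loc R =>
    obtain ⟨hne, w, S, Δ, Ss, hΔ, hG, hf, hR⟩ := h
    refine ⟨fun e => hne (by subst e; cases hPs; rfl), w, S, Δ, Ss, hΔ, hYs.trans hG, ?_, hR⟩
    refine forall₂_comp (fun P P' S' h₁ h₂ => ?_) hPs hf
    exact ⟨by rw [h₁.2, h₂.1, Finset.union_eq_left.mpr hYa], h₁.1.trans h₂.2⟩
  | exp x R =>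
    obtain ⟨P, w, u, S, S₁, S₂, Δ, rfl, hΔ, hG, hu, ha, hs, hR⟩ := h
    cases hPs with
    | cons h₁ hn =>
      cases hn
      exact ⟨_, w, u, S, S₁, S₂, Δ, rfl, hΔ, hYs.trans hG, hYv ▸ hu,
        by rw [h₁.2, ha, Finset.union_insert, Finset.union_eq_left.mpr hYa], h₁.1.trans hs, hR⟩
  | hornF a s =>
    obtain ⟨P, w, u, rfl, hp, ha, hs⟩ := h
    cases hPs with
    | cons h₁ hn =>
      cases hn
      exact ⟨_, w, u, rfl, hp.mono hYa hYv.ge,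
        by rw [h₁.2, ha, Finset.union_insert, Finset.union_eq_left.mpr hYa],
        (h₁.1.trans hs).trans hYs.symm⟩
  | hornB a s =>
    obtain ⟨P, w, u, rfl, hp, ha, hs⟩ := h
    cases hPs with
    | cons h₁ hn =>
      cases hn
      exact ⟨_, w, u, rfl, hp.mono hYa hYv.ge,
        by rw [h₁.2, ha, Finset.union_insert, Finset.union_eq_left.mpr hYa],
        (h₁.1.trans hs).trans hYs.symm⟩
  | reach fam R =>
    obtain ⟨hne, w, u, S, S', Δ, Ss, hΔ, hG, hf, hL, hR⟩ := h
    have hf' : List.Forall₂ (fun P T => P.ant = Y.ant ∧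
        P.suc = insert (w, T.1) (insert (u, T.2) Δ)) Ps' Ss :=
      forall₂_comp (fun P P' T h₁ h₂ =>
        ⟨by rw [h₁.2, h₂.1, Finset.union_eq_left.mpr hYa], h₁.1.trans h₂.2⟩) hPs hf
    refine ⟨fun e => hne (by subst e; cases hPs; rfl), w, u, S, S', Δ, Ss, hΔ, hYs.trans hG, hf',
      ?_, hR⟩
    -- The paths of a reachability rule are required in the premises. These have the same atoms and
    -- vertices as `Y`, hence are saturated as well.
    have hP' : List.Forall₂ (fun P' T => P'.Saturated K) Ps' Ss := by
      refine hf'.imp fun P' T h => hY.congr h.1 ?_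
      simp [GSeq.verts, h.2, hYs, hG]
    have hL' := List.forall₂_map_right_iff.mp hL
    have hall : ∀ P' ∈ Ps', P'.Saturated K := by
      intro P' hm
      clear hL hL' hne hR hf hf' hPs
      induction hP' with
      | nil => simp at hm
      | cons h _ ih => rcases List.mem_cons.mp hm with rfl | hm; exacts [h, ih hm]
    have := forall₂_comp (t := fun P' L => P'.LangPath (K.lang (L : Label n).2) w u ∨
        (L.1 ≠ ESystem.empty)) (fun P P' L h₁ h₂ => ?_) hPs hL'
    · refine forall₂_imp_of_mem this fun P' hP' L hL h => ?_
      have hl : L.1 = ESystem.empty := hρ _ ⟨L, hL, rfl⟩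
      rw [empty_label_lang hl, langPath_empty_iff]
      exact (hall P' hP').mem_ant (h.resolve_right (not_not.mpr hl))
    · by_cases hl : L.1 = ESystem.empty
      · rw [empty_absorb_lang hl] at h₂
        exact Or.inl (h₂.mono (by rw [h₁.2]; exact Finset.subset_union_right)
          (by simp [GSeq.verts, h₁.1]))
      · exact Or.inr hl

/-- After the deletion of `R`, labels are satisfied by the paths that `hX` provides for single
atoms. For Horn rules, `hK` keeps the required path intact, and `hnew` ensures that the atom
introduced is not itself in `R`. -/
theorem Rule.Infer.absorb {ρ : Rule n} {K : ESystem n} (hρ : ¬ ρ.IsHorn → ∀ G ∈ ρ.systems, G = ESystem.empty)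
    (hK : ρ.IsHorn → ∀ p ∈ ρ.grammar.rules, ∀ p' ∈ K.rules, p'.1 ∉ p.2)
    {R : Finset (Vertex × Fin n × Vertex)} {Ps Ps' : List (GSeq n)} {G X : GSeq n}
    (h : ρ.Infer Ps G) (hR : R ⊆ G.ant) (hXs : X.suc = G.suc) (hXa : X.ant = G.ant \ R)
    (hX : X.Covers K G) (hnew : ρ.IsHorn → ∀ P ∈ Ps, ¬ P.ant ⊆ G.ant)
    (hPs : List.Forall₂ (fun P P' => P'.suc = P.suc ∧ P'.ant = P.ant \ R) Ps Ps') :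
    (ρ.absorb K).Infer Ps' X := by
  have hXv : X.verts = G.verts := by simp [GSeq.verts, hXs]
  cases ρ with
  | init C Q =>
    obtain ⟨rfl, θ, S, ⟨hC₁, hC₂⟩, hS, hQ⟩ := h
    cases hPs
    refine ⟨rfl, θ, S, ⟨fun v hv => hXv ▸ hC₁ v hv, fun e => ?_⟩, fun v hv => hXs ▸ hS v hv,
      by rw [hXs]; exact hQ⟩
    have he := hC₂ e
    have hl : (C.label e).1 = ESystem.empty := hρ id _ ⟨e, rfl⟩
    rw [empty_label_lang hl, langPath_empty_iff] at he
    show X.LangPath ((C.label e).absorb K).lang _ _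
    rw [empty_absorb_lang hl]
    exact hX _ _ _ he
  | loc Q =>
    obtain ⟨hne, w, S, Δ, Ss, hΔ, hG, hf, hQ⟩ := h
    refine ⟨fun e => hne (by subst e; cases hPs; rfl), w, S, Δ, Ss, hΔ, hXs.trans hG, ?_, hQ⟩
    refine forall₂_comp (fun P P' S' h₁ h₂ => ?_) hPs hf
    exact ⟨by rw [h₁.2, h₂.1, hXa], h₁.1.trans h₂.2⟩
  | exp x Q =>
    obtain ⟨P, w, u, S, S₁, S₂, Δ, rfl, hΔ, hG, hu, ha, hs, hQ⟩ := h
    cases hPs with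
    | cons h₁ hn =>
      cases hn
      refine ⟨_, w, u, S, S₁, S₂, Δ, rfl, hΔ, hXs.trans hG, hXv ▸ hu, ?_, h₁.1.trans hs, hQ⟩
      -- The new edge has a fresh end, whereas the atoms of `R` lie between vertices of `G`.
      rw [h₁.2, ha, hXa, Finset.insert_sdiff_of_notMem _
        fun hm => hu (GSeq.mem_verts_of_edgeAtom (hR hm)).2]
  | hornF a s =>
    obtain ⟨P, w, u, rfl, hp, ha, hs⟩ := h
    cases hPs with
    | cons h₁ hn =>
      cases hn
      refine ⟨_, w, u, rfl, hX.path_of_notMem hXv.ge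
        (hK trivial ((a, false), s) (ESystem.mem_pair.mpr (Or.inl rfl))) hp, ?_,
        (h₁.1.trans hs).trans hXs.symm⟩
      rw [h₁.2, ha, hXa, Finset.insert_sdiff_of_notMem _ fun hm => hnew trivial P (by simp) ?_]
      rw [ha]
      exact Finset.insert_subset (hR hm) subset_rfl
  | hornB a s =>
    obtain ⟨P, w, u, rfl, hp, ha, hs⟩ := h
    cases hPs with
    | cons h₁ hn =>
      cases hn
      refine ⟨_, w, u, rfl, hX.path_of_notMem hXv.ge
        (hK trivial ((a, true), s) (ESystem.mem_pair.mpr (Or.inl rfl))) hp, ?_,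
        (h₁.1.trans hs).trans hXs.symm⟩
      rw [h₁.2, ha, hXa, Finset.insert_sdiff_of_notMem _ fun hm => hnew trivial P (by simp) ?_]
      rw [ha]
      exact Finset.insert_subset (hR hm) subset_rfl
  | reach fam Q =>
    obtain ⟨hne, w, u, S, S', Δ, Ss, hΔ, hG, hf, hL, hQ⟩ := h
    have hf' : List.Forall₂ (fun P T => P.ant = X.ant ∧
        P.suc = insert (w, T.1) (insert (u, T.2) Δ)) Ps' Ss :=
      forall₂_comp (fun P P' T h₁ h₂ => ⟨by rw [h₁.2, h₂.1, hXa], h₁.1.trans h₂.2⟩) hPs hf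
    refine ⟨fun e => hne (by subst e; cases hPs; rfl), w, u, S, S', Δ, Ss, hΔ, hXs.trans hG, hf',
      List.forall₂_map_right_iff.mpr ?_, hQ⟩
    have hPP : List.Forall₂ (fun P P' => P.ant = G.ant ∧ P'.ant = X.ant ∧ P'.verts = X.verts)
        Ps Ps' := by
      have h₁ : List.Forall₂ (fun T P' => P'.ant = X.ant ∧ P'.verts = X.verts) Ss Ps' := by
        refine hf'.flip.imp fun T P' h => ⟨h.1, ?_⟩
        simp [GSeq.verts, h.2, hXs, hG]
      have h₂ : List.Forall₂ (fun T P => P.ant = G.ant) Ss Ps := hf.flip.imp fun T P h => h.1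
      exact forall₂_comp (fun T P P' h h' => ⟨h, h'⟩) h₂ h₁
    have := forall₂_comp (t := fun P' L => P'.LangPath (K.lang (L : Label n).2) w u ∨
        (L.1 ≠ ESystem.empty)) (fun P P' L h₁ h₂ => ?_) hPP hL
    · refine forall₂_imp_of_mem this fun P' hP' L hL h => ?_
      have hl : L.1 = ESystem.empty := hρ id _ ⟨L, hL, rfl⟩
      rw [empty_absorb_lang hl]
      exact h.resolve_right (not_not.mpr hl)
    · by_cases hl : L.1 = ESystem.empty
      · rw [empty_label_lang hl, langPath_empty_iff, h₁.1] at h₂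
        exact Or.inl ((hX _ _ _ h₂).mono h₁.2.1.ge h₁.2.2.ge)
      · exact Or.inr hl

end AbsCalc

namespace AbsCalc

/-! ## Codes of g-sequents and proofs -/

variable {n : ℕ}

theorem boolCode_injective : Function.Injective boolCode := by
  intro a b h
  cases a <;> cases b <;> simp_all [boolCode]

theorem natCode_injective : Function.Injective natCode := by
  intro m k h
  have h := List.map_injective_iff.mpr boolCode_injective (listCode_injective h)
  have h := congrArg (List.map fun b => cond b 1 0) h
  rw [← Nat.digits_two_eq_bits, ← Nat.digits_two_eq_bits] at h
  exact Nat.digits_inj_iff.mp h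

def atomCode (e : Vertex × Fin n × Vertex) : Data :=
  listCode [natCode e.1, natCode e.2.1, natCode e.2.2]

theorem atomCode_injective : Function.Injective (atomCode (n := n)) := by
  rintro ⟨w, a, u⟩ ⟨w', a', u'⟩ h
  simp only [atomCode, listCode_cons, Data.cons.injEq, and_true] at h
  rw [natCode_injective h.1, Fin.ext (natCode_injective h.2.1), natCode_injective h.2.2]

/-- When each element has a single code, being the code of a set is a property of the list of data,
so that set operations can be carried out and verified on data. -/
theorem setCode_iff {α : Type} {f : α → Data} (hf : Function.Injective f) {s : Set α} {d : Data} :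
    SetCode (fun x d => d = f x) s d ↔ d.toList.Nodup ∧ ∀ y, y ∈ d.toList ↔ ∃ x ∈ s, f x = y := by
  have key : ∀ (l : List α) ds, List.Forall₂ (fun x d => d = f x) l ds ↔ ds = l.map f := by
    intro l ds
    constructor
    · intro h
      induction h with
      | nil => rfl
      | cons h _ ih => simp [h, ih]
    · rintro rfl
      rw [List.forall₂_map_right_iff, List.forall₂_same]
      exact fun _ _ => rfl
  constructor
  · rintro ⟨l, ds, hl, hm, h, rfl⟩
    rw [(key _ _).mp h, toList_listCode]
    refine ⟨hl.map hf, fun y => ?_⟩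
    simp [hm]
  · rintro ⟨hn, hm⟩
    obtain ⟨l, hl⟩ : d.toList ∈ Set.range (List.map f) := by
      rw [Set.range_list_map]
      intro y hy
      obtain ⟨x, _, rfl⟩ := (hm y).mp hy
      exact ⟨x, rfl⟩
    refine ⟨l, d.toList, List.Nodup.of_map f (hl ▸ hn), fun x => ?_, (key _ _).mpr hl.symm, by simp⟩
    rw [← List.mem_map_of_injective hf, hl, hm]
    exact ⟨fun ⟨y, hy, e⟩ => hf e ▸ hy, fun h => ⟨x, h, rfl⟩⟩

/-- `d` lists the codes of the edge atoms in `F`. -/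
def AtomsCode (F : Finset (Vertex × Fin n × Vertex)) (d : Data) : Prop :=
  d.toList.Nodup ∧ ∀ y, y ∈ d.toList ↔ ∃ e ∈ F, atomCode e = y

theorem AtomsCode.mem_iff {F : Finset (Vertex × Fin n × Vertex)} {d : Data} (h : AtomsCode F d)
    {e : Vertex × Fin n × Vertex} : atomCode e ∈ d.toList ↔ e ∈ F := by
  rw [h.2]
  exact ⟨fun ⟨e', he', h⟩ => atomCode_injective h ▸ he', fun h => ⟨e, h, rfl⟩⟩

def SucCode (F : Finset (Vertex × Sequent)) (d : Data) : Prop :=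
  SetCode (fun q d => d = Data.cons (natCode q.1) (natCode q.2)) (F : Set (Vertex × Sequent)) d

theorem gSeq_code_iff {G : GSeq n} {d : Data} :
    G.Code d ↔ ∃ g s, AtomsCode G.ant g ∧ SucCode G.suc s ∧ d = Data.cons g s := by
  have : ∀ g, AtomsCode G.ant g ↔ SetCode (fun e d => d = atomCode e)
      (G.ant : Set (Vertex × Fin n × Vertex)) g := fun g => by
    rw [setCode_iff atomCode_injective]; rfl
  simp only [this]
  rfl

theorem SucCode.mem_verts {G : GSeq n} {d : Data} (h : SucCode G.suc d) {y : Data} :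
    y ∈ d.toList.map Data.hd ↔ ∃ w ∈ G.verts, natCode w = y := by
  have hinj : Function.Injective fun q : Vertex × Sequent =>
      Data.cons (natCode q.1) (natCode q.2) := by
    rintro ⟨a, b⟩ ⟨a', b'⟩ h
    simp only [Data.cons.injEq] at h
    rw [natCode_injective h.1, natCode_injective h.2]
  have := ((setCode_iff hinj).mp h).2
  simp only [List.mem_map, this, GSeq.verts, Finset.mem_image]
  constructor
  · rintro ⟨_, ⟨q, hq, rfl⟩, rfl⟩
    exact ⟨q.1, ⟨q, hq, rfl⟩, rfl⟩
  · rintro ⟨_, ⟨q, hq, rfl⟩, rfl⟩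
    exact ⟨_, ⟨q, hq, rfl⟩, rfl⟩

/-! ### Sets of edge atoms as lists of data -/

section Sets

open Classical

noncomputable def dunion (a b : Data) : Data := listCode (a.toList ∪ b.toList)

noncomputable def dsdiff (a b : Data) : Data := listCode (a.toList.filter fun x => x ∉ b.toList)

@[fun_prop]
theorem Poly.dunion {f g : Data → Data} (hf : Poly f) (hg : Poly g) :
    Poly fun d => dunion (f d) (g d) := hf.union hg

@[fun_prop]
theorem Poly.dsdiff {f g : Data → Data} (hf : Poly f) (hg : Poly g) :
    Poly fun d => dsdiff (f d) (g d) :=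
  Poly.filter (P := fun d x => x ∉ (g d).toList) hf
    (PolyP.mem (f := fun e => e.tl) (l := fun e => g e.hd) (by fun_prop) (by fun_prop)).not

theorem size_dunion_le (a b : Data) : (dunion a b).size ≤ a.size + b.size := by
  have : ∀ L : List Data, (listCode (L ∪ b.toList)).size ≤ (listCode L).size + b.size := by
    intro L
    induction L with
    | nil => simp
    | cons x L ih =>
      rw [List.cons_union]
      by_cases h : x ∈ L ∪ b.toList
      · rw [List.insert_of_mem h]
        simp only [listCode_cons, Data.size]
        omega
      · rw [List.insert_of_not_mem h]
        simp only [listCode_cons, Data.size]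
        omega
  simpa [dunion] using this a.toList

theorem size_listCode_filter_le (p : Data → Bool) (L : List Data) :
    (listCode (L.filter p)).size ≤ (listCode L).size := by
  induction L with
  | nil => simp
  | cons x L ih =>
    by_cases h : p x
    · simp only [List.filter_cons, h, if_true, listCode_cons, Data.size]
      omega
    · simp only [List.filter_cons, h, listCode_cons, Data.size]
      simp
      omega

theorem size_dsdiff_le (a b : Data) : (dsdiff a b).size ≤ a.size := by
  simpa [dsdiff] using size_listCode_filter_le (fun x => decide (x ∉ b.toList)) a.toList

theorem AtomsCode.dunion {F F' : Finset (Vertex × Fin n × Vertex)} {d d' : Data}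
    (h : AtomsCode F d) (h' : AtomsCode F' d') : AtomsCode (F ∪ F') (dunion d d') := by
  refine ⟨by rw [AbsCalc.dunion, toList_listCode]; exact List.Nodup.union _ h'.1, fun y => ?_⟩
  rw [AbsCalc.dunion, toList_listCode, List.mem_union_iff, h.2, h'.2]
  simp only [Finset.mem_union, or_and_right, exists_or]

theorem AtomsCode.dsdiff {F F' : Finset (Vertex × Fin n × Vertex)} {d d' : Data}
    (h : AtomsCode F d) (h' : AtomsCode F' d') : AtomsCode (F \ F') (dsdiff d d') := by
  refine ⟨by rw [AbsCalc.dsdiff, toList_listCode]; exact h.1.filter _, fun y => ?_⟩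
  rw [AbsCalc.dsdiff, toList_listCode, List.mem_filter, h.2]
  simp only [decide_eq_true_eq, Finset.mem_sdiff]
  constructor
  · rintro ⟨⟨e, he, rfl⟩, hn⟩
    exact ⟨e, ⟨he, fun hm => hn (h'.mem_iff.mpr hm)⟩, rfl⟩
  · rintro ⟨e, ⟨he, hn⟩, rfl⟩
    exact ⟨⟨e, he, rfl⟩, fun hm => hn (h'.mem_iff.mp hm)⟩

end Sets

theorem atomsCode_nil : AtomsCode (∅ : Finset (Vertex × Fin n × Vertex)) Data.nil := by
  simp [AtomsCode]

/-! ### Tables -/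

open Classical in
noncomputable def lookup (tbl : List (Data × Data)) (x : Data) : Data :=
  tbl.foldr (fun p r => if x = p.1 then p.2 else r) Data.nil

theorem Poly.lookup (tbl : List (Data × Data)) {f : Data → Data} (hf : Poly f) :
    Poly fun d => lookup tbl (f d) := by
  induction tbl with
  | nil => exact Poly.const _
  | cons p tbl ih => exact PolyP.ite (PolyP.eq hf (Poly.const _)) (Poly.const _) ih

/-- The positions in `l` of the rules in `H`. -/
noncomputable def positions (l : List (Rule n)) (H : Finset (Rule n)) : List (Data × Rule n) :=
  (l.zipIdx.filter fun q => q.1 ∈ H).map fun q => (natCode q.2, q.1)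

theorem mem_positions {l : List (Rule n)} {H : Finset (Rule n)} {j : Data} {h : Rule n} :
    (j, h) ∈ positions l H ↔ ∃ i, j = natCode i ∧ l[i]? = some h ∧ h ∈ H := by
  simp only [positions, List.mem_map, List.mem_filter, Prod.exists, Prod.mk.injEq,
    List.mk_mem_zipIdx_iff_getElem?, decide_eq_true_eq]
  constructor
  · rintro ⟨ρ, i, ⟨h₁, h₂⟩, rfl, rfl⟩; exact ⟨i, rfl, h₁, h₂⟩
  · rintro ⟨i, rfl, h₁, h₂⟩; exact ⟨h, i, ⟨h₁, h₂⟩, rfl, rfl⟩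

/-- The codes of the positions in `l` of the rules in `H`. -/
noncomputable def posCodes (l : List (Rule n)) (H : Finset (Rule n)) : Data :=
  listCode ((positions l H).map Prod.fst)

theorem mem_posCodes {l : List (Rule n)} {H : Finset (Rule n)} {i : ℕ} {ρ : Rule n}
    (hi : l[i]? = some ρ) : natCode i ∈ (posCodes l H).toList ↔ ρ ∈ H := by
  simp only [posCodes, toList_listCode, List.mem_map, Prod.exists, mem_positions]
  constructor
  · rintro ⟨_, ρ', ⟨j, rfl, hj, hH⟩, e⟩
    rw [natCode_injective e, hi] at hj
    rwa [Option.some.inj hj]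
  · exact fun h => ⟨_, ρ, ⟨i, rfl, hi, h⟩, rfl⟩

/-- The table that translates positions in `l` to positions in `l'`. -/
noncomputable def posTable (l l' : List (Rule n)) (F : Rule n → Rule n) : List (Data × Data) :=
  l.zipIdx.map fun q => (natCode q.2, natCode (l'.idxOf (F q.1)))

theorem lookup_posTable {l l' : List (Rule n)} {F : Rule n → Rule n} {i : ℕ} {ρ : Rule n}
    (hi : l[i]? = some ρ) : lookup (posTable l l' F) (natCode i) = natCode (l'.idxOf (F ρ)) := by
  have key : ∀ L : List (Rule n × ℕ), (∀ q ∈ L, l[q.2]? = some q.1) → (ρ, i) ∈ L →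
      lookup (L.map fun q => (natCode q.2, natCode (l'.idxOf (F q.1)))) (natCode i) =
        natCode (l'.idxOf (F ρ)) := by
    intro L hL hm
    induction L with
    | nil => simp at hm
    | cons q L ih =>
      simp only [lookup, List.map_cons, List.foldr_cons]
      split_ifs with h
      · have := hL q (by simp)
        rw [← natCode_injective h, hi] at this
        rw [Option.some.inj this]
      · rcases List.mem_cons.mp hm with rfl | hm
        · exact (h rfl).elim
        · exact ih (fun q hq => hL q (by simp [hq])) hm
  exact key _ (fun q hq => List.mk_mem_zipIdx_iff_getElem?.mp hq)
    (List.mk_mem_zipIdx_iff_getElem?.mpr hi)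

/-! ### Nodes of proof codes -/

def nodeAnt (d : Data) : Data := d.tl.hd.hd

def nodeSuc (d : Data) : Data := d.tl.hd.tl

def mkNode (i g s kids : Data) : Data := Data.cons i (Data.cons (Data.cons g s) kids)

@[fun_prop]
theorem Poly.nodeAnt {f : Data → Data} (hf : Poly f) : Poly fun d => nodeAnt (f d) := by
  unfold AbsCalc.nodeAnt; fun_prop

@[fun_prop]
theorem Poly.nodeSuc {f : Data → Data} (hf : Poly f) : Poly fun d => nodeSuc (f d) := by
  unfold AbsCalc.nodeSuc; fun_prop

@[fun_prop]
theorem Poly.mkNode {f g h k : Data → Data} (hf : Poly f) (hg : Poly g) (hh : Poly h)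
    (hk : Poly k) : Poly fun d => mkNode (f d) (g d) (h d) (k d) := by
  unfold AbsCalc.mkNode; fun_prop

theorem size_nodeAnt_le (d : Data) : (nodeAnt d).size ≤ d.size :=
  (Data.size_hd_le _).trans ((Data.size_hd_le _).trans (Data.size_tl_le _))

theorem size_nodeSuc_le (d : Data) : (nodeSuc d).size ≤ d.size :=
  (Data.size_tl_le _).trans ((Data.size_hd_le _).trans (Data.size_tl_le _))

theorem proofCode_node_iff {l : List (Rule n)} {ρ : Rule n} {G : GSeq n}
    {subs : List (ProofTree n)} {d : Data} :
    ProofCode l (ProofTree.node ρ G subs) d ↔ ∃ i g s ds, l[i]? = some ρ ∧ AtomsCode G.ant g ∧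
      SucCode G.suc s ∧ List.Forall₂ (ProofCode l) subs ds ∧
      d = mkNode (natCode i) g s (listCode ds) := by
  constructor
  · intro h
    cases h with
    | node hi hg hlen hsub =>
      obtain ⟨g, s, h₁, h₂, rfl⟩ := gSeq_code_iff.mp hg
      exact ⟨_, g, s, _, hi, h₁, h₂, List.forall₂_iff_zip.mpr ⟨hlen, fun h => hsub _ h⟩, rfl⟩
  · rintro ⟨i, g, s, ds, hi, h₁, h₂, hf, rfl⟩
    obtain ⟨hlen, h⟩ := List.forall₂_iff_zip.mp hf
    exact ProofCode.node hi (gSeq_code_iff.mpr ⟨g, s, h₁, h₂, rfl⟩) hlen fun q hq => h hq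

theorem exists_subproofs {B : Calculus n} {l : List (Rule n)} {rel : GSeq n → GSeq n → Prop}
    {F : Data → Data} {subs : List (ProofTree n)} {ds : List Data}
    (h : List.Forall₂ (fun t d => ∃ t', IsProof B t' ∧ rel t.concl t'.concl ∧
      ProofCode l t' (F d)) subs ds) :
    ∃ subs', (∀ t' ∈ subs', IsProof B t') ∧
      List.Forall₂ rel (subs.map ProofTree.concl) (subs'.map ProofTree.concl) ∧
      List.Forall₂ (ProofCode l) subs' (ds.map F) := by
  induction h with
  | nil => exact ⟨[], by simp, List.Forall₂.nil, List.Forall₂.nil⟩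
  | cons h _ ih =>
    obtain ⟨t', h₁, h₂, h₃⟩ := h
    obtain ⟨subs', k₁, k₂, k₃⟩ := ih
    exact ⟨t' :: subs', by simpa using ⟨h₁, k₁⟩, List.Forall₂.cons h₂ k₂, List.Forall₂.cons h₃ k₃⟩

/-! ## Elimination of Horn rules from proofs -/

section Absorb

open Classical

/-- The accumulator lists the atoms that are to be deleted. -/
noncomputable def absorbDown (hidx : Data) (r d : Data) : Data :=
  if d.hd ∈ hidx.toList then dunion r (dsdiff (nodeAnt d.tl.tl.hd) (nodeAnt d)) else r

/-- A node is skipped if its rule is absorbed, and also if it is an application of another Horn rule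
that introduces an atom already present. Such an atom may be among the deleted ones; premise and
conclusion then become equal without being linked by the rule. -/
noncomputable def absorbUp (hidx hornIdx : Data) (tbl : List (Data × Data)) (r d res : Data) :
    Data :=
  if d.hd ∈ hidx.toList ∨ (d.hd ∈ hornIdx.toList ∧
    ∀ x ∈ (nodeAnt d.tl.tl.hd).toList, x ∈ (nodeAnt d).toList) then res.hd
  else mkNode (lookup tbl d.hd) (dsdiff (nodeAnt d) r) (nodeSuc d) res

theorem poly_absorbTree (hidx hornIdx : Data) (tbl : List (Data × Data)) :
    Poly fun d => treeRec (absorbDown hidx) (absorbUp hidx hornIdx tbl) Data.nil d := by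
  have hlook : Poly fun d => lookup tbl d.hd := Poly.lookup tbl (by fun_prop)
  obtain ⟨p, hp⟩ := hlook.size_le
  refine poly_treeRec (p := Polynomial.X) (q := p + 3 * Polynomial.X + 4) ?_ ?_ (fun a d => ?_)
    (fun a d r => ?_) (Poly.const _) Poly.id
  · unfold absorbDown
    exact PolyP.ite (PolyP.mem (by fun_prop) (by fun_prop)) (by fun_prop) (by fun_prop)
  · unfold absorbUp
    refine PolyP.ite (PolyP.or (PolyP.mem (by fun_prop) (by fun_prop)) (PolyP.and
      (PolyP.mem (by fun_prop) (by fun_prop)) (PolyP.forall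
        (P := fun e x => x ∈ (nodeAnt e.tl.hd).toList) (by fun_prop)
        (PolyP.mem (by fun_prop) (by fun_prop))))) (by fun_prop) ?_
    exact Poly.mkNode (Poly.lookup tbl (by fun_prop)) (by fun_prop) (by fun_prop) (by fun_prop)
  · simp only [Polynomial.eval_X]
    unfold absorbDown
    have h₁ := size_dunion_le a (dsdiff (nodeAnt d.tl.tl.hd) (nodeAnt d))
    have h₂ := size_dsdiff_le (nodeAnt d.tl.tl.hd) (nodeAnt d)
    have h₃ := size_nodeAnt_le d.tl.tl.hd
    have h₄ := (Data.size_hd_le d.tl.tl).trans ((Data.size_tl_le d.tl).trans (Data.size_tl_le d))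
    split_ifs <;> omega
  · unfold absorbUp
    have h₁ := Data.size_hd_le r
    have h₂ := (hp d).trans (Polynomial.eval_nat_mono p (Nat.le_add_left d.size a.size))
    have h₃ := size_dsdiff_le (nodeAnt d) a
    have h₄ := size_nodeAnt_le d
    have h₅ := size_nodeSuc_le d
    dsimp only at h₂
    simp only [Polynomial.eval_add, Polynomial.eval_mul, Polynomial.eval_X, Polynomial.eval_ofNat]
    split_ifs
    · omega
    · simp only [mkNode, Data.size]
      omega

end Absorb

/-- The path that licenses the new atom expands to a path in `X`. Its string is derived from the
type of the atom by the production of `h`, followed by the derivation of the expansion. -/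
theorem Rule.Infer.covers_of_horn {H : Finset (Rule n)} {h : Rule n} (hh : h ∈ H)
    (hH : ∀ h ∈ H, h.IsHorn) {Ps : List (GSeq n)} {G X : GSeq n} (hi : h.Infer Ps G)
    (hX : X.Covers (grammarOf H) G) (hv : G.verts ⊆ X.verts) :
    ∃ P, Ps = [P] ∧ P.suc = G.suc ∧ X.Covers (grammarOf H) P := by
  have hmem : ∀ p ∈ h.grammar.rules, p ∈ (grammarOf H).rules := fun p hp =>
    mem_grammarOf.mpr ⟨h, hh, hp⟩
  have key : ∀ (x : Letter n) (s : Str n) (w u : Vertex), (x, s) ∈ (grammarOf H).rules →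
      G.Path s w u → ∃ r, (grammarOf H).Derives [x] r ∧ X.Path r w u := by
    intro x s w u hxs hp
    obtain ⟨t, ht, hp⟩ := hX.path hv hp
    exact ⟨t, (ESystem.derives_singleton_of_mem hxs).trans ht, hp⟩
  have := hH h hh
  cases h with
  | hornF a s =>
    obtain ⟨P, w, u, rfl, hp, ha, hs⟩ := hi
    refine ⟨P, rfl, hs, fun w' a' u' hm => ?_⟩
    rw [ha, Finset.mem_insert] at hm
    rcases hm with hm | hm
    · simp only [Prod.mk.injEq] at hm
      obtain ⟨rfl, rfl, rfl⟩ := hm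
      exact key _ s _ _ (hmem _ (ESystem.mem_pair.mpr (Or.inl rfl))) hp
    · exact hX _ _ _ hm
  | hornB a s =>
    obtain ⟨P, w, u, rfl, hp, ha, hs⟩ := hi
    refine ⟨P, rfl, hs, fun w' a' u' hm => ?_⟩
    rw [ha, Finset.mem_insert] at hm
    rcases hm with hm | hm
    · simp only [Prod.mk.injEq] at hm
      obtain ⟨rfl, rfl, rfl⟩ := hm
      obtain ⟨r, hr, hp⟩ := key _ s _ _ (hmem _ (ESystem.mem_pair.mpr (Or.inl rfl))) hp
      exact ⟨_, ESystem.Derives.conv hr, hp.conv⟩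
    · exact hX _ _ _ hm
  | _ => exact this.elim

/-! ### Correctness of the elimination of Horn rules -/

section AbsorbCorrect

variable {A : Calculus n} {H : Finset (Rule n)} {l l' : List (Rule n)}

/-- Induction on the proof, for all sets `R` of deleted atoms; the invariant is that what remains
covers the original conclusion. -/
theorem absorbTree_correct (hA : Explicit A) (hH : AntiFracturable (hornRules A) H)
    (hl' : Lists l' (absorbHorn A H)) {t : ProofTree n} (ht : IsProof A t) :
    ∀ d, ProofCode l t d → ∀ (R : Finset (Vertex × Fin n × Vertex)) (r : Data) (X : GSeq n),
      AtomsCode R r → R ⊆ t.concl.ant → X.suc = t.concl.suc → X.ant = t.concl.ant \ R →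
      X.Covers (grammarOf H) t.concl →
      ∃ t', IsProof (absorbHorn A H) t' ∧ t'.concl = X ∧ ProofCode l' t'
        (treeRec (absorbDown (posCodes l H)) (absorbUp (posCodes l H) (posCodes l (hornRules A))
          (posTable l l' (Rule.absorb (grammarOf H)))) r d) := by
  classical
  have hHorn : ∀ h ∈ H, h.IsHorn := fun h hh => (mem_hornRules.mp (hH.subset hh)).2
  have hconf := ((antiFracturable_iff isHorn_of_mem_hornRules).mp hH).2
  induction ht with
  | @node ρ G subs hρ hinf hsubs ih =>
    intro d hd R r X hr hRG hXs hXa hX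
    obtain ⟨i, g, s, ds, hi, hg, hs, hf, rfl⟩ := proofCode_node_iff.mp hd
    simp only [ProofTree.concl] at hRG hXs hXa hX
    have hXv : G.verts = X.verts := by simp [GSeq.verts, hXs]
    rw [treeRec_eq]
    have hkids : (mkNode (natCode i) g s (listCode ds)).tl.tl.toList = ds := by
      simp [mkNode, Data.tl]
    have hhd : (mkNode (natCode i) g s (listCode ds)).hd = natCode i := rfl
    have hant : nodeAnt (mkNode (natCode i) g s (listCode ds)) = g := rfl
    have hsuc : nodeSuc (mkNode (natCode i) g s (listCode ds)) = s := rfl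
    rw [hkids]
    have hprem := hinf.premise
    have hcode : ∀ t d, ProofCode l t d → AtomsCode t.concl.ant (nodeAnt d) := by
      rintro ⟨ρ', G', subs'⟩ d hd
      obtain ⟨i, g, s, ds, _, hg, _, _, rfl⟩ := proofCode_node_iff.mp hd
      exact hg
    by_cases hρH : ρ ∈ H
    · obtain ⟨P, hPs, hPs', hP⟩ := hinf.covers_of_horn hρH hHorn hX hXv.le
      obtain ⟨t₁, rfl, rfl⟩ : ∃ t₁, subs = [t₁] ∧ t₁.concl = P := by
        obtain ⟨t₁, h₁, h₂⟩ := List.map_eq_singleton_iff.mp hPs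
        exact ⟨t₁, h₁, h₂⟩
      obtain ⟨d₁, rfl⟩ : ∃ d₁, ds = [d₁] := by
        have := hf.length_eq
        exact List.length_eq_one_iff.mp (by simpa using this.symm)
      have hd₁ : ProofCode l t₁ d₁ := by simpa using hf
      have hkid : (mkNode (natCode i) g s (listCode [d₁])).tl.tl.hd = d₁ := rfl
      have hsub := (hprem t₁.concl (by simp)).1
      -- Only an atom that is missing from the conclusion joins the deleted ones, so the premise
      -- reduces to the same `X` and its translated proof can be used as it is.
      obtain ⟨t', h₁, h₂, h₃⟩ := ih t₁ (by simp) d₁ hd₁ (R ∪ (t₁.concl.ant \ G.ant))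
        (dunion r (dsdiff (nodeAnt d₁) g)) X (hr.dunion ((hcode _ _ hd₁).dsdiff hg))
        (Finset.union_subset (hRG.trans hsub) Finset.sdiff_subset) (hXs.trans hPs'.symm)
        (by rw [hXa]; ext e; have := @hsub e; simp only [Finset.mem_sdiff, Finset.mem_union]; tauto)
        hP
      refine ⟨t', h₁, h₂, ?_⟩
      have hm := (mem_posCodes (H := H) hi).mpr hρH
      rw [absorbUp, if_pos (Or.inl (by rw [hhd]; exact hm)), absorbDown, if_pos (by rw [hhd]; exact hm),
        hkid, hant]
      exact h₃
    have hdown : absorbDown (posCodes l H) r (mkNode (natCode i) g s (listCode ds)) = r := by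
      rw [absorbDown, if_neg]
      rw [hhd, mem_posCodes hi]
      exact hρH
    -- An atom of a premise either occurs in the conclusion, where it is covered, or it is new and
    -- therefore not deleted.
    have hcov : ∀ P ∈ subs.map ProofTree.concl, ∀ X' : GSeq n, X'.suc = P.suc →
        X'.ant = P.ant \ R → X'.Covers (grammarOf H) P := by
      intro P hP X' hs' ha' w a u hm
      by_cases hG : (w, a, u) ∈ G.ant
      · refine (hX _ _ _ hG).mono ?_ ?_
        · rw [hXa, ha']
          exact Finset.sdiff_subset_sdiff (hprem P hP).1 subset_rfl
        · rw [← hXv]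
          exact (hprem P hP).2.trans (by simp [GSeq.verts, hs'])
      · refine langPath_of_mem_ant ?_
        rw [ha', Finset.mem_sdiff]
        exact ⟨hm, fun h => hG (hRG h)⟩
    rw [hdown]
    -- Here premise and conclusion of a Horn rule agree, so the translated proof of the premise
    -- already proves `X`.
    by_cases hskip : ρ.IsHorn ∧ ∀ P ∈ subs.map ProofTree.concl, P.ant ⊆ G.ant
    · obtain ⟨P, hPs, hPs'⟩ : ∃ P, subs.map ProofTree.concl = [P] ∧ P.suc = G.suc := by
        have := hskip.1
        cases ρ with
        | hornF a s => obtain ⟨P, _, _, h₁, _, _, h₂⟩ := hinf; exact ⟨P, h₁, h₂⟩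
        | hornB a s => obtain ⟨P, _, _, h₁, _, _, h₂⟩ := hinf; exact ⟨P, h₁, h₂⟩
        | _ => exact this.elim
      obtain ⟨t₁, rfl, rfl⟩ := List.map_eq_singleton_iff.mp hPs
      obtain ⟨d₁, rfl⟩ : ∃ d₁, ds = [d₁] :=
        List.length_eq_one_iff.mp (by simpa using hf.length_eq.symm)
      have hd₁ : ProofCode l t₁ d₁ := by simpa using hf
      have hkid : (mkNode (natCode i) g s (listCode [d₁])).tl.tl.hd = d₁ := rfl
      have hPG : t₁.concl.ant = G.ant :=
        (hskip.2 _ (by simp)).antisymm (hprem t₁.concl (by simp)).1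
      obtain ⟨t', h₁, h₂, h₃⟩ := ih t₁ (by simp) d₁ hd₁ R r X hr (hPG ▸ hRG) (hXs.trans hPs'.symm)
        (hPG ▸ hXa) (hcov _ (by simp) X (hXs.trans hPs'.symm) (hPG ▸ hXa))
      refine ⟨t', h₁, h₂, ?_⟩
      rw [absorbUp, if_pos]
      · exact h₃
      · refine Or.inr ⟨?_, ?_⟩
        · rw [hhd, mem_posCodes hi, mem_hornRules]
          exact ⟨hρ, hskip.1⟩
        · rw [hkid, hant]
          intro x hx
          obtain ⟨e, he, rfl⟩ := ((hcode _ _ hd₁).2 x).mp hx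
          exact hg.mem_iff.mpr (hPG ▸ he)
    · have hnew : ρ.IsHorn → ∀ P ∈ subs.map ProofTree.concl, ¬ P.ant ⊆ G.ant := by
        intro hh P hP hPG
        refine hskip ⟨hh, fun P' hP' => ?_⟩
        have : ∃ P, subs.map ProofTree.concl = [P] := by
          cases ρ with
          | hornF a s => obtain ⟨P, _, _, h₁, _⟩ := hinf; exact ⟨P, h₁⟩
          | hornB a s => obtain ⟨P, _, _, h₁, _⟩ := hinf; exact ⟨P, h₁⟩
          | _ => exact hh.elim
        obtain ⟨Q, hQ⟩ := this
        rw [hQ, List.mem_singleton] at hP hP'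
        rwa [hP', ← hP]
      rw [absorbUp, if_neg]
      · obtain ⟨subs', k₁, k₂, k₃⟩ := exists_subproofs (B := absorbHorn A H) (l := l')
          (rel := fun P P' => P'.suc = P.suc ∧ P'.ant = P.ant \ R)
          (F := treeRec (absorbDown (posCodes l H)) (absorbUp (posCodes l H)
            (posCodes l (hornRules A)) (posTable l l' (Rule.absorb (grammarOf H)))) r)
          (forall₂_imp_of_mem hf fun t ht d _ htd => by
            have hPm : t.concl ∈ subs.map ProofTree.concl := List.mem_map_of_mem ht
            obtain ⟨t', h₁, h₂, h₃⟩ := ih t ht d htd R r (t.concl.withAnt (t.concl.ant \ R)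
              fun e he => GSeq.mem_verts_of_mem_ant (Finset.mem_sdiff.mp he).1) hr
              (hRG.trans (hprem _ hPm).1) rfl rfl (hcov _ hPm _ rfl rfl)
            exact ⟨t', h₁, by rw [h₂]; exact ⟨rfl, rfl⟩, h₃⟩)
        refine ⟨ProofTree.node (ρ.absorb (grammarOf H)) X subs', IsProof.node
          ((mem_absorbHorn hHorn).mpr ⟨ρ, hρ, hρH, rfl⟩) ?_ k₁, rfl, proofCode_node_iff.mpr
          ⟨l'.idxOf (ρ.absorb (grammarOf H)), dsdiff g r, s, _, ?_, ?_, ?_, k₃, ?_⟩⟩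
        · refine hinf.absorb (fun _ G' hG' => hA.systems_eq_empty hρ hG') ?_ hRG hXs hXa hX hnew k₂
          -- A left-hand side from `H` in the path of `ρ` would put `ρ`, which is not in `H`,
          -- immediately below a rule of `H`.
          intro hh p hp p' hp' hm
          obtain ⟨h', hh', hp'⟩ := mem_grammarOf.mp hp'
          exact hconf ρ (mem_hornRules.mpr ⟨hρ, hh⟩) hρH h' hh' (Or.inr ⟨p, hp, p', hp', hm⟩)
        · exact List.getElem?_idxOf ((hl'.2 _).mpr ((mem_absorbHorn hHorn).mpr ⟨ρ, hρ, hρH, rfl⟩))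
        · rw [hXa]
          exact hg.dsdiff hr
        · rw [hXs]
          exact hs
        · rw [hhd, hant, hsuc, lookup_posTable hi]
      · rw [hhd, mem_posCodes hi, mem_posCodes hi, mem_hornRules]
        rintro (h | ⟨⟨_, hh⟩, hall⟩)
        · exact hρH h
        · refine hskip ⟨hh, ?_⟩
          rw [List.forall_mem_map]
          intro t ht e he
          obtain ⟨t₁, rfl⟩ : ∃ t₁, subs = [t₁] := by
            cases ρ with
            | hornF a s =>
              obtain ⟨P, _, _, h₁, _⟩ := hinf
              obtain ⟨t₁, h, _⟩ := List.map_eq_singleton_iff.mp h₁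
              exact ⟨t₁, h⟩
            | hornB a s =>
              obtain ⟨P, _, _, h₁, _⟩ := hinf
              obtain ⟨t₁, h, _⟩ := List.map_eq_singleton_iff.mp h₁
              exact ⟨t₁, h⟩
            | _ => exact hh.elim
          obtain ⟨d₁, rfl⟩ : ∃ d₁, ds = [d₁] :=
            List.length_eq_one_iff.mp (by simpa using hf.length_eq.symm)
          have hd₁ : ProofCode l t₁ d₁ := by simpa using hf
          obtain rfl := List.mem_singleton.mp ht
          have := hall (atomCode e) ((hcode _ _ hd₁).mem_iff.mpr he)
          rw [hant] at this
          exact hg.mem_iff.mp this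

end AbsorbCorrect

end AbsCalc

namespace AbsCalc

/-! ## Introduction of Horn rules into proofs -/

variable {n : ℕ}

@[simp]
theorem Data.hd_cons (l r : Data) : (Data.cons l r).hd = l := rfl

@[simp]
theorem Data.tl_cons (l r : Data) : (Data.cons l r).tl = r := rfl

theorem size_foldl_le {s : Data → Data → Data} (I : Data → Prop) {C : ℕ} {L : List Data} {a : Data}
    (ha : I a) (h : ∀ a, ∀ x ∈ L, I a → I (s a x) ∧ (s a x).size ≤ a.size + C) :
    (L.foldl s a).size ≤ a.size + L.length * C := by
  induction L generalizing a with
  | nil => simp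
  | cons x L ih =>
    obtain ⟨h₁, h₂⟩ := h a x (by simp) ha
    have h₃ := ih h₁ fun a y hy => h a y (by simp [hy])
    rw [List.foldl_cons, List.length_cons, Nat.succ_mul]
    omega

/-- In the list `Γ` of edge atoms there is a path from `w` to `u` that reads the string. -/
def CodePath (Γ : Data) : Str n → Data → Data → Prop
  | [], w, u => w = u
  | x :: s, w, u => ∃ e ∈ Γ.toList, e.tl.hd = natCode x.1 ∧
      if x.2 then e.tl.tl.hd = w ∧ CodePath Γ s e.hd u else e.hd = w ∧ CodePath Γ s e.tl.tl.hd u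

/-- The string belongs to the calculus and not to the input, so the recursion on it nests a constant
number of searches through the list of atoms. -/
theorem PolyP.codePath (s : Str n) {Γ w u : Data → Data} (hΓ : Poly Γ) (hw : Poly w)
    (hu : Poly u) : PolyP fun d => CodePath (Γ d) s (w d) (u d) := by
  induction s generalizing Γ w u with
  | nil => exact PolyP.eq hw hu
  | cons x s ih =>
    obtain ⟨a, b⟩ := x
    refine PolyP.exists (P := fun d e => e.tl.hd = natCode a ∧ if b then e.tl.tl.hd = w d ∧
      CodePath (Γ d) s e.hd (u d) else e.hd = w d ∧ CodePath (Γ d) s e.tl.tl.hd (u d)) hΓ ?_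
    refine PolyP.and (PolyP.eq (by fun_prop) (by fun_prop)) ?_
    cases b with
    | false =>
      simp only [Bool.false_eq_true, if_false]
      exact PolyP.and (PolyP.eq (by fun_prop) (by fun_prop))
        (ih (by fun_prop) (by fun_prop) (by fun_prop))
    | true =>
      simp only [if_true]
      exact PolyP.and (PolyP.eq (by fun_prop) (by fun_prop))
        (ih (by fun_prop) (by fun_prop) (by fun_prop))

theorem codePath_iff {G : GSeq n} {Γ : Data} (hΓ : AtomsCode G.ant Γ) {s : Str n} {w u : Vertex}
    (hw : w ∈ G.verts) : CodePath Γ s (natCode w) (natCode u) ↔ G.Path s w u := by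
  induction s generalizing w with
  | nil => simp [CodePath, GSeq.Path, hw, natCode_injective.eq_iff]
  | cons x s ih =>
    obtain ⟨a, b⟩ := x
    simp only [CodePath, GSeq.Path, hΓ.2]
    constructor
    · rintro ⟨_, ⟨⟨v, a', v'⟩, he, rfl⟩, ha, h⟩
      have ha' : a' = a := Fin.ext (natCode_injective ha)
      subst ha'
      have hv := GSeq.mem_verts_of_mem_ant he
      cases b with
      | false =>
        simp only [Bool.false_eq_true, if_false] at h
        have : v = w := natCode_injective h.1
        subst this
        exact ⟨v', he, (ih hv.2).mp h.2⟩
      | true =>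
        simp only [if_true] at h
        have : v' = w := natCode_injective h.1
        subst this
        exact ⟨v, he, (ih hv.1).mp h.2⟩
    · rintro ⟨v, he, h⟩
      have hv := h.mem_verts.1
      refine ⟨_, ⟨_, he, rfl⟩, ?_⟩
      cases b with
      | false => exact ⟨rfl, rfl, (ih hv).mpr h⟩
      | true => exact ⟨rfl, rfl, (ih hv).mpr h⟩

/-- The Horn rule allows to delete the edge atom `c` in the presence of `Γ`. -/
def Deletes (Γ c : Data) : Rule n → Prop
  | Rule.hornF a s => c.tl.hd = natCode a ∧ CodePath Γ s c.hd c.tl.tl.hd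
  | Rule.hornB a s => c.tl.hd = natCode a ∧ CodePath Γ s c.tl.tl.hd c.hd
  | _ => False

theorem PolyP.deletes (h : Rule n) {Γ c : Data → Data} (hΓ : Poly Γ) (hc : Poly c) :
    PolyP fun d => Deletes (Γ d) (c d) h := by
  cases h with
  | hornF a s =>
    exact PolyP.and (PolyP.eq hc.tl.hd (Poly.const _)) (PolyP.codePath s hΓ hc.hd hc.tl.tl.hd)
  | hornB a s =>
    exact PolyP.and (PolyP.eq hc.tl.hd (Poly.const _)) (PolyP.codePath s hΓ hc.tl.tl.hd hc.hd)
  | _ =>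
    exact (PolyP.eq (Poly.const Data.nil) (Poly.const (Data.cons Data.nil Data.nil))).of_iff
      fun d => by simp [Deletes]

/-- A Horn rule serves both productions of its pair: a path for the converse production is reversed
into a path for the rule. -/
theorem deletes_of_path {G : GSeq n} {Γ : Data} (hΓ : AtomsCode G.ant Γ) {h : Rule n}
    (hh : h.IsHorn) {p : Production n} (hp : p ∈ h.grammar.rules) {w u : Vertex}
    (hP : G.Path p.2 w u) : Deletes Γ (atomCode (edgeAtom w p.1 u)) h := by
  have hs := hP.conv
  cases h with
  | hornF a s =>
    rcases ESystem.mem_pair.mp hp with rfl | rfl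
    · exact ⟨rfl, (codePath_iff hΓ hP.mem_verts.1).mpr hP⟩
    · simp only [Production.conv, Str.conv_conv] at hs
      exact ⟨rfl, (codePath_iff hΓ hs.mem_verts.1).mpr hs⟩
  | hornB a s =>
    rcases ESystem.mem_pair.mp hp with rfl | rfl
    · exact ⟨rfl, (codePath_iff hΓ hP.mem_verts.1).mpr hP⟩
    · simp only [Production.conv, Str.conv_conv] at hs
      exact ⟨rfl, (codePath_iff hΓ hs.mem_verts.1).mpr hs⟩
  | _ => exact hh.elim

theorem infer_of_deletes {G P : GSeq n} {Γ : Data} (hΓ : AtomsCode G.ant Γ) {h : Rule n}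
    {w u : Vertex} {a : Fin n} (hw : w ∈ G.verts) (hu : u ∈ G.verts)
    (hd : Deletes Γ (atomCode (w, a, u)) h) (hPs : P.suc = G.suc)
    (hPa : P.ant = insert (w, a, u) G.ant) : h.Infer [P] G := by
  cases h with
  | hornF b s =>
    obtain ⟨hb, hd⟩ := hd
    have : a = b := Fin.ext (natCode_injective hb)
    subst this
    exact ⟨P, w, u, rfl, (codePath_iff hΓ hw).mp hd, hPa, hPs⟩
  | hornB b s =>
    obtain ⟨hb, hd⟩ := hd
    have : a = b := Fin.ext (natCode_injective hb)
    subst this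
    exact ⟨P, u, w, rfl, (codePath_iff hΓ hu).mp hd, hPa, hPs⟩
  | _ => exact hd.elim

/-! ### Saturation of the edge atoms under Horn rules, and the translation built on it -/

section Saturation

open Classical

variable (hs : List (Data × Rule n))

/-- The position of a Horn rule that allows to delete `c` in the presence of `Γ`. -/
noncomputable def findRule (Γ c : Data) : Data :=
  hs.foldr (fun q r => if Deletes Γ c q.2 then Data.cons q.1 Data.nil else r) Data.nil

/-- The state consists of the edge atoms, and of the positions of the rules used, the last first. -/
noncomputable def satStep (st c : Data) : Data :=
  if c ∈ st.hd.toList ∨ findRule hs st.hd c = Data.nil then st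
  else Data.cons (Data.cons c st.hd) (Data.cons (findRule hs st.hd c).hd st.tl)

variable {hs}

theorem Poly.findRule {Γ c : Data → Data} (hΓ : Poly Γ) (hc : Poly c) :
    Poly fun d => findRule hs (Γ d) (c d) := by
  unfold AbsCalc.findRule
  induction hs with
  | nil => exact Poly.const _
  | cons q hs ih => exact PolyP.ite (PolyP.deletes q.2 hΓ hc) (Poly.const _) ih

theorem size_findRule_le : ∃ C, ∀ Γ c, (findRule hs Γ c).size ≤ C := by
  induction hs with
  | nil => exact ⟨1, fun _ _ => by simp [findRule, Data.size]⟩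
  | cons q hs ih =>
    obtain ⟨C, hC⟩ := ih
    refine ⟨C + (Data.cons q.1 Data.nil).size, fun Γ c => ?_⟩
    have := hC Γ c
    simp only [findRule, List.foldr_cons] at this ⊢
    split_ifs <;> omega

theorem Poly.satStep {st c : Data → Data} (hst : Poly st) (hc : Poly c) :
    Poly fun d => satStep hs (st d) (c d) := by
  have hf : Poly fun d => AbsCalc.findRule hs (st d).hd (c d) := Poly.findRule hst.hd hc
  exact PolyP.ite (PolyP.or (PolyP.mem hc hst.hd) (PolyP.eq hf (Poly.const _))) hst
    ((hc.cons hst.hd).cons (hf.hd.cons hst.tl))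

theorem size_satStep_le {C : ℕ} (hC : ∀ Γ c, (findRule hs Γ c).size ≤ C) (st c : Data) :
    (satStep hs st c).size ≤ st.size + (c.size + C + 4) := by
  unfold satStep
  have h₁ := hC st.hd c
  have h₂ := Data.size_hd_le (findRule hs st.hd c)
  split_ifs with h
  · omega
  · cases st <;> simp only [Data.hd_cons, Data.tl_cons, Data.size] at * <;>
      simp only [Data.hd, Data.tl, Data.size] at * <;> omega

theorem findRule_ne_nil {Γ c : Data} (h : findRule hs Γ c ≠ Data.nil) :
    ∃ q ∈ hs, Deletes Γ c q.2 ∧ (findRule hs Γ c).hd = q.1 := by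
  induction hs with
  | nil => exact (h rfl).elim
  | cons q hs ih =>
    simp only [findRule, List.foldr_cons] at h ⊢
    split_ifs at h ⊢ with hd
    · exact ⟨q, by simp, hd, rfl⟩
    · obtain ⟨q', h₁, h₂, h₃⟩ := ih h
      exact ⟨q', by simp [h₁], h₂, h₃⟩

theorem not_deletes_of_findRule {Γ c : Data} (h : findRule hs Γ c = Data.nil) :
    ∀ q ∈ hs, ¬ Deletes Γ c q.2 := by
  induction hs with
  | nil => simp
  | cons q hs ih =>
    simp only [findRule, List.foldr_cons] at h
    split_ifs at h with hd
    · rw [List.forall_mem_cons]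
      exact ⟨hd, ih h⟩

/-- `μ` counts the members of `cs` that are missing from the state. A round through `cs` either
changes nothing or lowers `μ`, and `μ` is at most the length of `cs`; hence as many rounds as `cs`
has members reach a fixed point. -/
theorem foldl_satStep_fixed (cs : List Data) (st : Data) :
    (∀ c ∈ cs, satStep hs ((cs.flatMap fun _ => cs).foldl (satStep hs) st) c =
      (cs.flatMap fun _ => cs).foldl (satStep hs) st) := by
  set μ : Data → ℕ := fun st => (cs.toFinset \ st.hd.toList.toFinset).card with hμ
  have step : ∀ st, ∀ c ∈ cs, satStep hs st c = st ∨ μ (satStep hs st c) < μ st := by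
    intro st c hc
    unfold satStep
    split_ifs with h
    · exact Or.inl rfl
    · rw [not_or] at h
      refine Or.inr (Finset.card_lt_card ?_)
      simp only [Data.hd_cons, toList_cons, List.toFinset_cons]
      refine Finset.ssubset_iff_subset_ne.mpr ⟨Finset.sdiff_subset_sdiff subset_rfl
        (Finset.subset_insert _ _), fun e => ?_⟩
      have : c ∈ cs.toFinset \ st.hd.toList.toFinset := by simp [hc, h.1]
      rw [← e] at this
      simp at this
  have round : ∀ L : List Data, (∀ c ∈ L, c ∈ cs) → ∀ st,
      ((∀ c ∈ L, satStep hs st c = st) ∧ L.foldl (satStep hs) st = st) ∨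
        μ (L.foldl (satStep hs) st) < μ st := by
    intro L
    induction L with
    | nil => simp
    | cons c L ih =>
      intro hL st
      have hL' := fun c hc => hL c (List.mem_cons_of_mem _ hc)
      rw [List.foldl_cons]
      rcases step st c (hL c (by simp)) with h | h
      · rw [h]
        rcases ih hL' st with h' | h'
        · exact Or.inl ⟨by simpa [h] using h'.1, h'.2⟩
        · exact Or.inr h'
      · rcases ih hL' (satStep hs st c) with h' | h'
        · exact Or.inr (by rw [h'.2]; exact h)
        · exact Or.inr (h'.trans h)
  -- The elements of `L` merely count rounds.
  have main : ∀ L : List Data, ∀ st, μ st ≤ L.length →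
      ∀ c ∈ cs, satStep hs ((L.flatMap fun _ => cs).foldl (satStep hs) st) c =
        (L.flatMap fun _ => cs).foldl (satStep hs) st := by
    intro L
    induction L with
    | nil =>
      intro st hst c hc
      rcases step st c hc with h | h
      · exact h
      · simp at hst; omega
    | cons x L ih =>
      intro st hst c hc
      rw [List.flatMap_cons, List.foldl_append]
      rcases round cs (fun _ h => h) st with h | h
      · rw [h.2]
        have : ∀ L : List Data, (L.flatMap fun _ => cs).foldl (satStep hs) st = st := by
          intro L
          induction L with
          | nil => rfl
          | cons _ L ih => rw [List.flatMap_cons, List.foldl_append, h.2, ih]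
        rw [this]
        exact h.1 c hc
      · exact ih _ (by simp only [List.length_cons] at hst; omega) c hc
  exact main cs st ((Finset.card_le_card Finset.sdiff_subset).trans (List.toFinset_card_le cs))

/-- All edge atoms between the vertices. -/
noncomputable def allAtoms (n : ℕ) (s : Data) : Data :=
  listCode ((s.toList.map Data.hd).flatMap fun w => ((List.range n).map natCode).flatMap fun a =>
    (s.toList.map Data.hd).map fun u => listCode [w, a, u])

@[fun_prop]
theorem Poly.allAtoms {s : Data → Data} (hs : Poly s) : Poly fun d => allAtoms n (s d) := by
  have hv : Poly fun d => listCode ((s d).toList.map Data.hd) :=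
    Poly.map (F := fun _ x => x.hd) hs (by fun_prop)
  have h₁ : Poly fun e => listCode ((listCode ((s e.hd.hd).toList.map Data.hd)).toList.map
      fun u => listCode [e.hd.tl, e.tl, u]) :=
    Poly.map (F := fun e u => listCode [e.hd.tl, e.tl, u]) (hv.comp (by fun_prop))
      (by simp only [listCode_cons, listCode_nil]; fun_prop)
  have h₂ := Poly.flatMap (l := fun _ => listCode ((List.range n).map natCode))
    (F := fun e a => listCode ((listCode ((s e.hd).toList.map Data.hd)).toList.map
      fun u => listCode [e.tl, a, u])) (Poly.const _) h₁
  have h₃ := Poly.flatMap (F := fun d w => listCode ((listCode ((List.range n).map natCode)).toList.flatMap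
    fun a => (listCode ((listCode ((s d).toList.map Data.hd)).toList.map
      fun u => listCode [w, a, u])).toList)) hv h₂
  simpa only [toList_listCode, AbsCalc.allAtoms] using h₃

theorem mem_allAtoms {G : GSeq n} {s : Data} (hs : SucCode G.suc s) {c : Data} :
    c ∈ (allAtoms n s).toList ↔
      ∃ w ∈ G.verts, ∃ a : Fin n, ∃ u ∈ G.verts, c = atomCode (w, a, u) := by
  simp only [allAtoms, toList_listCode, List.mem_flatMap]
  constructor
  · rintro ⟨w, hw, a, ha, hc⟩
    obtain ⟨u, hu, rfl⟩ := List.mem_map.mp hc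
    obtain ⟨w, hw', rfl⟩ := hs.mem_verts.mp hw
    obtain ⟨u, hu', rfl⟩ := hs.mem_verts.mp hu
    obtain ⟨a, ha', rfl⟩ := List.mem_map.mp ha
    exact ⟨w, hw', ⟨a, List.mem_range.mp ha'⟩, u, hu', rfl⟩
  · rintro ⟨w, hw, a, u, hu, rfl⟩
    exact ⟨_, hs.mem_verts.mpr ⟨w, hw, rfl⟩, _, List.mem_map.mpr ⟨a, by simp, rfl⟩,
      List.mem_map.mpr ⟨_, hs.mem_verts.mpr ⟨u, hu, rfl⟩, rfl⟩⟩

variable (hs)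

/-- The saturation of the edge atoms of the node `d` together with those in `r`. -/
noncomputable def satState (r d : Data) : Data :=
  ((allAtoms n (nodeSuc d)).toList.flatMap fun _ => (allAtoms n (nodeSuc d)).toList).foldl
    (satStep hs) (Data.cons (dunion r (nodeAnt d)) Data.nil)

variable {hs}

theorem poly_rounds : Poly fun d => listCode
    ((allAtoms n (nodeSuc d)).toList.flatMap fun _ => (allAtoms n (nodeSuc d)).toList) :=
  Poly.flatMap (F := fun d _ => allAtoms n (nodeSuc d)) (by fun_prop) (by fun_prop)

theorem Poly.satState {r d : Data → Data} (hr : Poly r) (hd : Poly d) :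
    Poly fun x => satState hs (r x) (d x) := by
  obtain ⟨C, hC⟩ := size_findRule_le (hs := hs)
  have := Poly.foldl (s := fun _ st c => AbsCalc.satStep hs st c) ((poly_rounds (n := n)).comp hd)
    (i := fun x => Data.cons (AbsCalc.dunion (r x) (AbsCalc.nodeAnt (d x))) Data.nil) (by fun_prop)
    (Poly.satStep (by fun_prop) (by fun_prop)) (fun _ _ => True) (fun _ => trivial)
    ((PBdd.size.add (PBdd.const C)).add (PBdd.const 4))
    (fun x st c _ _ => ⟨trivial, (size_satStep_le hC st c).trans (by simp only [Data.size]; omega)⟩)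
  simp only [toList_listCode] at this
  exact this

/-- The candidates and the number of rounds depend on the node alone, so the growth beyond `r` is
bounded in terms of `d`, as `poly_treeRec` requires of an accumulator. -/
theorem size_satState_le : ∃ T, PBdd T ∧ ∀ r d, (satState hs r d).size ≤ r.size + T d := by
  obtain ⟨C, hC⟩ := size_findRule_le (hs := hs)
  have hL := (poly_rounds (n := n)).size_le
  refine ⟨_, (PBdd.size.add (PBdd.const 2)).add (hL.mul (hL.add (PBdd.const (C + 4)))),
    fun r d => ?_⟩
  set L := (allAtoms n (nodeSuc d)).toList.flatMap fun _ => (allAtoms n (nodeSuc d)).toList with hLd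
  show (L.foldl (satStep hs) _).size ≤ _
  refine (size_foldl_le (C := (listCode L).size + (C + 4)) (fun _ => True) trivial
    fun a x hx _ => ⟨trivial, ?_⟩).trans ?_
  · have h₂ := size_satStep_le hC a x
    try dsimp only
    have h₃ := Data.size_lt_of_mem (d := listCode L) (x := x)
      (by rw [toList_listCode]; exact hx)
    omega
  have h₁ := size_dunion_le r (nodeAnt d)
  have h₂ := size_nodeAnt_le d
  have h₃ := Data.length_lt_size (listCode L)
  rw [toList_listCode] at h₃
  have h₄ := Nat.mul_le_mul_right ((listCode L).size + (C + 4)) h₃.le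
  simp only [Data.size]
  omega

/-- Build the applications of Horn rules below the proof `dt`. -/
def wrap (s st dt : Data) : Data :=
  (st.tl.toList.foldl (fun p i => Data.cons p.hd.tl
    (mkNode i p.hd.tl s (Data.cons p.tl Data.nil))) (Data.cons st.hd dt)).tl

@[simp]
theorem wrap_nil (s Γ dt : Data) : wrap s (Data.cons Γ Data.nil) dt = dt := rfl

@[simp]
theorem wrap_cons (s c Γ i st dt : Data) :
    wrap s (Data.cons (Data.cons c Γ) (Data.cons i st)) dt =
      wrap s (Data.cons Γ st) (mkNode i Γ s (Data.cons dt Data.nil)) := rfl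

theorem size_wrap_step (s p x : Data) {m : ℕ} (hp : p.hd.size ≤ m) :
    (Data.cons p.hd.tl (mkNode x p.hd.tl s (Data.cons p.tl Data.nil))).hd.size ≤ m ∧
    (Data.cons p.hd.tl (mkNode x p.hd.tl s (Data.cons p.tl Data.nil))).size ≤
      p.size + (x.size + s.size + m + 10) := by
  have h₁ := Data.size_tl_le p.hd
  refine ⟨h₁.trans hp, ?_⟩
  cases p <;> simp only [mkNode, Data.hd, Data.tl, Data.size] at * <;> omega

theorem Poly.wrap {s st dt : Data → Data} (hs : Poly s) (hst : Poly st) (hdt : Poly dt) :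
    Poly fun d => wrap (s d) (st d) (dt d) := by
  have := Poly.foldl (l := fun e => e.tl.hd.tl)
    (i := fun e => Data.cons e.tl.hd.hd e.tl.tl)
    (s := fun e p x => Data.cons p.hd.tl (AbsCalc.mkNode x p.hd.tl e.hd (Data.cons p.tl Data.nil)))
    (by fun_prop) (by fun_prop) (by fun_prop) (fun e p => p.hd.size ≤ e.size)
    (fun e => (Data.size_hd_le e.tl.hd).trans ((Data.size_hd_le e.tl).trans (Data.size_tl_le e)))
    ((PBdd.const 2).mul (PBdd.size.add (PBdd.const 10)))
    (fun e p x hp _ => ⟨(size_wrap_step e.hd p x hp).1, (size_wrap_step e.hd p x hp).2.trans (by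
      have := Data.size_hd_le e
      simp only [Data.size]
      omega)⟩)
  exact (this.tl).comp (f := fun d => Data.cons (s d) (Data.cons (st d) (dt d))) (by fun_prop)

/-- Every application adds a node that holds a tail of the list of atoms, the succedent and a
position. The bound is additive in `dt`, as `poly_treeRec` requires of a value. -/
theorem size_wrap_le (s st dt : Data) :
    (wrap s st dt).size ≤ dt.size + (st.size + 1 + st.size * (2 * st.size + s.size + 10)) := by
  refine (Data.size_tl_le _).trans ((size_foldl_le (a := Data.cons st.hd dt) (C := 2 * st.size + s.size + 10)
    (fun p => p.hd.size ≤ st.size) (Data.size_hd_le st) fun p x hx hp =>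
      ⟨(size_wrap_step s p x hp).1, (size_wrap_step s p x hp).2.trans ?_⟩).trans ?_)
  · have := (Data.size_lt_of_mem hx).trans_le (Data.size_tl_le st)
    omega
  · have h₁ := Data.size_hd_le st
    have h₂ := (Data.length_lt_size st.tl).trans_le (Data.size_tl_le st)
    have h₃ := Nat.mul_le_mul_right (2 * st.size + s.size + 10) h₂.le
    simp only [Data.size]
    omega

-- The children receive all atoms of the saturated node.
variable (hs) in
noncomputable def fractureDown (r d : Data) : Data := (satState hs r d).hd

-- The node is rebuilt with its saturated atoms; the Horn rules below lead back to its own atoms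
-- together with those received.
variable (hs) in
noncomputable def fractureUp (tbl : List (Data × Data)) (r d res : Data) : Data :=
  wrap (nodeSuc d) (satState hs r d) (mkNode (lookup tbl d.hd) (satState hs r d).hd (nodeSuc d) res)

theorem poly_fractureTree (tbl : List (Data × Data)) :
    Poly fun d => treeRec (fractureDown hs) (fractureUp hs tbl) Data.nil d := by
  have hlook : Poly fun d => lookup tbl d.hd := Poly.lookup tbl (by fun_prop)
  obtain ⟨T, ⟨p, hp⟩, hT⟩ := size_satState_le (hs := hs)
  obtain ⟨q, hq⟩ := hlook.size_le
  have hsat : Poly fun e => satState hs e.hd e.tl.hd := Poly.satState (by fun_prop) (by fun_prop)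
  -- `Polynomial.X + p` bounds the saturated state; the last summand of `q` accounts for the Horn
  -- rules that `wrap` adds.
  refine poly_treeRec (p := p)
    (q := q + 2 * (Polynomial.X + p) + Polynomial.X + 10 +
      (Polynomial.X + p) * (2 * (Polynomial.X + p) + Polynomial.X + 10))
    ?_ ?_ (fun a d => ?_) (fun a d r => ?_) (Poly.const _) Poly.id
  · exact (Poly.satState (by fun_prop) (by fun_prop)).hd
  · exact Poly.wrap (by fun_prop) hsat
      ((Poly.lookup tbl (by fun_prop)).mkNode hsat.hd (by fun_prop) (by fun_prop))
  · exact (Data.size_hd_le _).trans ((hT a d).trans (Nat.add_le_add_left (hp d) _))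
  · have h₁ := size_wrap_le (nodeSuc d) (satState hs a d)
      (mkNode (lookup tbl d.hd) (satState hs a d).hd (nodeSuc d) r)
    have h₂ := hq d
    have h₃ := (hT a d).trans (Nat.add_le_add_left (hp d) _)
    have h₄ := Polynomial.eval_nat_mono p (Nat.le_add_left d.size a.size)
    have h₅ := Polynomial.eval_nat_mono q (Nat.le_add_left d.size a.size)
    have h₆ := size_nodeSuc_le d
    have h₇ := Data.size_hd_le (satState hs a d)
    set S := a.size + d.size with hS
    have h₈ : (satState hs a d).size ≤ S + p.eval S := by omega
    have h₉ := Nat.mul_le_mul h₈ (show 2 * (satState hs a d).size + (nodeSuc d).size + 10 ≤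
      2 * (S + p.eval S) + S + 10 by omega)
    simp only [Polynomial.eval_add, Polynomial.eval_mul, Polynomial.eval_X, Polynomial.eval_ofNat]
    unfold fractureUp
    simp only [mkNode, Data.size] at h₁ ⊢
    dsimp only at h₂
    omega

end Saturation

end AbsCalc

/-! ### Correctness of the introduction of Horn rules -/

namespace AbsCalc

variable {n : ℕ} {A : Calculus n} {H : Finset (Rule n)} {l l' : List (Rule n)}

/-- The state `st` lists the edge atoms of a g-sequent from which `X` is inferred by means of the
Horn rules in the state. -/
def Reaches (A : Calculus n) (l : List (Rule n)) (X : GSeq n) (s st : Data) (Y : GSeq n) : Prop :=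
  Y.suc = X.suc ∧ X.ant ⊆ Y.ant ∧ AtomsCode Y.ant st.hd ∧
    ∀ t dt, IsProof A t → t.concl = Y → ProofCode l t dt →
      ∃ t', IsProof A t' ∧ t'.concl = X ∧ ProofCode l t' (wrap s st dt)

/-- The atom just added is removed by one application of the rule that was found. Its position
becomes the head of the list, so `wrap` places this application directly below the proof of `Y'`. -/
theorem Reaches.satStep (hH : H ⊆ hornRules A) {X Y : GSeq n} {s st c : Data}
    (hs : SucCode X.suc s) (h : Reaches A l X s st Y) (hc : c ∈ (allAtoms n s).toList) :
    ∃ Y', Reaches A l X s (satStep (positions l H) st c) Y' := by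
  unfold AbsCalc.satStep
  split_ifs with hst
  · exact ⟨Y, h⟩
  rw [not_or] at hst
  obtain ⟨hYs, hYa, hY, hprf⟩ := h
  have hv : Y.verts = X.verts := by simp [GSeq.verts, hYs]
  obtain ⟨⟨j, ρ⟩, hq, hdel, hj⟩ := findRule_ne_nil hst.2
  obtain ⟨i, rfl, hi, hρ⟩ := mem_positions.mp hq
  obtain ⟨w, hw, a, u, hu, rfl⟩ := (mem_allAtoms hs).mp hc
  have hnew : (w, a, u) ∉ Y.ant := fun h => hst.1 (hY.mem_iff.mpr h)
  let Y' : GSeq n := Y.withAnt (insert (w, a, u) Y.ant) (by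
    intro e he
    rcases Finset.mem_insert.mp he with rfl | he
    · exact hv ▸ ⟨hw, hu⟩
    · exact GSeq.mem_verts_of_mem_ant he)
  refine ⟨Y', hYs, hYa.trans (Finset.subset_insert _ _), ?_, fun t dt ht htY hcode => ?_⟩
  · refine ⟨?_, fun y => ?_⟩
    · rw [Data.hd_cons, toList_cons, List.nodup_cons]
      exact ⟨hst.1, hY.1⟩
    · rw [Data.hd_cons, toList_cons, List.mem_cons, hY.2]
      show _ ↔ ∃ e ∈ insert (w, a, u) Y.ant, _
      simp only [Finset.exists_mem_insert]
      rw [eq_comm (a := y)]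
  · have hst' : st = Data.cons st.hd st.tl ∨ st = Data.nil := by cases st <;> simp
    have hwrap : wrap s (Data.cons (Data.cons (atomCode (w, a, u)) st.hd)
        (Data.cons (findRule (positions l H) st.hd (atomCode (w, a, u))).hd st.tl)) dt =
        wrap s st (mkNode (natCode i) st.hd s (Data.cons dt Data.nil)) := by
      rw [wrap_cons, hj]
      cases st <;> rfl
    rw [hwrap]
    have hinf : ρ.Infer [Y'] Y :=
      infer_of_deletes hY (hv ▸ hw) (hv ▸ hu) hdel rfl rfl
    refine hprf (ProofTree.node ρ Y [t]) _ (IsProof.node (mem_hornRules.mp (hH hρ)).1 ?_ ?_) rfl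
      (proofCode_node_iff.mpr ⟨i, st.hd, s, [dt], hi, hY, hYs ▸ hs, by simpa using hcode, rfl⟩)
    · simpa [htY] using hinf
    · simpa using ht

theorem satState_spec (hH : H ⊆ hornRules A) (hl : Lists l A) {X : GSeq n} {r d : Data}
    (hs : SucCode X.suc (nodeSuc d)) (hX : AtomsCode X.ant (dunion r (nodeAnt d))) :
    ∃ Y, Reaches A l X (nodeSuc d) (satState (positions l H) r d) Y ∧
      Y.Saturated (grammarOf H) := by
  have key : ∀ L : List Data, (∀ c ∈ L, c ∈ (allAtoms n (nodeSuc d)).toList) → ∀ st,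
      (∃ Y, Reaches A l X (nodeSuc d) st Y) →
      ∃ Y, Reaches A l X (nodeSuc d) (L.foldl (satStep (positions l H)) st) Y := by
    intro L
    induction L with
    | nil => exact fun _ _ h => h
    | cons c L ih =>
      rintro hL st ⟨Y, hY⟩
      exact ih (fun c hc => hL c (by simp [hc])) _ (hY.satStep hH hs (hL c (by simp)))
  obtain ⟨Y, hY⟩ := key _ (fun c hc => by
    obtain ⟨_, _, hc⟩ := List.mem_flatMap.mp hc
    exact hc) (Data.cons (dunion r (nodeAnt d)) Data.nil)
    ⟨X, rfl, subset_rfl, hX, fun t dt h₁ h₂ h₃ => ⟨t, h₁, h₂, by rwa [wrap_nil]⟩⟩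
  refine ⟨Y, hY, fun p hp w u hpath => ?_⟩
  obtain ⟨h, hh, hp⟩ := mem_grammarOf.mp hp
  have hhA := mem_hornRules.mp (hH hh)
  have hdel := deletes_of_path hY.2.2.1 hhA.2 hp hpath
  have hv : Y.verts = X.verts := by simp [GSeq.verts, hY.1]
  have hmem : atomCode (edgeAtom w p.1 u) ∈ (allAtoms n (nodeSuc d)).toList := by
    obtain ⟨h₁, h₂⟩ := hpath.mem_verts
    rw [hv] at h₁ h₂
    rw [mem_allAtoms hs]
    unfold edgeAtom
    split_ifs
    · exact ⟨u, h₂, _, w, h₁, rfl⟩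
    · exact ⟨w, h₁, _, u, h₂, rfl⟩
  have hfix := foldl_satStep_fixed (hs := positions l H) (allAtoms n (nodeSuc d)).toList
    (Data.cons (dunion r (nodeAnt d)) Data.nil) _ hmem
  set st := ((allAtoms n (nodeSuc d)).toList.flatMap fun _ => (allAtoms n (nodeSuc d)).toList).foldl
    (satStep (positions l H)) (Data.cons (dunion r (nodeAnt d)) Data.nil) with hst
  have hYst : AtomsCode Y.ant st.hd := hY.2.2.1
  by_cases hin : atomCode (edgeAtom w p.1 u) ∈ st.hd.toList
  · exact hYst.mem_iff.mp hin
  -- A missing atom that some rule of `H` deletes would be added by one more step, which would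
  -- enlarge the list of atoms; but the state is a fixed point.
  · exfalso
    have hf : findRule (positions l H) st.hd (atomCode (edgeAtom w p.1 u)) ≠ Data.nil := by
      obtain ⟨i, hi⟩ := List.mem_iff_getElem?.mp ((hl.2 h).mpr hhA.1)
      exact fun e => not_deletes_of_findRule e _ (mem_positions.mpr ⟨i, rfl, hi, hh⟩) hdel
    rw [AbsCalc.satStep, if_neg (by tauto)] at hfix
    have := congrArg (fun x => x.hd.size) hfix
    simp only [Data.hd_cons, Data.size] at this
    omega

/-- Induction on the proof, for all sets `R` of additional atoms. The premises are proved with all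
atoms of the saturated conclusion `Y`; then the original rule, chosen by `F`, infers `Y`, and Horn
rules lead from `Y` down to `X`. -/
theorem fractureTree_correct (hA : Explicit A) (hH : H ⊆ hornRules A) (hl : Lists l A)
    {F : Rule n → Rule n} (hF : ∀ ρ ∈ absorbHorn A H, F ρ ∈ A ∧ (F ρ).absorb (grammarOf H) = ρ)
    {t : ProofTree n} (ht : IsProof (absorbHorn A H) t) :
    ∀ d, ProofCode l' t d → ∀ (R : Finset (Vertex × Fin n × Vertex)) (r : Data) (X : GSeq n),
      AtomsCode R r → X.suc = t.concl.suc → X.ant = R ∪ t.concl.ant →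
      ∃ t', IsProof A t' ∧ t'.concl = X ∧ ProofCode l t'
        (treeRec (fractureDown (positions l H)) (fractureUp (positions l H) (posTable l' l F))
          r d) := by
  induction ht with
  | @node ρ G subs hρ hinf hsubs ih =>
    intro d hd R r X hr hXs hXa
    obtain ⟨i, g, s, ds, hi, hg, hs, hf, rfl⟩ := proofCode_node_iff.mp hd
    simp only [ProofTree.concl] at hXs hXa
    rw [treeRec_eq]
    set d := mkNode (natCode i) g s (listCode ds) with hd'
    have hkids : d.tl.tl.toList = ds := by simp [hd', mkNode]
    have hhd : d.hd = natCode i := rfl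
    have hant : nodeAnt d = g := rfl
    have hsuc : nodeSuc d = s := rfl
    obtain ⟨Y, hY, hsat⟩ := satState_spec (r := r) (d := d) hH hl (X := X)
      (by rw [hXs, hsuc]; exact hs) (by rw [hXa, hant]; exact hr.dunion hg)
    obtain ⟨hYs, hYa, hYc, hprf⟩ := hY
    obtain ⟨hFA, hFρ⟩ := hF ρ hρ
    have hinf' : ((F ρ).absorb (grammarOf H)).Infer (subs.map ProofTree.concl) G := by rwa [hFρ]
    have hprem := hinf.premise
    have hGY : G.ant ⊆ Y.ant := (by rw [hXa]; exact Finset.subset_union_right : G.ant ⊆ X.ant).trans hYa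
    have hYG : Y.verts = G.verts := by simp [GSeq.verts, hYs, hXs]
    obtain ⟨subs', k₁, k₂, k₃⟩ := exists_subproofs (B := A) (l := l)
      (rel := fun P P' => P'.suc = P.suc ∧ P'.ant = Y.ant ∪ P.ant)
      (F := treeRec (fractureDown (positions l H)) (fractureUp (positions l H) (posTable l' l F))
        (fractureDown (positions l H) r d))
      (forall₂_imp_of_mem hf fun t ht d' _ htd => by
        have hPm : t.concl ∈ subs.map ProofTree.concl := List.mem_map_of_mem ht
        obtain ⟨t', h₁, h₂, h₃⟩ := ih t ht d' htd Y.ant (fractureDown (positions l H) r d)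
          (t.concl.withAnt (Y.ant ∪ t.concl.ant) fun e he => by
            rcases Finset.mem_union.mp he with he | he
            · have := GSeq.mem_verts_of_mem_ant he
              rw [hYG] at this
              exact ⟨(hprem _ hPm).2 this.1, (hprem _ hPm).2 this.2⟩
            · exact GSeq.mem_verts_of_mem_ant he) hYc rfl rfl
        exact ⟨t', h₁, by rw [h₂]; exact ⟨rfl, rfl⟩, h₃⟩)
    rw [hkids, fractureUp, hhd, lookup_posTable hi]
    refine hprf (ProofTree.node (F ρ) Y subs') _ (IsProof.node hFA (hinf'.fracture
      (fun G' hG' => hA.systems_eq_empty hFA hG') (hYs.trans hXs) hGY hsat k₂) k₁) rfl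
      (proofCode_node_iff.mpr ⟨_, _, _, _, List.getElem?_idxOf ((hl.2 _).mpr hFA), hYc, ?_, k₃, rfl⟩)
    rw [hYs, hXs, hsuc]
    exact hs

/-! ## Polynomial equivalence -/

theorem lists_toList (A : Calculus n) : Lists A.toList A :=
  ⟨A.nodup_toList, fun _ => Finset.mem_toList⟩

theorem exists_setCode {α : Type} {f : α → Data} (hf : Function.Injective f) (s : Finset α) :
    ∃ d, SetCode (fun x d => d = f x) (s : Set α) d :=
  ⟨listCode (s.toList.map f), (setCode_iff hf).mpr ⟨by
    rw [toList_listCode]; exact s.nodup_toList.map hf, by simp⟩⟩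

theorem GSeq.exists_code (G : GSeq n) : ∃ d, G.Code d := by
  obtain ⟨g, hg⟩ := exists_setCode atomCode_injective G.ant
  obtain ⟨s, hs⟩ := exists_setCode (f := fun q : Vertex × Sequent =>
    Data.cons (natCode q.1) (natCode q.2)) (by
      rintro ⟨a, b⟩ ⟨a', b'⟩ h
      simp only [Data.cons.injEq] at h
      rw [natCode_injective h.1, natCode_injective h.2]) G.suc
  exact ⟨_, g, s, hg, hs, rfl⟩

theorem exists_proofCode (hl : Lists l A) {t : ProofTree n} (ht : IsProof A t) :
    ∃ d, ProofCode l t d := by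
  induction ht with
  | @node ρ G subs hρ _ _ ih =>
    obtain ⟨i, hi⟩ := List.mem_iff_getElem?.mp ((hl.2 ρ).mpr hρ)
    obtain ⟨d, hd⟩ := G.exists_code
    obtain ⟨g, s, hg, hs, rfl⟩ := gSeq_code_iff.mp hd
    choose f hf using ih
    refine ⟨_, proofCode_node_iff.mpr ⟨i, g, s, subs.attach.map fun t => f t.1 t.2, hi, hg, hs, ?_,
      rfl⟩⟩
    rw [List.forall₂_map_right_iff]
    have : List.Forall₂ (fun (a c : {x // x ∈ subs}) => ProofCode l a.1 (f c.1 c.2))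
        subs.attach subs.attach := by
      rw [List.forall₂_same]
      exact fun t _ => hf t.1 t.2
    have h : List.Forall₂ (fun t (c : {x // x ∈ subs}) => ProofCode l t (f c.1 c.2))
        (subs.attach.map Subtype.val) subs.attach := List.forall₂_map_left_iff.mpr this
    simpa using h

/-- Proofs can be translated in polynomial time. -/
def Translates (A B : Calculus n) (l l' : List (Rule n)) : Prop :=
  ∃ f, Poly f ∧ ∀ G t d, IsProofOf A G t → ProofCode l t d →
    ∃ t', IsProofOf B G t' ∧ ProofCode l' t' (f d)

theorem Translates.trans {B C : Calculus n} {l'' : List (Rule n)} (h : Translates A B l l')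
    (h' : Translates B C l' l'') : Translates A C l l'' := by
  obtain ⟨f, hf, h⟩ := h
  obtain ⟨g, hg, h'⟩ := h'
  refine ⟨_, hg.comp hf, fun G t d ht hd => ?_⟩
  obtain ⟨t', ht', hd'⟩ := h G t d ht hd
  exact h' G t' _ ht' hd'

theorem translates_absorbHorn (hA : Explicit A) (hH : AntiFracturable (hornRules A) H)
    (hl' : Lists l' (absorbHorn A H)) : Translates A (absorbHorn A H) l l' := by
  refine ⟨_, poly_absorbTree (posCodes l H) (posCodes l (hornRules A))
    (posTable l l' (Rule.absorb (grammarOf H))), fun G t d ht hd => ?_⟩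
  obtain ⟨t', h₁, h₂, h₃⟩ := absorbTree_correct hA hH hl' ht.1 d hd ∅ Data.nil t.concl atomsCode_nil
    (Finset.empty_subset _) rfl (by simp) fun w a u h => langPath_of_mem_ant h
  exact ⟨t', ⟨h₁, h₂.trans ht.2⟩, h₃⟩

theorem translates_of_absorbHorn (hA : Explicit A) (hH : H ⊆ hornRules A) (hl : Lists l A) :
    Translates (absorbHorn A H) A l' l := by
  have hF : ∀ ρ, ∃ ρ', ρ ∈ absorbHorn A H → ρ' ∈ A ∧ ρ'.absorb (grammarOf H) = ρ := by
    intro ρ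
    by_cases h : ρ ∈ absorbHorn A H
    · obtain ⟨ρ', h₁, _, h₂⟩ := (mem_absorbHorn fun h hh => (mem_hornRules.mp (hH hh)).2).mp h
      exact ⟨ρ', fun _ => ⟨h₁, h₂⟩⟩
    · exact ⟨ρ, fun h' => absurd h' h⟩
  choose F hF using hF
  refine ⟨_, poly_fractureTree (hs := positions l H) (posTable l' l F), fun G t d ht hd => ?_⟩
  obtain ⟨t', h₁, h₂, h₃⟩ := fractureTree_correct hA hH hl hF ht.1 d hd ∅ Data.nil t.concl
    atomsCode_nil rfl (by simp)
  exact ⟨t', ⟨h₁, h₂.trans ht.2⟩, h₃⟩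

theorem PTime.of_poly {f : Data → Data} {Q : Data → Set Data → Prop} (hf : Poly f)
    (h : ∀ d O, Q d O → f d ∈ O) : PTime Q := by
  obtain ⟨T, ⟨p, hp⟩, c, K, hc⟩ := hf
  refine ⟨c, p, fun d O hd => ?_⟩
  obtain ⟨t, σ', h₁, h₂, _, h₄⟩ := hc (Function.update (fun _ => Data.nil) 0 d)
  simp only [Function.update_self] at h₂ h₄
  exact ⟨t, _, ⟨σ', h₁, rfl⟩, h₄.trans (hp d), by rw [h₂]; exact h d O hd⟩

theorem ExpTime.of_expo {f : Data → Data} {Q : Data → Set Data → Prop} (hf : Expo f)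
    (h : ∀ d O, Q d O → f d ∈ O) : ExpTime Q := by
  obtain ⟨T, ⟨U, ⟨p, hp⟩, hU⟩, c, K, hc⟩ := hf
  refine ⟨c, p, fun d O hd => ?_⟩
  obtain ⟨t, σ', h₁, h₂, _, h₄⟩ := hc (Function.update (fun _ => Data.nil) 0 d)
  simp only [Function.update_self] at h₂ h₄
  exact ⟨t, _, ⟨σ', h₁, rfl⟩, h₄.trans ((hU d).trans (Nat.pow_le_pow_right two_pos (hp d))),
    by rw [h₂]; exact h d O hd⟩

/-- Each translation passes through `A`, so `H` and `H'` need not be comparable. -/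
theorem polyEquiv_absorbHorn (hA : Explicit A) {H' : Finset (Rule n)}
    (hH : AntiFracturable (hornRules A) H) (hH' : AntiFracturable (hornRules A) H') :
    PolyEquiv (absorbHorn A H) (absorbHorn A H') := by
  have key : ∀ H H' : Finset (Rule n), AntiFracturable (hornRules A) H →
      AntiFracturable (hornRules A) H' → ∀ l l', Lists l' (absorbHorn A H') →
      Translates (absorbHorn A H) (absorbHorn A H') l l' := fun H H' hH hH' l l' hl' =>
    (translates_of_absorbHorn hA hH.subset (lists_toList A)).trans
      (translates_absorbHorn hA hH' hl')
  have prov : ∀ H H' : Finset (Rule n), AntiFracturable (hornRules A) H →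
      AntiFracturable (hornRules A) H' → ∀ G, (∃ t, IsProofOf (absorbHorn A H) G t) →
      ∃ t, IsProofOf (absorbHorn A H') G t := by
    rintro H H' hH hH' G ⟨t, ht⟩
    obtain ⟨f, _, hf⟩ := key H H' hH hH' _ _ (lists_toList _)
    obtain ⟨d, hd⟩ := exists_proofCode (lists_toList _) ht.1
    obtain ⟨t', ht', _⟩ := hf G t d ht hd
    exact ⟨t', ht'⟩
  have time : ∀ H H' : Finset (Rule n), AntiFracturable (hornRules A) H →
      AntiFracturable (hornRules A) H' → ∀ l l', Lists l' (absorbHorn A H') →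
      PTime (translationProblem (absorbHorn A H) (absorbHorn A H') l l') := by
    intro H H' hH hH' l l' hl'
    obtain ⟨f, hf, h⟩ := key H H' hH hH' l l' hl'
    refine PTime.of_poly hf ?_
    rintro d O ⟨G, t, ht, hd, rfl⟩
    exact h G t d ht hd
  exact ⟨fun G => ⟨prov H H' hH hH' G, prov H' H hH' hH G⟩,
    fun l l' hl hl' => ⟨time H H' hH hH' l l' hl', time H' H hH' hH l' l hl⟩⟩

end AbsCalc

namespace AbsCalc

/-! ## Codes of absorbed calculi -/

section Codes

variable {n : ℕ}

def prodCode (p : Production n) : Data := Data.cons (letterCode p.1) (strCode p.2)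

theorem letterCode_injective : Function.Injective (letterCode (n := n)) := by
  rintro ⟨a, b⟩ ⟨a', b'⟩ h
  simp only [letterCode, Data.cons.injEq] at h
  rw [Fin.ext (natCode_injective h.1), boolCode_injective h.2]

theorem strCode_injective : Function.Injective (strCode (n := n)) := fun _ _ h =>
  List.map_injective_iff.mpr letterCode_injective (listCode_injective h)

theorem prodCode_injective : Function.Injective (prodCode (n := n)) := by
  rintro ⟨x, s⟩ ⟨x', s'⟩ h
  simp only [prodCode, Data.cons.injEq] at h
  rw [letterCode_injective h.1, strCode_injective h.2]

open Classical in
noncomputable def convLetterData (x : Data) : Data :=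
  Data.cons x.hd (if x.tl = Data.nil then Data.cons Data.nil Data.nil else Data.nil)

noncomputable def convProdData (p : Data) : Data :=
  Data.cons (convLetterData p.hd) (listCode (listCode (p.tl.toList.map convLetterData)).toList.reverse)

open Classical in
/-- The production of the Horn rule with the given code. -/
noncomputable def hornProdData (h : Data) : Data :=
  Data.cons (Data.cons h.tl.hd
    (if h.hd = natCode 3 then Data.nil else Data.cons Data.nil Data.nil)) h.tl.tl.hd

/-- The grammar of the Horn rule with the given code. -/
noncomputable def hornPairData (h : Data) : Data :=
  listCode [hornProdData h, convProdData (hornProdData h)]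

theorem convLetterData_letterCode (x : Letter n) :
    convLetterData (letterCode x) = letterCode (Letter.conv x) := by
  obtain ⟨a, b⟩ := x
  cases b <;> simp [convLetterData, letterCode, Letter.conv, boolCode]

theorem convProdData_prodCode (p : Production n) :
    convProdData (prodCode p) = prodCode (Production.conv p) := by
  simp only [convProdData, prodCode, Data.hd_cons, Data.tl_cons, convLetterData_letterCode,
    toList_listCode, strCode, Production.conv, Str.conv, List.map_reverse, List.map_map]
  congr 3
  exact List.map_congr_left fun x _ => convLetterData_letterCode x

theorem poly_convLetterData : Poly convLetterData := by
  unfold convLetterData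
  exact (by fun_prop : Poly fun d : Data => d.hd).cons
    (PolyP.ite (PolyP.eq (by fun_prop) (by fun_prop)) (by fun_prop) (by fun_prop))

theorem poly_convProdData : Poly convProdData := by
  unfold convProdData
  exact (poly_convLetterData.comp (by fun_prop : Poly fun d : Data => d.hd)).cons
    (Poly.reverse (Poly.map (F := fun _ => convLetterData) (by fun_prop)
      (poly_convLetterData.comp (by fun_prop : Poly fun d : Data => d.tl))))

theorem poly_hornProdData : Poly hornProdData := by
  unfold hornProdData
  exact ((by fun_prop : Poly fun d : Data => d.tl.hd).cons
    (PolyP.ite (PolyP.eq (by fun_prop) (by fun_prop)) (by fun_prop) (by fun_prop))).cons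
    (by fun_prop)

theorem poly_hornPairData : Poly hornPairData := by
  unfold hornPairData
  exact poly_hornProdData.cons ((poly_convProdData.comp poly_hornProdData).cons (Poly.const _))

/-- The code of a Horn rule. -/
def hornCode : Rule n → Data
  | .hornF a s => listCode [natCode 3, natCode a, strCode s]
  | .hornB a s => listCode [natCode 4, natCode a, strCode s]
  | _ => Data.nil

def IsHornData (x : Data) : Prop := x.hd = natCode 3 ∨ x.hd = natCode 4

theorem polyP_isHornData : PolyP IsHornData := by
  unfold IsHornData
  exact (PolyP.eq (by fun_prop) (by fun_prop)).or (PolyP.eq (by fun_prop) (by fun_prop))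

theorem hornCode_injOn {h h' : Rule n} (hh : h.IsHorn) (hh' : h'.IsHorn)
    (e : hornCode h = hornCode h') : h = h' := by
  have h34 : natCode 3 ≠ natCode 4 := fun e => by simpa using natCode_injective e
  cases h <;> first | exact hh.elim | skip
  all_goals cases h' <;> first | exact hh'.elim | skip
  all_goals
    simp only [hornCode, listCode_cons, Data.cons.injEq, h34, h34.symm, false_and, and_true,
      true_and] at e
  all_goals rw [Fin.ext (natCode_injective e.1), strCode_injective e.2]

theorem Rule.Code.isHornData_iff {ν : SeqConstraint → ℕ} {ρ : Rule n} {x : Data}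
    (h : ρ.Code ν x) : IsHornData x ↔ ρ.IsHorn := by
  have key : ∀ m k, natCode m = natCode k ↔ m = k := fun m k => natCode_injective.eq_iff
  cases ρ with
  | init C R =>
    obtain ⟨c, _, rfl⟩ := h
    simp [IsHornData, key, Rule.IsHorn]
  | reach fam R =>
    obtain ⟨c, _, rfl⟩ := h
    simp [IsHornData, key, Rule.IsHorn]
  | _ =>
    cases h
    simp [IsHornData, key, Rule.IsHorn]

theorem Rule.Code.eq_hornCode {ν : SeqConstraint → ℕ} {ρ : Rule n} {x : Data}
    (h : ρ.Code ν x) (hρ : ρ.IsHorn) : x = hornCode ρ := by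
  cases ρ <;> first | exact hρ.elim | exact h

theorem hornProdData_hornCode {h : Rule n} (hh : h.IsHorn) :
    ∃ p, h.grammar = ESystem.pair p ∧ hornProdData (hornCode h) = prodCode p := by
  have h34 : natCode 4 ≠ natCode 3 := fun e => by simpa using natCode_injective e
  cases h with
  | hornF a s => exact ⟨_, rfl, by simp [hornProdData, hornCode, prodCode, letterCode, boolCode]⟩
  | hornB a s =>
    exact ⟨_, rfl, by simp [hornProdData, hornCode, prodCode, letterCode, boolCode, h34]⟩
  | _ => exact hh.elim

theorem mem_hornPairData {h : Rule n} (hh : h.IsHorn) {y : Data} :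
    y ∈ (hornPairData (hornCode h)).toList ↔ ∃ p ∈ h.grammar.rules, prodCode p = y := by
  obtain ⟨p, hp, e⟩ := hornProdData_hornCode hh
  rw [hornPairData, e, convProdData_prodCode, hp, toList_listCode]
  simp only [ESystem.mem_pair, exists_eq_or_imp, exists_eq_left]
  simp [eq_comm]

/-- `Hs` lists the codes of the Horn rules in `H`. -/
def HornCodes (H : Finset (Rule n)) (Hs : Data) : Prop :=
  (∀ h ∈ H, h.IsHorn) ∧ ∀ y, y ∈ Hs.toList ↔ ∃ h ∈ H, hornCode h = y

/-- The code of a Horn rule involves neither `ν` nor the order of a set. It is thus unique, and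
membership can be tested on codes. -/
theorem HornCodes.mem_iff {H : Finset (Rule n)} {Hs : Data} (hH : HornCodes H Hs)
    {ν : SeqConstraint → ℕ} {ρ : Rule n} {x : Data} (h : ρ.Code ν x) : x ∈ Hs.toList ↔ ρ ∈ H := by
  rw [hH.2]
  constructor
  · rintro ⟨h', hh', rfl⟩
    have hρ : ρ.IsHorn := by
      rw [← h.isHornData_iff]
      have := hH.1 h' hh'
      cases h' <;> first | exact this.elim | simp [hornCode, IsHornData]
    rwa [hornCode_injOn hρ (hH.1 h' hh') (h.eq_hornCode hρ).symm]
  · exact fun hρ => ⟨ρ, hρ, (h.eq_hornCode (hH.1 ρ hρ)).symm⟩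

open Classical in
/-- The grammar of a list of Horn rules. -/
noncomputable def grammarData (Hs : Data) : Data :=
  listCode ((listCode (Hs.toList.flatMap fun x => (hornPairData x).toList)).toList ∪
    Data.nil.toList)

theorem poly_grammarData : Poly grammarData := by
  unfold grammarData
  exact Poly.union (Poly.flatMap (F := fun _ => hornPairData) Poly.id
    (poly_hornPairData.comp (by fun_prop))) (Poly.const _)

theorem HornCodes.grammarData_code {H : Finset (Rule n)} {Hs : Data} (hH : HornCodes H Hs) :
    (grammarOf H).Code (grammarData Hs) := by
  classical
  refine (setCode_iff (f := prodCode) prodCode_injective).mpr ⟨?_, fun y => ?_⟩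
  -- The union with the empty list removes repetitions; these occur when a production is its own
  -- converse, or when a forward and a backward rule have the same grammar.
  · rw [grammarData, toList_listCode]
    exact List.Nodup.union _ (by simp)
  · simp only [grammarData, toList_listCode, List.mem_union_iff, List.mem_flatMap, toList_nil,
      List.not_mem_nil, or_false, hH.2, SetLike.mem_coe, mem_grammarOf]
    constructor
    · rintro ⟨_, ⟨h, hh, rfl⟩, hy⟩
      obtain ⟨p, hp, rfl⟩ := (mem_hornPairData (hH.1 h hh)).mp hy
      exact ⟨p, ⟨h, hh, hp⟩, rfl⟩
    · rintro ⟨p, ⟨h, hh, hp⟩, rfl⟩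
      exact ⟨_, ⟨h, hh, rfl⟩, (mem_hornPairData (hH.1 h hh)).mpr ⟨p, hp, rfl⟩⟩

/-- The code `ρ ⊕ G` if the systems in `ρ` are empty. -/
noncomputable def absorbData (g ρ : Data) : Data :=
  open Classical in
  if ρ.hd = natCode 0 then
    Data.cons ρ.hd (Data.cons (Data.cons ρ.tl.hd.hd (listCode (ρ.tl.hd.tl.toList.map fun e =>
      Data.cons e.hd (Data.cons g e.tl.tl)))) ρ.tl.tl)
  else if ρ.hd = natCode 5 then
    Data.cons ρ.hd (Data.cons (listCode (ρ.tl.hd.toList.map fun L => Data.cons g L.tl)) ρ.tl.tl)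
  else ρ

theorem poly_absorbData : Poly fun e => absorbData e.hd e.tl := by
  unfold absorbData
  refine PolyP.ite (PolyP.eq (by fun_prop) (by fun_prop)) ?_
    (PolyP.ite (PolyP.eq (by fun_prop) (by fun_prop)) ?_ (by fun_prop))
  · exact (by fun_prop : Poly fun d : Data => d.tl.hd).cons
      ((((by fun_prop : Poly fun d : Data => d.tl.tl.hd.hd)).cons
        (Poly.map (l := fun d => d.tl.tl.hd.tl) (F := fun d e => Data.cons e.hd
          (Data.cons d.hd e.tl.tl)) (by fun_prop) (by fun_prop))).cons (by fun_prop))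
  · exact (by fun_prop : Poly fun d : Data => d.tl.hd).cons
      ((Poly.map (l := fun d => d.tl.tl.hd) (F := fun d L => Data.cons d.hd L.tl)
        (by fun_prop) (by fun_prop)).cons (by fun_prop))

/-- As the systems are empty, the code of `G` simply takes the place of each of them. -/
theorem Rule.Code.absorb {ν : SeqConstraint → ℕ} {ρ : Rule n} {x g : Data} {G : ESystem n}
    (h : ρ.Code ν x) (hρ : ∀ G' ∈ ρ.systems, G' = ESystem.empty) (hg : G.Code g) :
    (ρ.absorb G).Code ν (absorbData g x) := by
  have key : ∀ m k, natCode m = natCode k ↔ m = k := fun m k => natCode_injective.eq_iff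
  have lab : ∀ (L : Label n) y, L.1 = ESystem.empty → L.Code y →
      (L.absorb G).Code (Data.cons g y.tl) := by
    rintro ⟨G', a⟩ y rfl ⟨g', _, rfl⟩
    exact ⟨g, by simpa [Label.absorb] using hg, rfl⟩
  cases ρ with
  | init C R =>
    obtain ⟨c, ⟨v, e, hv, he, rfl⟩, rfl⟩ := h
    simp only [absorbData, listCode_cons, Data.hd_cons, Data.tl_cons, if_true]
    refine ⟨_, ⟨v, _, hv, ?_, rfl⟩, rfl⟩
    obtain ⟨l, ds, h₁, h₂, h₃, rfl⟩ := he
    refine ⟨l, _, h₁, h₂, ?_, rfl⟩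
    rw [toList_listCode]
    refine List.forall₂_map_right_iff.mpr (h₃.imp ?_)
    rintro ⟨e, he⟩ d ⟨y, hy, rfl⟩
    exact ⟨_, lab _ y (hρ _ ⟨⟨e, he⟩, rfl⟩) hy, rfl⟩
  | reach fam R =>
    obtain ⟨ds, h₁, rfl⟩ := h
    simp only [absorbData, listCode_cons, Data.hd_cons, Data.tl_cons, if_true, key,
      OfNat.ofNat_ne_zero, if_false]
    refine ⟨_, ?_, rfl⟩
    rw [toList_listCode, List.forall₂_map_right_iff, List.forall₂_map_left_iff]
    exact forall₂_imp_of_mem h₁ fun L hL y _ hy => lab L y (hρ _ ⟨L, hL, rfl⟩) hy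
  | _ =>
    cases h
    simp [absorbData, key, Rule.absorb, Rule.Code]

open Classical in
/-- `absorbHorn` on codes of explicit calculi. -/
noncomputable def absorbHornData (d Hs : Data) : Data :=
  Data.cons d.hd (listCode ((listCode (d.tl.toList.filter fun x => x ∉ Hs.toList)).toList.map
    (absorbData (grammarData Hs))))

theorem poly_absorbHornData : Poly fun e => absorbHornData e.hd e.tl := by
  unfold absorbHornData
  refine (by fun_prop : Poly fun e : Data => e.hd.hd).cons
    (Poly.map (F := fun e => absorbData (grammarData e.tl)) ?_ ?_)
  · exact Poly.filter (l := fun e => e.hd.tl) (P := fun e x => x ∉ e.tl.toList) (by fun_prop)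
      (PolyP.mem (by fun_prop) (by fun_prop)).not
  · exact poly_absorbData.comp
      ((poly_grammarData.comp (by fun_prop : Poly fun e : Data => e.hd.tl)).cons
        (by fun_prop : Poly fun e : Data => e.tl))

theorem forall₂_map_filter {α β γ δ : Type*} {R : α → β → Prop} {S : γ → δ → Prop} {p : α → Bool}
    {q : β → Bool} {f : α → γ} {g : β → δ} {l : List α} {l' : List β} (h : List.Forall₂ R l l')
    (hpq : ∀ a ∈ l, ∀ b, R a b → (p a ↔ q b)) (hS : ∀ a ∈ l, ∀ b, R a b → p a → S (f a) (g b)) :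
    List.Forall₂ S ((l.filter p).map f) ((l'.filter q).map g) := by
  induction h with
  | nil => simp
  | @cons a b l l' hab _ ih =>
    have ih := ih (fun a ha => hpq a (by simp [ha])) (fun a ha => hS a (by simp [ha]))
    have h₁ := hpq a (by simp) b hab
    have h₂ := hS a (by simp) b hab
    by_cases hp : p a
    · rw [List.filter_cons_of_pos hp, List.filter_cons_of_pos (h₁.mp hp)]
      exact List.Forall₂.cons (h₂ hp) ih
    · rw [List.filter_cons_of_neg hp, List.filter_cons_of_neg fun h => hp (h₁.mpr h)]
      exact ih

theorem Rule.fracture_absorb (ρ : Rule n) (G : ESystem n) :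
    (ρ.absorb G).fracture G = ρ.fracture G := by
  have : ∀ G' : ESystem n, (G'.union G).sdiff G = G'.sdiff G := fun G' => by
    ext1; simp [ESystem.union, ESystem.sdiff, Finset.union_sdiff_right]
  cases ρ <;> simp [Rule.absorb, Rule.fracture, Constraint.absorb, Constraint.fracture,
    Label.absorb, Label.fracture, this]

variable {A : Calculus n} {ν : SeqConstraint → ℕ} {d : Data}

/-- On rules with empty systems, fracturing undoes absorption. Distinct rules thus stay distinct,
and the code of the absorbed calculus lists no rule twice. -/
theorem Explicit.absorb_injOn (hA : Explicit A) {G : ESystem n} {ρ ρ' : Rule n} (hρ : ρ ∈ A)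
    (hρ' : ρ' ∈ A) (h : ρ.absorb G = ρ'.absorb G) : ρ = ρ' := by
  have key : ∀ ρ ∈ A, (ρ.absorb G).fracture G = ρ := fun ρ hρ => by
    rw [Rule.fracture_absorb, Rule.fracture_eq_self_iff]
    intro G' hG'
    rw [hA.systems_eq_empty hρ hG']
    ext1; simp [ESystem.sdiff, ESystem.empty]
  rw [← key ρ hρ, h, key ρ' hρ']

theorem calcCode_absorbHorn (hA : Explicit A) (hd : calcCode ν A d) {H : Finset (Rule n)}
    {Hs : Data} (hH : HornCodes H Hs) : calcCode ν (absorbHorn A H) (absorbHornData d Hs) := by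
  classical
  obtain ⟨r, ⟨l, ds, h₁, h₂, h₃, rfl⟩, rfl⟩ := hd
  refine ⟨_, ⟨(l.filter (· ∉ H)).map (Rule.absorb (grammarOf H)), _, ?_, fun ρ => ?_, ?_, rfl⟩, rfl⟩
  · refine List.Nodup.map_on (fun ρ hρ ρ' hρ' h => ?_) (h₁.filter _)
    exact hA.absorb_injOn ((h₂ _).mp (List.mem_filter.mp hρ).1) ((h₂ _).mp (List.mem_filter.mp hρ').1) h
  · rw [Finset.mem_coe, mem_absorbHorn hH.1]
    simp [h₂, and_assoc]
  · simp only [Data.tl_cons, toList_listCode]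
    refine forall₂_map_filter h₃ (fun ρ _ x hx => ?_) fun ρ hρ x hx _ => ?_
    · simp [hH.mem_iff hx]
    · exact hx.absorb (fun G hG => hA.systems_eq_empty ((h₂ _).mp hρ) hG) hH.grammarData_code

open Classical in
/-- The Horn rules in the code of a calculus. -/
noncomputable def hornData (d : Data) : Data := listCode (d.tl.toList.filter fun x => IsHornData x)

theorem poly_hornData : Poly hornData := by
  unfold hornData
  exact Poly.filter (P := fun _ => IsHornData) (by fun_prop) (polyP_isHornData.comp (by fun_prop))

theorem hornData_spec (hd : calcCode ν A d) : ∃ l : List (Rule n), l.Nodup ∧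
    (∀ ρ, ρ ∈ l ↔ ρ ∈ hornRules A) ∧ (hornData d).toList = l.map hornCode := by
  classical
  obtain ⟨r, ⟨l, ds, h₁, h₂, h₃, rfl⟩, rfl⟩ := hd
  refine ⟨l.filter fun ρ => ρ.IsHorn, h₁.filter _, fun ρ => by simp [h₂, mem_hornRules], ?_⟩
  have := forall₂_map_filter (S := Eq) (p := fun ρ : Rule n => decide ρ.IsHorn)
    (q := fun x => decide (IsHornData x)) (f := hornCode) (g := fun x => x) h₃
    (fun ρ _ x hx => by simp [hx.isHornData_iff])
    fun ρ _ x hx hρ => (hx.eq_hornCode (by simpa using hρ)).symm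
  rw [List.forall₂_eq_eq_eq] at this
  simp [hornData, this]

theorem hornCodes_of_list {l : List (Rule n)} (hl : ∀ ρ ∈ l, ρ.IsHorn) {Hs : Data}
    (h : Hs.toList = l.map hornCode) : HornCodes l.toFinset Hs :=
  ⟨by simpa using hl, fun y => by simp [h]⟩

end Codes

theorem topProblem_pTime : PTime topProblem := by
  refine PTime.of_poly (f := fun d => absorbHornData d (hornData d))
    (poly_absorbHornData.comp (f := fun d => Data.cons d (hornData d))
      (Poly.cons Poly.id poly_hornData)) ?_
  rintro d O ⟨n, A, ν, hA, _, hd, rfl⟩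
  obtain ⟨l, _, hl, e⟩ := hornData_spec hd
  have hH : l.toFinset = hornRules A := by ext; simp [hl]
  refine ⟨_, isTop_absorbHorn A, calcCode_absorbHorn hA hd ?_⟩
  rw [← hH]
  exact hornCodes_of_list (fun ρ hρ => (mem_hornRules.mp ((hl ρ).mp hρ)).2) e

end AbsCalc

namespace AbsCalc

/-! ## Sublists -/

/-- Each list in `a`, without and with `x`. -/
def sublistsStep (a x : Data) : Data :=
  listCode (a.toList ++ (listCode (a.toList.map (Data.cons x))).toList)

theorem poly_sublistsStep : Poly fun e => sublistsStep e.tl.hd e.tl.tl := by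
  unfold sublistsStep
  exact Poly.append (by fun_prop) (Poly.map (F := fun e => Data.cons e.tl.tl) (by fun_prop)
    (by fun_prop))

theorem size_sublistsStep_le (a x : Data) : (sublistsStep a x).size ≤ a.size * (x.size + 3) := by
  have h : ∀ l : List Data, (listCode (l.map (Data.cons x))).size ≤
      (listCode l).size * (x.size + 2) := by
    intro l
    induction l with
    | nil => simp [Data.size]
    | cons y l ih =>
      simp only [List.map_cons, listCode_cons, Data.size]
      nlinarith [Data.size_pos y]
  have := Data.size_listCode_append a.toList (a.toList.map (Data.cons x))
  have := h a.toList
  rw [listCode_toList] at *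
  rw [sublistsStep, toList_listCode]
  nlinarith

/-- Later elements are put in front of earlier ones, which is why the sublists are those of the
reversed list. -/
theorem foldl_sublistsStep {α : Type*} (f : α → Data) (l : List α) :
    (l.map f).foldl sublistsStep (Data.cons Data.nil Data.nil) =
      listCode (l.reverse.sublists'.map fun s => listCode (s.map f)) := by
  induction l using List.reverseRecOn with
  | nil => simp
  | append_singleton l x ih =>
    rw [List.map_append, List.foldl_append, ih]
    simp [sublistsStep, Function.comp_def]

theorem size_foldl_sublistsStep_le {S : ℕ} (L : List Data) (hL : ∀ x ∈ L, x.size ≤ S) (a : Data) :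
    (L.foldl sublistsStep a).size ≤ a.size * (S + 3) ^ L.length := by
  induction L generalizing a with
  | nil => simp
  | cons x L ih =>
    have h₁ := ih (fun y hy => hL y (by simp [hy])) (sublistsStep a x)
    have h₂ := (size_sublistsStep_le a x).trans
      (Nat.mul_le_mul_left a.size (Nat.add_le_add_right (hL x (by simp)) 3))
    rw [List.foldl_cons, List.length_cons, pow_succ', ← mul_assoc]
    exact h₁.trans (Nat.mul_le_mul_right _ h₂)

/-- The input, and the lists of its Horn rules. -/
noncomputable def hornSublists (d : Data) : Data :=
  Data.cons d (Data.cons Data.nil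
    ((hornData d).toList.foldl sublistsStep (Data.cons Data.nil Data.nil)))

theorem expo_hornSublists : Expo hornSublists := by
  -- The factor `3` is the size of the initial list, which has the empty list as its only element.
  -- The size of `hornData d` bounds both the number and the sizes of the codes of the Horn rules.
  have hB : EBdd fun d => 3 * ((hornData d).size + 3) ^ (hornData d).size := by
    have hs : PBdd fun d => (hornData d).size := poly_hornData.size_le
    refine (PBdd.const 3).eBdd.mul ⟨_, (hs.add (PBdd.const 3)).mul hs, fun d => ?_⟩
    rw [pow_mul]
    exact Nat.pow_le_pow_left Nat.lt_two_pow_self.le _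
  refine Expo.foldl (s := fun _ => sublistsStep) poly_hornData (Poly.const _) poly_sublistsStep hB
    fun d j => ?_
  refine (size_foldl_sublistsStep_le (S := (hornData d).size) _ (fun x hx =>
    (Data.size_lt_of_mem (List.mem_of_mem_take hx)).le) _).trans ?_
  refine Nat.mul_le_mul le_rfl (Nat.pow_le_pow_right (by omega) ?_)
  exact (List.length_take_le' _ _).trans (Data.length_lt_size _).le

/-! ## Anti-fracturable sets -/

def ConflictData (h h' : Data) : Prop :=
  hornProdData h ∈ (hornPairData h').toList ∨
    ∃ x ∈ (hornPairData h).toList, ∃ y ∈ (hornPairData h').toList, y.hd ∈ x.tl.toList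

/-- `Hs` lists the elements of an anti-fracturable set of Horn rules. -/
def AntiFracturableData (d Hs : Data) : Prop :=
  ∀ h ∈ (hornData d).toList, ∀ h' ∈ Hs.toList, h ∈ Hs.toList ∨ ¬ ConflictData h h'

theorem polyP_conflictData : PolyP fun e => ConflictData e.hd e.tl := by
  unfold ConflictData
  refine (PolyP.mem (poly_hornProdData.comp (by fun_prop))
    (poly_hornPairData.comp (by fun_prop))).or ?_
  refine PolyP.exists (P := fun e x => ∃ y ∈ (hornPairData e.tl).toList, y.hd ∈ x.tl.toList)
    (poly_hornPairData.comp (by fun_prop)) ?_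
  exact PolyP.exists (P := fun e y => y.hd ∈ e.tl.tl.toList)
    (poly_hornPairData.comp (by fun_prop)) (PolyP.mem (by fun_prop) (by fun_prop))

theorem polyP_antiFracturableData : PolyP fun e => AntiFracturableData e.hd e.tl := by
  unfold AntiFracturableData
  refine PolyP.forall (P := fun e h => ∀ h' ∈ e.tl.toList, h ∈ e.tl.toList ∨ ¬ ConflictData h h')
    (poly_hornData.comp (by fun_prop)) ?_
  exact PolyP.forall (P := fun e h' => e.tl ∈ e.hd.tl.toList ∨ ¬ ConflictData e.tl h')
    (by fun_prop) ((PolyP.mem (by fun_prop) (by fun_prop)).or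
      (polyP_conflictData.comp (f := fun e => Data.cons e.hd.tl e.tl) (by fun_prop)).not)

section

variable {n : ℕ} {A : Calculus n}

theorem conflictData_iff {h h' : Rule n} (hh : h.IsHorn) (hh' : h'.IsHorn) :
    ConflictData (hornCode h) (hornCode h') ↔ Conflict h h' := by
  refine or_congr ?_ ?_
  · obtain ⟨p, hp, e⟩ := hornProdData_hornCode hh
    rw [e, mem_hornPairData hh', hp]
    obtain ⟨p', hp', _⟩ := hornProdData_hornCode hh'
    rw [hp']
    constructor
    · rintro ⟨q, hq, e⟩
      rw [prodCode_injective e] at hq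
      exact ESystem.pair_eq_of_mem hq
    · exact fun e => ⟨p, e ▸ ESystem.mem_pair.mpr (Or.inl rfl), rfl⟩
  · have key : ∀ p p' : Production n,
        (prodCode p').hd ∈ (prodCode p).tl.toList ↔ p'.1 ∈ p.2 := fun p p' => by
      simp [prodCode, strCode, List.mem_map_of_injective letterCode_injective]
    simp only [mem_hornPairData hh, mem_hornPairData hh']
    constructor
    · rintro ⟨_, ⟨p, hp, rfl⟩, _, ⟨p', hp', rfl⟩, h⟩
      exact ⟨p, hp, p', hp', (key p p').mp h⟩
    · rintro ⟨p, hp, p', hp', h⟩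
      exact ⟨_, ⟨p, hp, rfl⟩, _, ⟨p', hp', rfl⟩, (key p p').mpr h⟩

theorem hornCode_mem_map_iff {h : Rule n} (hh : h.IsHorn) {l : List (Rule n)}
    (hl : ∀ ρ ∈ l, ρ.IsHorn) : hornCode h ∈ l.map hornCode ↔ h ∈ l := by
  refine ⟨fun hm => ?_, List.mem_map_of_mem⟩
  obtain ⟨ρ, hρ, e⟩ := List.mem_map.mp hm
  rwa [hornCode_injOn hh (hl ρ hρ) e.symm]

/-- By `antiFracturable_iff` it is enough to inspect pairs of Horn rules, which makes the test
polynomial. -/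
theorem antiFracturableData_iff {d : Data} {l s : List (Rule n)}
    (hl : ∀ ρ, ρ ∈ l ↔ ρ ∈ hornRules A) (hd : (hornData d).toList = l.map hornCode)
    (hs : ∀ ρ ∈ s, ρ ∈ l) :
    AntiFracturableData d (listCode (s.map hornCode)) ↔
      AntiFracturable (hornRules A) s.toFinset := by
  have hh : ∀ ρ ∈ l, ρ.IsHorn := fun ρ hρ => isHorn_of_mem_hornRules ρ ((hl ρ).mp hρ)
  have hsub : s.toFinset ⊆ hornRules A := fun ρ hρ => (hl ρ).mp (hs ρ (List.mem_toFinset.mp hρ))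
  rw [antiFracturable_iff isHorn_of_mem_hornRules, and_iff_right hsub]
  rw [AntiFracturableData, hd]
  simp only [toList_listCode, List.forall_mem_map, ← hl, List.mem_toFinset]
  refine forall₂_congr fun h hh₁ => ?_
  constructor
  · intro H hn h' hh'
    rw [← conflictData_iff (hh h hh₁) (hh h' (hs h' hh'))]
    exact (H h' hh').resolve_left fun h => hn ((hornCode_mem_map_iff (hh _ hh₁) fun ρ hρ => hh ρ (hs ρ hρ)).mp h)
  · intro H h' hh'
    rw [hornCode_mem_map_iff (hh _ hh₁) fun ρ hρ => hh ρ (hs ρ hρ),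
      conflictData_iff (hh h hh₁) (hh h' (hs h' hh'))]
    exact or_iff_not_imp_left.mpr fun hn => H hn h' hh'

end

/-! ## The computation of the upward space -/

open Classical in
/-- The anti-fracturable sets, from the result of `hornSublists`. -/
noncomputable def antiFracturableList (e : Data) : Data :=
  listCode (e.tl.tl.toList.filter fun x => AntiFracturableData e.hd x)

open Classical in
/-- The pairs of comparable anti-fracturable sets. -/
noncomputable def comparablePairs (e : Data) : Data :=
  listCode ((listCode ((antiFracturableList e).toList.flatMap fun x =>
    (listCode ((antiFracturableList e).toList.map (Data.cons x))).toList)).toList.filter fun p =>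
      ∀ h ∈ p.hd.toList, h ∈ p.tl.toList)

noncomputable def upSpaceData (e : Data) : Data :=
  Data.cons (listCode ((antiFracturableList e).toList.map (absorbHornData e.hd)))
    (listCode ((comparablePairs e).toList.map fun p =>
      Data.cons (absorbHornData e.hd p.hd) (absorbHornData e.hd p.tl)))

theorem poly_antiFracturableList : Poly antiFracturableList := by
  unfold antiFracturableList
  exact Poly.filter (P := fun e => AntiFracturableData e.hd) (by fun_prop)
    (polyP_antiFracturableData.comp (f := fun e => Data.cons e.hd.hd e.tl) (by fun_prop))

theorem poly_comparablePairs : Poly comparablePairs := by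
  unfold comparablePairs
  refine Poly.filter (P := fun _ p => ∀ h ∈ p.hd.toList, h ∈ p.tl.toList) ?_ ?_
  · exact Poly.flatMap (F := fun e x => listCode ((antiFracturableList e).toList.map (Data.cons x)))
      poly_antiFracturableList (Poly.map (F := fun e => Data.cons e.tl)
        (poly_antiFracturableList.comp (by fun_prop)) (by fun_prop))
  · exact PolyP.forall (P := fun e h => h ∈ e.tl.tl.toList) (by fun_prop)
      (PolyP.mem (by fun_prop) (by fun_prop))

theorem poly_upSpaceData : Poly upSpaceData := by
  unfold upSpaceData
  refine Poly.cons (Poly.map (F := fun e => absorbHornData e.hd) poly_antiFracturableList ?_)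
    (Poly.map (F := fun e p => Data.cons (absorbHornData e.hd p.hd) (absorbHornData e.hd p.tl))
      poly_comparablePairs (Poly.cons ?_ ?_))
  · exact poly_absorbHornData.comp (f := fun e => Data.cons e.hd.hd e.tl) (by fun_prop)
  · exact poly_absorbHornData.comp (f := fun e => Data.cons e.hd.hd e.tl.hd) (by fun_prop)
  · exact poly_absorbHornData.comp (f := fun e => Data.cons e.hd.hd e.tl.tl) (by fun_prop)

theorem setCode_of_list {α β : Type} {code : α → Data → Prop} {s : Set α} {L : List β} {f : β → α}
    {g : β → Data} (hL : L.Nodup) (hf : ∀ a ∈ L, ∀ b ∈ L, f a = f b → a = b)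
    (hs : ∀ x, x ∈ s ↔ ∃ b ∈ L, f b = x) (hc : ∀ b ∈ L, code (f b) (g b)) :
    SetCode code s (listCode (L.map g)) :=
  ⟨L.map f, _, List.Nodup.map_on hf hL, fun x => by rw [hs, List.mem_map], by
    rw [List.forall₂_map_right_iff, List.forall₂_map_left_iff, List.forall₂_same]
    exact hc, rfl⟩

/-- A sublist of a list without repetitions is the list filtered by membership in the sublist. -/
theorem eq_of_sublist_of_mem_iff {α : Type*} {l s s' : List α} (hl : l.Nodup)
    (h : s.Sublist l) (h' : s'.Sublist l) (hm : ∀ x, x ∈ s ↔ x ∈ s') : s = s' := by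
  classical
  have key : ∀ t : List α, t.Sublist l → t = l.filter (· ∈ t) := by
    intro t ht
    have h₁ := ht.filter (· ∈ t)
    rw [List.filter_eq_self.mpr (by simp)] at h₁
    exact h₁.eq_of_length_le (List.subperm_of_subset (hl.filter _) fun x hx => by
      simpa using (List.mem_filter.mp hx).2).length_le
  rw [key s h, key s' h']
  exact List.filter_congr fun x _ => by simp [hm]

/-- Once the sublists of the Horn rules are listed, everything else is polynomial in the size of
that list. -/
theorem upSpaceProblem_expTime : ExpTime upSpaceProblem := by
  classical
  refine ExpTime.of_expo (poly_upSpaceData.comp_expo expo_hornSublists) ?_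
  rintro d O ⟨n, A, ν, hA, _, hd, rfl⟩
  obtain ⟨l, hn, hl, e⟩ := hornData_spec hd
  have hr : l.reverse.Nodup := List.nodup_reverse.mpr hn
  have hsub : ∀ s ∈ l.reverse.sublists', ∀ ρ ∈ s, ρ ∈ l := fun s hs ρ hρ =>
    List.mem_reverse.mp ((List.mem_sublists'.mp hs).subset hρ)
  obtain ⟨L, hLdef⟩ : ∃ L, L = l.reverse.sublists'.filter fun s =>
    AntiFracturable (hornRules A) s.toFinset := ⟨_, rfl⟩
  have hmem : ∀ s, s ∈ L ↔ s.Sublist l.reverse ∧ AntiFracturable (hornRules A) s.toFinset := by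
    simp [hLdef]
  have hLn : L.Nodup := hLdef ▸ (List.nodup_sublists'.mpr hr).filter _
  have hLH : ∀ H, AntiFracturable (hornRules A) H ↔ ∃ s ∈ L, s.toFinset = H := by
    intro H
    constructor
    · intro hH
      have : (l.reverse.filter (· ∈ H)).toFinset = H := by
        ext ρ
        have := hH.subset (x := ρ)
        simp [hl]
        exact this
      exact ⟨_, (hmem _).mpr ⟨List.filter_sublist, by rwa [this]⟩, this⟩
    · rintro ⟨s, hs, rfl⟩
      exact ((hmem s).mp hs).2
  -- Different selected sublists yield different calculi, so neither the members nor the pairs are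
  -- listed twice.
  have hinj : ∀ s ∈ L, ∀ s' ∈ L, absorbHorn A s.toFinset = absorbHorn A s'.toFinset → s = s' := by
    intro s hs s' hs' h
    obtain ⟨h₁, h₂⟩ := (hmem s).mp hs
    obtain ⟨h₃, h₄⟩ := (hmem s').mp hs'
    have := absorbHorn_injOn h₂.subset h₄.subset h
    exact eq_of_sublist_of_mem_iff hr h₁ h₃ fun x => by
      rw [← List.mem_toFinset, this, List.mem_toFinset]
  have hhorn : ∀ s ∈ L, ∀ ρ ∈ s, ρ.IsHorn := fun s hs ρ hρ =>
    isHorn_of_mem_hornRules ρ (((hmem s).mp hs).2.subset (List.mem_toFinset.mpr hρ))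
  have hcode : ∀ s ∈ L, calcCode ν (absorbHorn A s.toFinset)
      (absorbHornData d (listCode (s.map hornCode))) := fun s hs =>
    calcCode_absorbHorn hA hd (hornCodes_of_list (hhorn s hs) (toList_listCode _))
  have hlist : (antiFracturableList (hornSublists d)).toList =
      L.map fun s => listCode (s.map hornCode) := by
    rw [antiFracturableList, hornSublists, e]
    simp only [Data.hd_cons, Data.tl_cons, foldl_sublistsStep, toList_listCode, List.filter_map]
    rw [hLdef]
    congr 1
    refine List.filter_congr fun s hs => ?_
    simp only [Function.comp_apply, antiFracturableData_iff hl e (hsub s hs)]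
  have hpairs : (comparablePairs (hornSublists d)).toList =
      ((L.product L).filter fun p => p.1.toFinset ⊆ p.2.toFinset).map fun p =>
        Data.cons (listCode (p.1.map hornCode)) (listCode (p.2.map hornCode)) := by
    have : (L.product L).map (fun p : List (Rule n) × List (Rule n) =>
        Data.cons (listCode (p.1.map hornCode)) (listCode (p.2.map hornCode))) =
        (L.map fun s => listCode (s.map hornCode)).flatMap fun x =>
          (L.map fun s => listCode (s.map hornCode)).map (Data.cons x) := by
      simp [List.product, List.map_flatMap, List.flatMap_map, Function.comp_def]
    simp only [comparablePairs, hlist, toList_listCode]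
    rw [← this, List.filter_map]
    congr 1
    refine List.filter_congr fun p hp => ?_
    obtain ⟨h₁, h₂⟩ := List.pair_mem_product.mp hp
    simp only [Function.comp_apply, Data.hd_cons, Data.tl_cons, toList_listCode,
      List.forall_mem_map, decide_eq_decide]
    refine (forall₂_congr fun ρ hρ => hornCode_mem_map_iff (hhorn _ h₁ ρ hρ) (hhorn _ h₂)).trans ?_
    simp [Finset.subset_iff]
  have hhd : (hornSublists d).hd = d := rfl
  show (upSpace A).Code ν _
  rw [upSpaceData, hlist, hpairs, List.map_map, List.map_map, hhd]
  refine ⟨_, _, ?_, ?_, rfl⟩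
  · have h₁ : ∀ B, B ∈ (upSpace A).carrier ↔ ∃ s ∈ L, absorbHorn A s.toFinset = B := by
      intro B
      show UpMem A B ↔ _
      rw [upMem_iff]
      simp only [hLH]
      constructor
      · rintro ⟨_, ⟨s, hs, rfl⟩, rfl⟩
        exact ⟨s, hs, rfl⟩
      · rintro ⟨s, hs, rfl⟩
        exact ⟨_, ⟨s, hs, rfl⟩, rfl⟩
    exact setCode_of_list (code := calcCode ν) (s := (upSpace A).carrier) (L := L)
      (f := fun s => absorbHorn A s.toFinset)
      (g := absorbHornData d ∘ fun s => listCode (s.map hornCode)) hLn hinj h₁ hcode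
  · have hm : ∀ p, p ∈ (L.product L).filter (fun p => p.1.toFinset ⊆ p.2.toFinset) ↔
        (p.1 ∈ L ∧ p.2 ∈ L) ∧ p.1.toFinset ⊆ p.2.toFinset := fun p => by
      rw [List.mem_filter, decide_eq_true_iff]
      exact and_congr_left' List.pair_mem_product
    refine setCode_of_list
      (f := fun p => (absorbHorn A p.1.toFinset, absorbHorn A p.2.toFinset))
      ((hLn.product hLn).filter _) (fun p hp q hq h => ?_) (fun q => ?_) fun p hp => ?_
    · obtain ⟨⟨h₁, h₂⟩, _⟩ := (hm p).mp hp
      obtain ⟨⟨h₃, h₄⟩, _⟩ := (hm q).mp hq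
      simp only [Prod.mk.injEq] at h
      exact Prod.ext (hinj _ h₁ _ h₃ h.1) (hinj _ h₂ _ h₄ h.2)
    · rw [mem_upSpace_le_iff]
      simp only [hLH]
      constructor
      · rintro ⟨_, _, ⟨s, hs, rfl⟩, ⟨s', hs', rfl⟩, h, rfl⟩
        exact ⟨(s, s'), (hm _).mpr ⟨⟨hs, hs'⟩, h⟩, rfl⟩
      · rintro ⟨p, hp, rfl⟩
        obtain ⟨⟨h₁, h₂⟩, h⟩ := (hm p).mp hp
        exact ⟨_, _, ⟨_, h₁, rfl⟩, ⟨_, h₂, rfl⟩, h, rfl⟩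
    · obtain ⟨⟨h₁, h₂⟩, _⟩ := (hm p).mp hp
      exact ⟨_, _, hcode _ h₁, hcode _ h₂, by
        simp only [Function.comp_apply, Data.hd_cons, Data.tl_cons]⟩

end AbsCalc

/-! ### The theorem -/

theorem mainTheorem1 :
    (∀ (n : ℕ) (A : Calculus n), Explicit A →
      ImplicateReturns A (upSpace A) ∧
      (∀ B ∈ (upSpace A).carrier, ∀ C ∈ (upSpace A).carrier, PolyEquiv B C) ∧
      (∃! T, (upSpace A).IsTop T) ∧
      ∀ T, (upSpace A).IsTop T → ∀ B ∈ (upSpace A).carrier, Implicit B ↔ B = T) ∧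
    ExpTime upSpaceProblem ∧
    PTime topProblem := by
  refine ⟨fun n A hA => ⟨implicateReturns_upSpace A, fun B hB C hC => ?_,
    ⟨_, isTop_absorbHorn A, fun T hT => eq_of_isTop hT⟩,
    fun T hT B hB => implicit_iff_eq_top hA hT hB⟩, upSpaceProblem_expTime, topProblem_pTime⟩
  obtain ⟨H, hH, rfl⟩ := upMem_iff.mp hB
  obtain ⟨H', hH', rfl⟩ := upMem_iff.mp hC
  exact polyEquiv_absorbHorn hA hH hH'
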